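/- Fix $n\in\mathbb N$ and $\sigma\in(0,1]$. For an open set $\mathcal G\subseteq\mathbb R^n$, a subset $\mathcal V\subseteq\mathcal G$ and $\delta\in(0,1]$, let $\mathcal V_\delta=\bigcup_{I\in\mathcal V}\{\hat I\in\mathbb C^n:|\hat I-I|<\delta\}$ (and likewise $\mathcal G_\delta$), where $|\cdot|$ is the Euclidean norm, and let $$\mathcal D=\mathcal G_\delta\times\{\varphi\in\mathbb C^n:|\mathrm{Im}\,\varphi_j|<2\sigma\ \text{for all } j\}\times\{\xi\in\mathbb C:|\mathrm{Im}\,\xi|<2\sigma\}.$$ Let $h(I)$ and $f(I,\varphi,\xi)$ be holomorphic and bounded on $\mathcal G_\delta$ and $\mathcal D$ respectively, real at real points, with $f$ $2\pi$-periodic in each $\varphi_j$, and set $C_f=\sup_{\mathcal D}|f|$. For $\varepsilon>0$ and $\mu\ge 0$ consider the Hamiltonian $$H(I,\varphi,t)=h(I)+\varepsilon f(I,\varphi,\mu t),\qquad I\in\mathcal G,\ \varphi\in\mathbb T^n,\ t\in\mathbb R,$$ and put $$\tilde{\mathcal F}=C_f\left(\frac{1+e^{-\sigma/2}}{1-e^{-\sigma/2}}\right)^{n},\qquad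 \lambda_{\varepsilon,\mu}=\mu+e\,\tilde{\mathcal F}\,\varepsilon .$$ Let $\mathcal M\subseteq\mathbb Z^n$ be a resonance module, that is, $\mathrm{span}_{\mathbb R}(\mathcal M)\cap\mathbb Z^n=\mathcal M$. Let $r,K\ge 1$ be integers and $\alpha>0$, and suppose that $\mathcal V\subseteq\mathcal G$ is a non-resonance domain of type $(\mathcal M,\alpha,\delta,rK)$: for every $k\in\mathbb Z^n\setminus\mathcal M$ with $|k_1|+\dots+|k_n|<rK$, $$|\langle \partial_I h(I),k\rangle|>\alpha\qquad\text{for all } I\in\mathcal V_\delta .$$ Suppose moreover that $$\Delta:=\frac{2^8 r}{\alpha\delta\sigma}\lambda_{\varepsilon,\mu}+4e^{-K\sigma/2}\le\frac12,\qquad e^{-K\sigma/2}\ge\frac1{8+3e^2}.$$ Then there is a constant $C_1>0$, depending only on $n$, $\sigma$ and $C_f$, with the following property. Let $a<0<b$ and let $(I(t),\varphi(t))$, $t\in[a,b]$, be a solution of the Hamilton equations $\dot I=-\partial_\varphi H$, $\dot\varphi=\partial_I H$ with $I(t)\in\mathcal V$ for all $t\in[a,b]$. Then $$\mathrm{dist}\bigl(I(t),\,I(0)+\mathrm{span}_{\mathbb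 R}(\mathcal M)\bigr)\le\frac{\delta}{2}\qquad\text{for all } t\in[a,b]\cap[-t^*,t^*],\qquad t^*=\frac{e^2\delta}{C_1\,\varepsilon\,\Delta^r},$$ where $\mathrm{dist}$ is the Euclidean distance. -/

import Mathlib

namespace SlowNekhoroshev

/-- The inclusion of the real action space `ℝⁿ` into `ℂⁿ`. -/
noncomputable def toComplex {n : ℕ} (I : EuclideanSpace ℝ (Fin n)) : EuclideanSpace ℂ (Fin n) :=
  WithLp.toLp 2 (fun j => (I j : ℂ))

/-- The complex neighbourhood `V_δ`: the union of the open complex (Euclidean) balls of radius `δ`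
centred at the points of `V`. -/
def actionNhd {n : ℕ} (V : Set (EuclideanSpace ℝ (Fin n))) (δ : ℝ) :
    Set (EuclideanSpace ℂ (Fin n)) :=
  ⋃ I ∈ V, Metric.ball (toComplex I) δ

/-- The complex strip of width `s` over the (universal cover of the) torus: every component
of the imaginary part is smaller than `s`. -/
def angleStrip (n : ℕ) (s : ℝ) : Set (Fin n → ℂ) :=
  {φ | ∀ j, |(φ j).im| < s}

/-- The complex strip of width `s` over the slow time axis. -/
def timeStrip (s : ℝ) : Set ℂ :=
  {ξ | |ξ.im| < s}

/-- The complex domain of the functions of `(I, φ, ξ)`. -/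
def phaseDomain {n : ℕ} (G : Set (EuclideanSpace ℝ (Fin n))) (δ s : ℝ) :
    Set (EuclideanSpace ℂ (Fin n) × (Fin n → ℂ) × ℂ) :=
  actionNhd G δ ×ˢ (angleStrip n s ×ˢ timeStrip s)

/-- The supremum norm over the complex domain (only used for functions bounded there). -/
noncomputable def supNorm {n : ℕ} (G : Set (EuclideanSpace ℝ (Fin n))) (δ s : ℝ)
    (F : EuclideanSpace ℂ (Fin n) × (Fin n → ℂ) × ℂ → ℂ) : ℝ :=
  ⨆ z : phaseDomain G δ s, ‖F z‖

/-- The standing regularity assumption on the Hamiltonian `h(I) + ε f(I, φ, μ t)`: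
`h` and `f` are holomorphic and bounded on the complex domain of widths `δ` and `2 σ`, `f` is
`2π`-periodic in every angle, and both are real at real points. -/
structure IsRegular {n : ℕ} (G : Set (EuclideanSpace ℝ (Fin n))) (δ σ : ℝ)
    (h : EuclideanSpace ℂ (Fin n) → ℂ)
    (f : EuclideanSpace ℂ (Fin n) × (Fin n → ℂ) × ℂ → ℂ) : Prop where
  holo_h : DifferentiableOn ℂ h (actionNhd G δ)
  bdd_h : ∃ B : ℝ, ∀ I ∈ actionNhd G δ, ‖h I‖ ≤ B
  holo_f : DifferentiableOn ℂ f (phaseDomain G δ (2 * σ))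
  bdd_f : ∃ B : ℝ, ∀ z ∈ phaseDomain G δ (2 * σ), ‖f z‖ ≤ B
  periodic_f : ∀ I φ ξ, (I, φ, ξ) ∈ phaseDomain G δ (2 * σ) → ∀ j : Fin n,
    f (I, φ + Pi.single j (2 * Real.pi : ℂ), ξ) = f (I, φ, ξ)
  real_h : ∀ I ∈ G, (h (toComplex I)).im = 0
  real_f : ∀ I ∈ G, ∀ (φ : Fin n → ℝ) (ξ : ℝ),
    (f (toComplex I, fun j => (φ j : ℂ), (ξ : ℂ))).im = 0

/-- An integer vector as a point of `ℝⁿ`. -/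
noncomputable def intVec {n : ℕ} (k : Fin n → ℤ) : EuclideanSpace ℝ (Fin n) :=
  WithLp.toLp 2 (fun j => (k j : ℝ))

/-- The real linear span of a set of integer vectors. -/
noncomputable def realSpan {n : ℕ} (M : Set (Fin n → ℤ)) :
    Submodule ℝ (EuclideanSpace ℝ (Fin n)) :=
  Submodule.span ℝ (intVec '' M)

/-- A resonance module: `span(M) ∩ ℤⁿ = M`. -/
def IsResonanceModule {n : ℕ} (M : Set (Fin n → ℤ)) : Prop :=
  {k : Fin n → ℤ | intVec k ∈ realSpan M} = M

/-- The frequency vector `ω(I) = ∂h/∂I`. -/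
noncomputable def frequency {n : ℕ} (h : EuclideanSpace ℂ (Fin n) → ℂ)
    (I : EuclideanSpace ℂ (Fin n)) (j : Fin n) : ℂ :=
  fderiv ℂ h I (EuclideanSpace.single j 1)

/-- `V` is a non-resonance domain of type `(M, α, δ, N)`: `|⟨ω(I), k⟩| > α` on the complex
neighbourhood `V_δ`, for every integer vector `k` outside `M` with `|k₁| + ⋯ + |kₙ| < N`. -/
def IsNonResonanceDomain {n : ℕ} (h : EuclideanSpace ℂ (Fin n) → ℂ)
    (V : Set (EuclideanSpace ℝ (Fin n))) (M : Set (Fin n → ℤ)) (α δ : ℝ) (N : ℕ) : Prop :=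
  ∀ k : Fin n → ℤ, k ∉ M → ∑ j, (k j).natAbs < N →
    ∀ I ∈ actionNhd V δ, α < ‖∑ j, frequency h I j * (k j : ℂ)‖

/-- The constant `C_f ((1 + e^{-σ/2}) / (1 - e^{-σ/2}))ⁿ`. -/
noncomputable def Ftilde (n : ℕ) (σ Cf : ℝ) : ℝ :=
  Cf * ((1 + Real.exp (-(σ / 2))) / (1 - Real.exp (-(σ / 2)))) ^ n

/-- `λ = μ + e F̃ ε`. -/
noncomputable def lam (n : ℕ) (σ Cf ε μ : ℝ) : ℝ :=
  μ + Real.exp 1 * Ftilde n σ Cf * ε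

/-- `Δ = 2⁸ r λ / (α δ σ) + 4 e^{-Kσ/2}`. -/
noncomputable def smallness (n : ℕ) (σ Cf δ α ε μ : ℝ) (r K : ℕ) : ℝ :=
  2 ^ 8 * (r : ℝ) / (α * δ * σ) * lam n σ Cf ε μ + 4 * Real.exp (-((K : ℝ) * (σ / 2)))

/-- The real time-dependent Hamiltonian `H(I, φ, t) = h(I) + ε f(I, φ, μ t)`. -/
noncomputable def hamiltonian {n : ℕ} (h : EuclideanSpace ℂ (Fin n) → ℂ)
    (f : EuclideanSpace ℂ (Fin n) × (Fin n → ℂ) × ℂ → ℂ) (ε μ : ℝ)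
    (I : EuclideanSpace ℝ (Fin n)) (φ : Fin n → ℝ) (t : ℝ) : ℝ :=
  (h (toComplex I) + (ε : ℂ) * f (toComplex I, fun j => (φ j : ℂ), ((μ * t : ℝ) : ℂ))).re

/-- `(I(t), φ(t))` solves Hamilton's equations `I' = -∂H/∂φ`, `φ' = ∂H/∂I` on `[a, b]`
(one-sided derivatives at the ends; the angles are lifted to `ℝⁿ`). -/
def IsTrajectoryOn {n : ℕ} (H : EuclideanSpace ℝ (Fin n) → (Fin n → ℝ) → ℝ → ℝ)
    (I : ℝ → EuclideanSpace ℝ (Fin n)) (φ : ℝ → Fin n → ℝ) (a b : ℝ) : Prop :=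
  ∀ t ∈ Set.Icc a b, ∀ j : Fin n,
    HasDerivWithinAt (fun s => I s j)
      (-deriv (fun x : ℝ => H (I t) (φ t + Pi.single j x) t) 0) (Set.Icc a b) t ∧
    HasDerivWithinAt (fun s => φ s j)
      (deriv (fun x : ℝ => H (I t + EuclideanSpace.single j x) (φ t) t) 0) (Set.Icc a b) t

/-- The plane of fast drift `I₀ + span(M)`. -/
noncomputable def fastDriftPlane {n : ℕ} (M : Set (Fin n → ℤ))
    (I₀ : EuclideanSpace ℝ (Fin n)) : Set (EuclideanSpace ℝ (Fin n)) :=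
  {J | J - I₀ ∈ realSpan M}

end SlowNekhoroshev

/-!
# Confinement of the actions for slowly time-dependent, nearly integrable Hamiltonians

The component of the displacement `I t - I 0` orthogonal to the plane of fast drift is bounded by
testing it against its own direction `v`. The function `v·I` would be a first integral of any normal
form containing only the Fourier modes in `M`, because `v` is orthogonal to these modes. So the proof
transports `v·I` back through the normalizing transformation, and shows that the resulting observable
`Φ` is almost invariant.

*Algebra.* Everything happens in a Lie algebra of trigonometric polynomials in the angles with
coefficients holomorphic in the actions and in slow time (`Obs`), enlarged by the variable conjugate
to slow time. The Hamiltonian is graded by blocks of Fourier modes of length `K`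
(`IsRegular.expansion`). The normalizing transformation is only used as a formal Lie series
(`lieTransform`) with generators of order at most `r`; no flow is ever constructed. The generators
solve homological equations whose small divisors are bounded below by `α`, since the modes outside
`M` involved at order at most `r` are shorter than `r K`. A Lie transform is a morphism of Lie
algebras (`lieTransform_lie`), so the transform of `v·I` commutes with the Hamiltonian order by order
(`sum_lie_lieTransform_eq_zero`). The bracket of the truncated series `Φ` with the truncated
Hamiltonian therefore consists of terms of order larger than `r` (`lie_sum_eq_remainder`).

*Estimates.* The loss of domain caused by each bracket is controlled by norms of Nagumo type
(`NagumoBound`): the bracket of functions with exponents `p` and `q` has exponent `p + q + 1`, and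
the constant grows like `(p + 1) (q + 1)` (`NagumoBound.trigBracket`). In a Lie transform one of
these two factors is cancelled by the coefficient `1 / s` of the series, and the other one is at most
`r`. The sizes of the generators are then dominated by a scalar convolution recursion (`IsMajorant`),
whose generating function is bounded at the point `2 / Δ` (`IsMajorant.sum_le`). This yields an
observable `Φ` within `δ / 8` of `v·I` at real points whose bracket with the truncated Hamiltonian is
of size `ε Δ ^ r` (`IsPerturbation.exists_almost_invariant`).

*Dynamics.* The Fourier coefficients of the perturbation decay exponentially
(`norm_fourierCoef_le`), so that the modes of length at least `r K` contribute at most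
`ε exp(-r K σ / 2) ≤ ε Δ ^ r` to the velocity of `Φ`
(`IsRegular.exists_hasDerivWithinAt_evalTrig`). The mean value inequality along the trajectory
(`abs_inner_sub_le`) bounds the drift by `δ / 4` plus the speed of `Φ` times the elapsed time, and
the constant in the time scale is chosen to make the second term at most `δ / 4`.
-/

namespace SlowNekhoroshev

/-! ### Formal Lie transforms -/

section LieTransform

open Finset hiding mem_antidiagonal
open Finset.HasAntidiagonal (mem_antidiagonal)

theorem sum_antidiagonal_assoc {N : Type*} [AddCommMonoid N] (f : ℕ → ℕ → ℕ → N) (m : ℕ) :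
    ∑ p ∈ antidiagonal m, ∑ q ∈ antidiagonal p.2, f p.1 q.1 q.2 =
      ∑ p ∈ antidiagonal m, ∑ q ∈ antidiagonal p.1, f q.1 q.2 p.2 := by
  rw [sum_sigma', sum_sigma']
  refine sum_nbij' (fun x => ⟨(x.1.1 + x.2.1, x.2.2), (x.1.1, x.2.1)⟩)
    (fun x => ⟨(x.2.1, x.2.2 + x.1.2), (x.2.2, x.1.2)⟩) ?_ ?_ ?_ ?_ ?_
  all_goals
    rintro ⟨⟨a, b⟩, ⟨c, d⟩⟩ h
    simp only [mem_sigma, mem_antidiagonal] at h ⊢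
  all_goals
    obtain ⟨h1, h2⟩ := h
    subst h2
    first
      | exact ⟨by omega, trivial⟩
      | rfl

theorem sum_antidiagonal_left_comm {N : Type*} [AddCommMonoid N] (f : ℕ → ℕ → ℕ → N) (m : ℕ) :
    ∑ p ∈ antidiagonal m, ∑ q ∈ antidiagonal p.2, f p.1 q.1 q.2 =
      ∑ p ∈ antidiagonal m, ∑ q ∈ antidiagonal p.2, f q.1 p.1 q.2 := by
  rw [sum_sigma', sum_sigma']
  refine sum_nbij' (fun x => ⟨(x.2.1, x.1.1 + x.2.2), (x.1.1, x.2.2)⟩)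
    (fun x => ⟨(x.2.1, x.1.1 + x.2.2), (x.1.1, x.2.2)⟩) ?_ ?_ ?_ ?_ ?_
  all_goals
    rintro ⟨⟨a, b⟩, ⟨c, d⟩⟩ h
    simp only [mem_sigma, mem_antidiagonal] at h ⊢
  all_goals
    obtain ⟨h1, h2⟩ := h
    subst h2
    first
      | exact ⟨by omega, trivial⟩
      | rfl

variable {L : Type*} [LieRing L] [LieAlgebra ℂ L]

/-- The homogeneous parts `E_s` of the Lie transform with generating sequence `X`, where `X j` has
order `j + 1`: the formal series `∑ τ^s E_s F` solves `∂_τ Y = ⁅∑ τ^j X_j, Y⁆` with `Y = F` at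
`τ = 0`. -/
noncomputable def lieTransform (X : ℕ → L) : ℕ → L → L
  | 0, F => F
  | s + 1, F => ((s : ℂ) + 1)⁻¹ • ∑ j : Fin (s + 1), ⁅X j, lieTransform X (s - j) F⁆
  termination_by s => s
  decreasing_by omega

@[simp] theorem lieTransform_zero (X : ℕ → L) (F : L) : lieTransform X 0 F = F := by
  rw [lieTransform]

theorem lieTransform_succ (X : ℕ → L) (s : ℕ) (F : L) :
    lieTransform X (s + 1) F =
      ((s : ℂ) + 1)⁻¹ • ∑ p ∈ antidiagonal s, ⁅X p.1, lieTransform X p.2 F⁆ := by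
  rw [lieTransform, Nat.sum_antidiagonal_eq_sum_range_succ_mk]
  congr 1
  exact Fin.sum_univ_eq_sum_range (fun j => ⁅X j, lieTransform X (s - j) F⁆) (s + 1)

theorem smul_lieTransform_succ (X : ℕ → L) (s : ℕ) (F : L) :
    ((s : ℂ) + 1) • lieTransform X (s + 1) F =
      ∑ p ∈ antidiagonal s, ⁅X p.1, lieTransform X p.2 F⁆ := by
  rw [lieTransform_succ, smul_inv_smul₀]
  exact_mod_cast Nat.succ_ne_zero s

theorem lieTransform_smul (X : ℕ → L) (s : ℕ) (c : ℂ) (F : L) :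
    lieTransform X s (c • F) = c • lieTransform X s F := by
  induction s using Nat.strong_induction_on with
  | _ s ih =>
    cases s with
    | zero => simp
    | succ s =>
      simp only [lieTransform_succ]
      rw [smul_comm c, smul_sum (r := c)]
      congr 1
      refine sum_congr rfl fun p hp => ?_
      rw [ih p.2 (by have := mem_antidiagonal.1 hp; omega), lie_smul]

theorem lieTransform_of_zero (X : ℕ → L) (s : ℕ) : lieTransform X s (0 : L) = 0 := by
  simpa using lieTransform_smul X s 0 0

/-- `E_s` only involves the generators of order at most `s`. -/
theorem lieTransform_congr {X Y : ℕ → L} {s : ℕ} (h : ∀ j < s, X j = Y j) (F : L) :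
    lieTransform X s F = lieTransform Y s F := by
  induction s using Nat.strong_induction_on with
  | _ s ih =>
    cases s with
    | zero => simp
    | succ s =>
      simp only [lieTransform_succ]
      congr 1
      refine sum_congr rfl fun p hp => ?_
      have := mem_antidiagonal.1 hp
      rw [ih p.2 (by omega) fun j hj => h j (by omega), h p.1 (by omega)]

/-- A Lie transform is a morphism of Lie algebras: the Jacobi identity, order by order. -/
theorem lieTransform_lie (X : ℕ → L) (m : ℕ) (F G : L) :
    lieTransform X m ⁅F, G⁆ =
      ∑ p ∈ antidiagonal m, ⁅lieTransform X p.1 F, lieTransform X p.2 G⁆ := by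
  induction m using Nat.strong_induction_on with
  | _ m ih =>
    cases m with
    | zero => simp
    | succ m =>
      have hm : ((m : ℂ) + 1) ≠ 0 := by exact_mod_cast Nat.succ_ne_zero m
      apply smul_right_injective L hm
      simp only
      rw [smul_lieTransform_succ]
      have h1 : ∑ p ∈ antidiagonal m, ⁅X p.1, lieTransform X p.2 ⁅F, G⁆⁆ =
          ∑ p ∈ antidiagonal m, ∑ q ∈ antidiagonal p.2,
            (⁅⁅X p.1, lieTransform X q.1 F⁆, lieTransform X q.2 G⁆ +
              ⁅lieTransform X q.1 F, ⁅X p.1, lieTransform X q.2 G⁆⁆) := by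
        refine sum_congr rfl fun p hp => ?_
        rw [ih p.2 (by have := mem_antidiagonal.1 hp; omega), lie_sum]
        exact sum_congr rfl fun q _ => leibniz_lie _ _ _
      rw [h1]
      simp only [sum_add_distrib]
      rw [sum_antidiagonal_assoc
          (fun a b c => ⁅⁅X a, lieTransform X b F⁆, lieTransform X c G⁆),
        sum_antidiagonal_left_comm
          (fun a b c => ⁅lieTransform X b F, ⁅X a, lieTransform X c G⁆⁆)]
      have h2 : ((m : ℂ) + 1) • ∑ p ∈ antidiagonal (m + 1),
            ⁅lieTransform X p.1 F, lieTransform X p.2 G⁆ =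
          (∑ p ∈ antidiagonal (m + 1), ⁅(p.1 : ℂ) • lieTransform X p.1 F, lieTransform X p.2 G⁆) +
          ∑ p ∈ antidiagonal (m + 1), ⁅lieTransform X p.1 F, (p.2 : ℂ) • lieTransform X p.2 G⁆ := by
        rw [smul_sum, ← sum_add_distrib]
        refine sum_congr rfl fun p hp => ?_
        rw [smul_lie, lie_smul, ← add_smul]
        congr 1
        have := mem_antidiagonal.1 hp
        exact_mod_cast this.symm
      rw [h2, Nat.sum_antidiagonal_succ, Nat.sum_antidiagonal_succ']
      simp only [Nat.cast_zero, zero_smul, zero_lie, lie_zero, zero_add, Nat.cast_add,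
        Nat.cast_one, smul_lieTransform_succ, sum_lie, lie_sum]

/-- If the series `∑ τ^m H_m` satisfies `∂_τ H = ⁅X, H⁆ + E Z`, it is the Lie transform of
`H_0 + ∫ Z`. -/
theorem eq_sum_lieTransform {X Z H : ℕ → L} {r : ℕ}
    (hH : ∀ m < r, ((m : ℂ) + 1) • H (m + 1) = ∑ p ∈ antidiagonal m, ⁅X p.1, H p.2⁆ +
      ∑ p ∈ antidiagonal m, lieTransform X p.1 (Z p.2))
    {N : ℕ → L} (hN0 : N 0 = H 0) (hN : ∀ i : ℕ, ((i : ℂ) + 1) • N (i + 1) = Z i) :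
    ∀ m ≤ r, H m = ∑ p ∈ antidiagonal m, lieTransform X p.1 (N p.2) := by
  intro m
  induction m using Nat.strong_induction_on with
  | _ m ih =>
    intro hmr
    cases m with
    | zero => simp [hN0]
    | succ m =>
      have hm : ((m : ℂ) + 1) ≠ 0 := by exact_mod_cast Nat.succ_ne_zero m
      apply smul_right_injective L hm
      simp only
      rw [hH m (by omega)]
      have h2 : ((m : ℂ) + 1) • ∑ p ∈ antidiagonal (m + 1), lieTransform X p.1 (N p.2) =
          (∑ p ∈ antidiagonal (m + 1), (p.1 : ℂ) • lieTransform X p.1 (N p.2)) +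
          ∑ p ∈ antidiagonal (m + 1), lieTransform X p.1 ((p.2 : ℂ) • N p.2) := by
        rw [smul_sum, ← sum_add_distrib]
        refine sum_congr rfl fun p hp => ?_
        rw [lieTransform_smul, ← add_smul]
        congr 1
        have := mem_antidiagonal.1 hp
        exact_mod_cast this.symm
      rw [h2, Nat.sum_antidiagonal_succ, Nat.sum_antidiagonal_succ']
      simp only [Nat.cast_zero, zero_smul, lieTransform_of_zero, zero_add, Nat.cast_add,
        Nat.cast_one, smul_lieTransform_succ, hN]
      congr 1
      rw [← sum_antidiagonal_assoc (fun a b c => ⁅X a, lieTransform X b (N c)⁆)]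
      refine sum_congr rfl fun p hp => ?_
      have := mem_antidiagonal.1 hp
      rw [ih p.2 (by omega) (by omega), lie_sum]

/-- If `Φ` commutes with the normal form `H_0 + ∫ Z`, its Lie transform commutes with `H`. -/
theorem sum_lie_lieTransform_eq_zero {X Z H : ℕ → L} {r : ℕ}
    (hH : ∀ m < r, ((m : ℂ) + 1) • H (m + 1) = ∑ p ∈ antidiagonal m, ⁅X p.1, H p.2⁆ +
      ∑ p ∈ antidiagonal m, lieTransform X p.1 (Z p.2))
    {Φ : L} (hΦ : ⁅Φ, H 0⁆ = 0) (hΦZ : ∀ i < r, ⁅Φ, Z i⁆ = 0) {m : ℕ} (hm : m ≤ r) :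
    ∑ p ∈ antidiagonal m, ⁅lieTransform X p.1 Φ, H p.2⁆ = 0 := by
  let N : ℕ → L := fun i => Nat.casesOn i (H 0) fun i => ((i : ℂ) + 1)⁻¹ • Z i
  have hN : ∀ i : ℕ, ((i : ℂ) + 1) • N (i + 1) = Z i := fun i => by
    have hi : ((i : ℂ) + 1) ≠ 0 := by exact_mod_cast Nat.succ_ne_zero i
    exact smul_inv_smul₀ hi _
  have hΦN : ∀ i ≤ r, ⁅Φ, N i⁆ = 0 := by
    rintro (_ | i) hi
    · exact hΦ
    · change ⁅Φ, ((i : ℂ) + 1)⁻¹ • Z i⁆ = 0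
      rw [lie_smul, hΦZ i (by omega), smul_zero]
  have key := eq_sum_lieTransform hH (N := N) rfl hN
  calc ∑ p ∈ antidiagonal m, ⁅lieTransform X p.1 Φ, H p.2⁆
      = ∑ p ∈ antidiagonal m, ∑ q ∈ antidiagonal p.2,
          ⁅lieTransform X p.1 Φ, lieTransform X q.1 (N q.2)⁆ := by
        refine sum_congr rfl fun p hp => ?_
        have := mem_antidiagonal.1 hp
        rw [key p.2 (by omega), lie_sum]
    _ = ∑ p ∈ antidiagonal m, lieTransform X p.1 ⁅Φ, N p.2⁆ := by
        rw [sum_antidiagonal_assoc (fun a b c => ⁅lieTransform X a Φ, lieTransform X b (N c)⁆)]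
        exact sum_congr rfl fun p _ => (lieTransform_lie X p.1 Φ (N p.2)).symm
    _ = 0 := by
        refine sum_eq_zero fun p hp => ?_
        have := mem_antidiagonal.1 hp
        rw [hΦN p.2 (by omega), lieTransform_of_zero]

end LieTransform

end SlowNekhoroshev

namespace SlowNekhoroshev

/-! ### Holomorphic functions on open subsets of a normed space -/

section Holomorphic

open Metric Filter Topology MeasureTheory

variable {X : Type*} [NormedAddCommGroup X] [NormedSpace ℂ X]

/-- Cauchy's estimate along a complex line. -/
theorem norm_fderiv_apply_le {U : Set X} (hU : IsOpen U) {f : X → ℂ}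
    (hf : DifferentiableOn ℂ f U) {z y : X} {R C : ℝ} (hR : 0 < R)
    (hmem : ∀ t : ℂ, ‖t‖ ≤ R → z + t • y ∈ U) (hC : ∀ t : ℂ, ‖t‖ ≤ R → ‖f (z + t • y)‖ ≤ C) :
    ‖fderiv ℂ f z y‖ ≤ C / R := by
  have hd : ∀ t : ℂ, HasDerivAt (fun t : ℂ => z + t • y) y t := fun t => by
    simpa using ((hasDerivAt_id t).smul_const y).const_add z
  have hz : z ∈ U := by simpa using hmem 0 (by simpa using hR.le)
  have h0 : HasDerivAt (fun t : ℂ => f (z + t • y)) (fderiv ℂ f z y) 0 := by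
    have hfz : HasFDerivAt f (fderiv ℂ f z) (z + (0 : ℂ) • y) := by
      simpa using (hf.differentiableAt (hU.mem_nhds hz)).hasFDerivAt
    exact hfz.comp_hasDerivAt 0 (hd 0)
  have hdiff : DifferentiableOn ℂ (fun t : ℂ => f (z + t • y)) (closedBall 0 R) := by
    intro t ht
    have ht' : ‖t‖ ≤ R := by simpa using ht
    exact ((hf.differentiableAt (hU.mem_nhds (hmem t ht'))).comp t
      (hd t).differentiableAt).differentiableWithinAt
  rw [← h0.deriv]
  refine Complex.norm_deriv_le_of_forall_mem_sphere_norm_le hR ?_ fun t ht => ?_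
  · exact DifferentiableOn.diffContOnCl (by rwa [closure_ball _ hR.ne'])
  · exact hC t (by simpa using (mem_sphere_zero_iff_norm.1 ht).le)

theorem norm_fderiv_le_of_ball {f : X → ℂ} {z : X} {ρ C : ℝ} (hρ : 0 < ρ)
    (hf : DifferentiableOn ℂ f (ball z ρ)) (hC : ∀ w ∈ ball z ρ, ‖f w‖ ≤ C) :
    ‖fderiv ℂ f z‖ ≤ 2 * C / ρ := by
  have hC0 : 0 ≤ C := (norm_nonneg _).trans (hC z (mem_ball_self hρ))
  refine ContinuousLinearMap.opNorm_le_bound _ (by positivity) fun y => ?_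
  rcases eq_or_ne y 0 with rfl | hy
  · simp
  have hy' : 0 < ‖y‖ := norm_pos_iff.2 hy
  have hmem : ∀ t : ℂ, ‖t‖ ≤ ρ / (2 * ‖y‖) → z + t • y ∈ ball z ρ := fun t ht => by
    rw [mem_ball, dist_eq_norm, add_sub_cancel_left, norm_smul]
    calc ‖t‖ * ‖y‖ ≤ ρ / (2 * ‖y‖) * ‖y‖ := by gcongr
      _ = ρ / 2 := by field_simp
      _ < ρ := by linarith
  have := norm_fderiv_apply_le isOpen_ball hf (z := z) (y := y) (R := ρ / (2 * ‖y‖)) (C := C)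
    (by positivity) hmem fun t ht => hC _ (hmem t ht)
  calc ‖fderiv ℂ f z y‖ ≤ C / (ρ / (2 * ‖y‖)) := this
    _ = 2 * C / ρ * ‖y‖ := by field_simp

variable [FiniteDimensional ℂ X]

theorem clm_eq_sum_coord {ι : Type*} [Fintype ι] (b : Module.Basis ι ℂ X) (T : X →L[ℂ] ℂ) :
    T = ∑ i, T (b i) • LinearMap.toContinuousLinearMap (b.coord i) := by
  ext y
  nth_rewrite 1 [← b.sum_repr y]
  rw [map_sum]
  simp [mul_comm]

/-- An integral depending holomorphically on a parameter, with a bounded integrand, is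
holomorphic. -/
theorem differentiableOn_integral_of_bounded {T : Type*} [MeasurableSpace T] {ν : Measure T}
    [IsFiniteMeasure ν] {U : Set X} (hU : IsOpen U) {g : X → T → ℂ}
    (hg : ∀ t, DifferentiableOn ℂ (fun z => g z t) U)
    (hmeas : ∀ z ∈ U, AEStronglyMeasurable (g z) ν) {C : ℝ} (hC : ∀ z ∈ U, ∀ t, ‖g z t‖ ≤ C) :
    DifferentiableOn ℂ (fun z => ∫ t, g z t ∂ν) U := by
  intro z₀ hz₀
  obtain ⟨ρ, hρ, hρU⟩ := Metric.isOpen_iff.1 hU z₀ hz₀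
  have hint : Integrable (g z₀) ν :=
    Integrable.of_bound (hmeas z₀ hz₀) C (ae_of_all _ fun t => hC z₀ hz₀ t)
  have hball : ∀ z ∈ ball z₀ (ρ / 2), ball z (ρ / 2) ⊆ U := fun z hz =>
    (ball_subset_ball' (by have := mem_ball.1 hz; linarith)).trans hρU
  -- the derivative is measurable in the parameter as a limit of difference quotients
  have happ : ∀ y : X, AEStronglyMeasurable (fun t => fderiv ℂ (fun z => g z t) z₀ y) ν := by
    intro y
    have hlim : Tendsto (fun n : ℕ => z₀ + ((n : ℂ))⁻¹ • y) atTop (𝓝 z₀) := by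
      have h1 : Tendsto (fun n : ℕ => ((n : ℂ))⁻¹) atTop (𝓝 0) :=
        tendsto_inv_atTop_nhds_zero_nat (𝕜 := ℂ)
      simpa using (h1.smul_const y).const_add z₀
    obtain ⟨N, hN⟩ := eventually_atTop.1 (hlim.eventually (hU.mem_nhds hz₀))
    refine aestronglyMeasurable_of_tendsto_ae atTop (f := fun n t =>
      ((n + N : ℕ) : ℂ) * (g (z₀ + (((n + N : ℕ) : ℂ))⁻¹ • y) t - g z₀ t)) (fun n => ?_)
      (ae_of_all _ fun t => ?_)
    · exact ((hmeas _ (hN (n + N) (by omega))).sub (hmeas _ hz₀)).const_mul _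
    · have hd := ((hg t).differentiableAt (hU.mem_nhds hz₀)).hasFDerivAt
      refine hd.lim y ?_
      have h2 : Tendsto (fun n : ℕ => ((n + N : ℕ) : ℝ)) atTop atTop :=
        tendsto_natCast_atTop_atTop.comp (tendsto_add_atTop_nat N)
      refine h2.congr fun n => ?_
      simp only [Complex.norm_natCast]
  have hF' : AEStronglyMeasurable (fun t => fderiv ℂ (fun z => g z t) z₀) ν := by
    let b := Module.finBasis ℂ X
    have heq : (fun t => fderiv ℂ (fun z => g z t) z₀) = fun t => ∑ i,
        (fderiv ℂ (fun z => g z t) z₀ (b i)) • LinearMap.toContinuousLinearMap (b.coord i) := by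
      funext t
      exact clm_eq_sum_coord b _
    rw [heq]
    exact Finset.aestronglyMeasurable_fun_sum _ fun i _ => (happ (b i)).smul_const _
  refine (hasFDerivAt_integral_of_dominated_of_fderiv_le (ball_mem_nhds z₀ (half_pos hρ))
    (F' := fun z t => fderiv ℂ (fun z => g z t) z) (bound := fun _ => 2 * C / (ρ / 2))
    ?_ hint hF' (ae_of_all _ fun t z hz => ?_) (integrable_const _)
    (ae_of_all _ fun t z hz => ?_)).differentiableAt.differentiableWithinAt
  · filter_upwards [hU.mem_nhds hz₀] with z hz using hmeas z hz
  · exact norm_fderiv_le_of_ball (half_pos hρ) ((hg t).mono (hball z hz))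
      fun w hw => hC w (hball z hz hw) t
  · exact ((hg t).differentiableAt
      (hU.mem_nhds (hball z hz (mem_ball_self (half_pos hρ))))).hasFDerivAt

/-- Directional derivatives of holomorphic functions are holomorphic, by Cauchy's formula on
complex lines. -/
theorem differentiableOn_fderiv_apply {U : Set X} (hU : IsOpen U) {f : X → ℂ}
    (hf : DifferentiableOn ℂ f U) (y : X) : DifferentiableOn ℂ (fun z => fderiv ℂ f z y) U := by
  intro z₀ hz₀
  have hcont : ContinuousAt f z₀ := (hf.differentiableAt (hU.mem_nhds hz₀)).continuousAt
  obtain ⟨ρ, hρ, hρU⟩ := Metric.mem_nhds_iff.1 (Filter.inter_mem (hU.mem_nhds hz₀)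
    (hcont.norm.eventually (gt_mem_nhds (lt_add_one ‖f z₀‖))))
  set C := ‖f z₀‖ + 1
  set R : ℝ := ρ / (2 * (‖y‖ + 1))
  have hy1 : 0 < ‖y‖ + 1 := by positivity
  have hR : 0 < R := by positivity
  have hmem : ∀ z ∈ ball z₀ (ρ / 2), ∀ t : ℂ, ‖t‖ ≤ R → z + t • y ∈ ball z₀ ρ := by
    intro z hz t ht
    have h1 : ‖t • y‖ ≤ ρ / 2 := by
      rw [norm_smul]
      calc ‖t‖ * ‖y‖ ≤ R * (‖y‖ + 1) := by gcongr; linarith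
        _ = ρ / 2 := by simp only [R]; field_simp
    rw [mem_ball, dist_eq_norm] at hz ⊢
    calc ‖z + t • y - z₀‖ = ‖(z - z₀) + t • y‖ := by congr 1; abel
      _ ≤ ‖z - z₀‖ + ‖t • y‖ := norm_add_le _ _
      _ < ρ := by linarith
  let c : ℝ → ℂ := fun θ => circleMap 0 R θ
  have hcn : ∀ θ, ‖c θ‖ = R := fun θ => by simp [c, abs_of_pos hR]
  have hcc : Continuous c := continuous_circleMap 0 R
  let g : X → ℝ → ℂ := fun z θ =>
    (2 * Real.pi * Complex.I)⁻¹ * (deriv (circleMap 0 R) θ * ((1 / (c θ) ^ 2) * f (z + c θ • y)))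
  have hformula : ∀ z ∈ ball z₀ (ρ / 2),
      fderiv ℂ f z y = ∫ θ in Set.Ioc 0 (2 * Real.pi), g z θ := by
    intro z hz
    have hd : ∀ t : ℂ, HasDerivAt (fun t : ℂ => z + t • y) y t := fun t => by
      simpa using ((hasDerivAt_id t).smul_const y).const_add z
    have h0 : HasDerivAt (fun t : ℂ => f (z + t • y)) (fderiv ℂ f z y) 0 := by
      have hzU : z ∈ U := by
        simpa using (hρU (hmem z hz 0 (by simpa using hR.le))).1
      have hfz : HasFDerivAt f (fderiv ℂ f z) (z + (0 : ℂ) • y) := by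
        simpa using (hf.differentiableAt (hU.mem_nhds hzU)).hasFDerivAt
      exact hfz.comp_hasDerivAt 0 (hd 0)
    have hdiff : DifferentiableOn ℂ (fun t : ℂ => f (z + t • y)) (closedBall 0 R) := by
      intro t ht
      have ht' : ‖t‖ ≤ R := by simpa using ht
      exact ((hf.differentiableAt (hU.mem_nhds (hρU (hmem z hz t ht')).1)).comp t
        (hd t).differentiableAt).differentiableWithinAt
    have hcauchy := DiffContOnCl.deriv_eq_smul_circleIntegral (f := fun t : ℂ => f (z + t • y))
      hR (c := 0) (DifferentiableOn.diffContOnCl (by rwa [closure_ball _ hR.ne']))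
    rw [h0.deriv] at hcauchy
    have hne : (2 * Real.pi * Complex.I : ℂ) ≠ 0 := Complex.two_pi_I_ne_zero
    rw [smul_eq_mul] at hcauchy
    rw [← mul_right_inj' hne, ← hcauchy, circleIntegral,
      intervalIntegral.integral_of_le Real.two_pi_pos.le, ← integral_const_mul]
    refine integral_congr_ae (ae_of_all _ fun θ => ?_)
    simp only [g, c, smul_eq_mul, sub_zero]
    field_simp
  have hdiffg : DifferentiableOn ℂ (fun z => ∫ θ in Set.Ioc 0 (2 * Real.pi), g z θ)
      (ball z₀ (ρ / 2)) := by
    refine differentiableOn_integral_of_bounded isOpen_ball (C := C / R) (fun θ => ?_)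
      (fun z hz => ?_) fun z hz θ => ?_
    · intro z hz
      have hw := (hρU (hmem z hz (c θ) (hcn θ).le)).1
      have h1 : DifferentiableAt ℂ (fun z => f (z + c θ • y)) z :=
        (hf.differentiableAt (hU.mem_nhds hw)).comp z
          (differentiableAt_id.add_const (c θ • y))
      exact (((h1.const_mul _).const_mul _).const_mul _).differentiableWithinAt
    · have h1 : Continuous fun θ => f (z + c θ • y) := by
        refine continuous_iff_continuousAt.2 fun θ => ?_
        have hw := (hρU (hmem z hz (c θ) (hcn θ).le)).1
        exact ContinuousAt.comp (f := fun θ => z + c θ • y)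
          (hf.differentiableAt (hU.mem_nhds hw)).continuousAt
          (continuous_const.add (hcc.smul continuous_const)).continuousAt
      have h2 : Continuous fun θ => 1 / (c θ) ^ 2 :=
        continuous_const.div (hcc.pow 2) fun θ => pow_ne_zero _ fun h => by
          have := hcn θ
          rw [h, norm_zero] at this
          exact hR.ne this
      have h3 : Continuous (deriv (circleMap 0 R)) := by
        have : deriv (circleMap 0 R) = fun θ => circleMap 0 R θ * Complex.I := by
          funext θ; simp
        rw [this]
        exact hcc.mul continuous_const
      exact (continuous_const.mul (h3.mul (h2.mul h1))).aestronglyMeasurable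
    · have hw := (hρU (hmem z hz (c θ) (hcn θ).le)).2
      have hwC : ‖f (z + c θ • y)‖ ≤ C := le_of_lt hw
      have h2 : ‖deriv (circleMap 0 R) θ‖ = R := by simp [abs_of_pos hR]
      have hpi : ‖(2 * Real.pi * Complex.I : ℂ)‖⁻¹ ≤ 1 := by
        apply inv_le_one_of_one_le₀
        simp only [norm_mul, Complex.norm_ofNat, Complex.norm_real, Complex.norm_I, mul_one,
          Real.norm_eq_abs, abs_of_pos Real.pi_pos]
        nlinarith [Real.pi_gt_three]
      simp only [g, norm_mul, norm_inv, h2, norm_div, norm_pow, hcn, norm_one] at *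
      calc _ ≤ 1 * (R * (1 / R ^ 2 * C)) := by gcongr
        _ = C / R := by field_simp
  have heq : (fun z => fderiv ℂ f z y) =ᶠ[𝓝 z₀] fun z => ∫ θ in Set.Ioc 0 (2 * Real.pi), g z θ := by
    filter_upwards [ball_mem_nhds z₀ (half_pos hρ)] with z hz using hformula z hz
  exact (heq.differentiableAt_iff.2 (hdiffg.differentiableAt
    (ball_mem_nhds z₀ (half_pos hρ)))).differentiableWithinAt

theorem differentiableOn_fderiv {U : Set X} (hU : IsOpen U) {f : X → ℂ}
    (hf : DifferentiableOn ℂ f U) : DifferentiableOn ℂ (fderiv ℂ f) U := by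
  let b := Module.finBasis ℂ X
  have heq : fderiv ℂ f = fun z => ∑ i,
      (fderiv ℂ f z (b i)) • LinearMap.toContinuousLinearMap (b.coord i) := by
    funext z
    exact clm_eq_sum_coord b _
  rw [heq]
  exact DifferentiableOn.fun_sum fun i _ =>
    (differentiableOn_fderiv_apply hU hf (b i)).smul_const _

theorem fderiv_fderiv_apply_comm {U : Set X} (hU : IsOpen U) {f : X → ℂ}
    (hf : DifferentiableOn ℂ f U) {z : X} (hz : z ∈ U) (y w : X) :
    fderiv ℂ (fun z => fderiv ℂ f z y) z w = fderiv ℂ (fun z => fderiv ℂ f z w) z y := by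
  have h2 := ((differentiableOn_fderiv hU hf).differentiableAt (hU.mem_nhds hz)).hasFDerivAt
  have hsymm := second_derivative_symmetric_of_eventually (x := z) (f' := fderiv ℂ f) (by
    filter_upwards [hU.mem_nhds hz] with v hv
    exact (hf.differentiableAt (hU.mem_nhds hv)).hasFDerivAt) h2
  have happ : ∀ y : X, HasFDerivAt (fun z => fderiv ℂ f z y)
      ((fderiv ℂ (fderiv ℂ f) z).flip y) z := fun y => by
    have := h2.clm_apply (hasFDerivAt_const y z)
    simpa using this
  rw [(happ y).fderiv, (happ w).fderiv]
  exact hsymm w y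

end Holomorphic

end SlowNekhoroshev

namespace SlowNekhoroshev

/-! ### The Lie algebra of trigonometric polynomials with holomorphic coefficients -/

section Algebra

open TopologicalSpace (Opens)

/-- The complex space of pairs (action, slow time). -/
abbrev ActTime (n : ℕ) := EuclideanSpace ℂ (Fin n) × ℂ

variable {n : ℕ}

/-- The holomorphic functions on an open set `U`, as a space of functions on the whole space which
vanish off `U`. -/
noncomputable def holSubmodule (U : Opens (ActTime n)) : Submodule ℂ (ActTime n → ℂ) where
  carrier := {f | DifferentiableOn ℂ f U ∧ ∀ z ∉ U, f z = 0}
  add_mem' := fun ha hb => ⟨ha.1.add hb.1, fun z hz => by simp [ha.2 z hz, hb.2 z hz]⟩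
  zero_mem' := ⟨differentiableOn_const 0, fun _ _ => rfl⟩
  smul_mem' := fun c _ ha => ⟨ha.1.const_smul c, fun z hz => by simp [ha.2 z hz]⟩

/-- The type of holomorphic functions on an open set `U`. They are represented by functions on the
whole space which vanish off `U`, so that functions agreeing on `U` are equal. -/
def Hol (U : Opens (ActTime n)) : Type := ↥(holSubmodule U)

variable {U : Opens (ActTime n)}

namespace Hol

noncomputable instance : AddCommGroup (Hol U) := inferInstanceAs (AddCommGroup ↥(holSubmodule U))

noncomputable instance : Module ℂ (Hol U) := inferInstanceAs (Module ℂ ↥(holSubmodule U))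

instance : CoeFun (Hol U) fun _ => ActTime n → ℂ := ⟨fun f => f.1⟩

noncomputable instance : Mul (Hol U) := ⟨fun f g =>
  ⟨fun z => f z * g z, f.2.1.mul g.2.1, fun z hz => by simp [f.2.2 z hz]⟩⟩

theorem differentiableOn (f : Hol U) : DifferentiableOn ℂ f U := f.2.1

theorem differentiableAt (f : Hol U) {z : ActTime n} (hz : z ∈ U) : DifferentiableAt ℂ f z :=
  f.2.1.differentiableAt (U.isOpen.mem_nhds hz)

theorem apply_of_notMem (f : Hol U) {z : ActTime n} (hz : z ∉ U) : f z = 0 := f.2.2 z hz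

theorem ext_on {f g : Hol U} (h : ∀ z ∈ U, f z = g z) : f = g := by
  apply Subtype.ext
  funext z
  by_cases hz : z ∈ U
  · exact h z hz
  · exact (f.apply_of_notMem hz).trans (g.apply_of_notMem hz).symm

open scoped Classical in
/-- The restriction to `U` of a function holomorphic there. -/
noncomputable def ofFun (f : ActTime n → ℂ)
    (hf : DifferentiableOn ℂ f (U : Set (ActTime n))) : Hol U :=
  ⟨fun z => if z ∈ U then f z else 0,
    hf.congr fun _ hz => if_pos hz, fun _ hz => if_neg hz⟩

theorem ofFun_apply {f : ActTime n → ℂ} {hf : DifferentiableOn ℂ f (U : Set (ActTime n))}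
    {z : ActTime n} (hz : z ∈ U) : ofFun f hf z = f z := if_pos hz

theorem fderiv_ofFun {f : ActTime n → ℂ} {hf : DifferentiableOn ℂ f (U : Set (ActTime n))}
    {z : ActTime n} (hz : z ∈ U) : fderiv ℂ (ofFun f hf) z = fderiv ℂ f z := by
  apply Filter.EventuallyEq.fderiv_eq
  filter_upwards [U.isOpen.mem_nhds hz] with w hw using ofFun_apply hw

theorem add_apply (f g : Hol U) (z : ActTime n) : (f + g) z = f z + g z := rfl

theorem sub_apply (f g : Hol U) (z : ActTime n) : (f - g) z = f z - g z := rfl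

theorem neg_apply (f : Hol U) (z : ActTime n) : (-f) z = -f z := rfl

theorem mul_apply (f g : Hol U) (z : ActTime n) : (f * g) z = f z * g z := rfl

theorem smul_apply (c : ℂ) (f : Hol U) (z : ActTime n) : (c • f) z = c * f z := rfl

theorem zero_apply (z : ActTime n) : (0 : Hol U) z = 0 := rfl

/-- The derivative in a fixed direction. -/
noncomputable def dir (y : ActTime n) : Hol U →ₗ[ℂ] Hol U where
  toFun f := ofFun (fun z => fderiv ℂ f z y)
    (differentiableOn_fderiv_apply U.isOpen f.differentiableOn y)
  map_add' f g := ext_on fun z hz => by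
    rw [add_apply, ofFun_apply hz, ofFun_apply hz, ofFun_apply hz]
    change fderiv ℂ ((f : ActTime n → ℂ) + (g : ActTime n → ℂ)) z y = _
    rw [fderiv_add (f.differentiableAt hz) (g.differentiableAt hz)]
    rfl
  map_smul' c f := ext_on fun z hz => by
    rw [RingHom.id_apply, smul_apply, ofFun_apply hz, ofFun_apply hz]
    change fderiv ℂ (c • (f : ActTime n → ℂ)) z y = _
    rw [fderiv_const_smul (f.differentiableAt hz)]
    rfl

theorem dir_apply (y : ActTime n) (f : Hol U) {z : ActTime n} (hz : z ∈ U) :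
    dir y f z = fderiv ℂ f z y :=
  ofFun_apply (hf := differentiableOn_fderiv_apply U.isOpen f.differentiableOn y) hz

theorem fderiv_dir (y : ActTime n) (f : Hol U) {z : ActTime n} (hz : z ∈ U) :
    fderiv ℂ (dir y f) z = fderiv ℂ (fun z => fderiv ℂ f z y) z :=
  fderiv_ofFun (hf := differentiableOn_fderiv_apply U.isOpen f.differentiableOn y) hz

theorem dir_add (y w : ActTime n) (f : Hol U) : dir (y + w) f = dir y f + dir w f :=
  ext_on fun z hz => by
    rw [add_apply, dir_apply _ _ hz, dir_apply _ _ hz, dir_apply _ _ hz, map_add]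

theorem dir_zero (f : Hol U) : dir 0 f = 0 :=
  ext_on fun z hz => by rw [dir_apply _ _ hz, map_zero, zero_apply]

theorem dir_mul (y : ActTime n) (f g : Hol U) : dir y (f * g) = dir y f * g + f * dir y g :=
  ext_on fun z hz => by
    rw [add_apply, mul_apply, mul_apply, dir_apply _ _ hz, dir_apply _ _ hz, dir_apply _ _ hz]
    change fderiv ℂ ((f : ActTime n → ℂ) * (g : ActTime n → ℂ)) z y = _
    rw [fderiv_mul (f.differentiableAt hz) (g.differentiableAt hz)]
    simp
    ring

theorem dir_comm (y w : ActTime n) (f : Hol U) : dir y (dir w f) = dir w (dir y f) :=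
  ext_on fun z hz => by
    rw [dir_apply _ _ hz, dir_apply _ _ hz, fderiv_dir _ _ hz, fderiv_dir _ _ hz]
    exact fderiv_fderiv_apply_comm U.isOpen f.differentiableOn hz w y

end Hol

/-- The direction `k ∂_I` attached to the Fourier mode `k`. -/
noncomputable def modeDir (k : Fin n → ℤ) : ActTime n := (WithLp.toLp 2 (fun j => (k j : ℂ)), 0)

theorem modeDir_add (k l : Fin n → ℤ) : modeDir (k + l) = modeDir k + modeDir l := by
  simp only [modeDir, Prod.mk_add_mk, add_zero, Prod.mk.injEq, and_true]
  ext j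
  simp

theorem modeDir_zero : modeDir (0 : Fin n → ℤ) = 0 := by
  simp only [modeDir, Prod.mk_eq_zero, and_true]
  ext j
  simp

/-- The direction of slow time. -/
def timeDir : ActTime n := (0, 1)

/-- Trigonometric polynomials `∑ F_k(I, ξ) exp(i k·φ)` with holomorphic coefficients. -/
abbrev Trig (U : Opens (ActTime n)) := (Fin n → ℤ) →₀ Hol U

/-- The coefficient of `exp(i (k + l)·φ)` in `-i` times the Poisson bracket of `f exp(i k·φ)` and
`g exp(i l·φ)`. The sign of the Poisson bracket is that of `∂_I F · ∂_φ G - ∂_φ F · ∂_I G`; the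
factor `-i` clears the imaginary units produced by the derivatives of the exponentials. -/
noncomputable def modeBracket (k l : Fin n → ℤ) : Hol U →ₗ[ℂ] Hol U →ₗ[ℂ] Hol U :=
  LinearMap.mk₂ ℂ (fun f g => Hol.dir (modeDir l) f * g - f * Hol.dir (modeDir k) g)
    (fun f f' g => Hol.ext_on fun z _ => by
      simp only [map_add, Hol.add_apply, Hol.sub_apply, Hol.mul_apply]; ring)
    (fun c f g => Hol.ext_on fun z _ => by
      simp only [map_smul, Hol.smul_apply, Hol.sub_apply, Hol.mul_apply]; ring)
    (fun f g g' => Hol.ext_on fun z _ => by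
      simp only [map_add, Hol.add_apply, Hol.sub_apply, Hol.mul_apply]; ring)
    (fun c f g => Hol.ext_on fun z _ => by
      simp only [map_smul, Hol.smul_apply, Hol.sub_apply, Hol.mul_apply]; ring)

theorem modeBracket_apply (k l : Fin n → ℤ) (f g : Hol U) :
    modeBracket k l f g = Hol.dir (modeDir l) f * g - f * Hol.dir (modeDir k) g := rfl

/-- `-i` times the Poisson bracket of trigonometric polynomials. -/
noncomputable def trigBracket : Trig U →ₗ[ℂ] Trig U →ₗ[ℂ] Trig U :=
  Finsupp.lsum ℂ fun k => (Finsupp.lsum ℂ fun l =>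
    ((modeBracket k l).compr₂ (Finsupp.lsingle (k + l))).flip).flip

theorem trigBracket_single (k l : Fin n → ℤ) (f g : Hol U) :
    trigBracket (Finsupp.single k f) (Finsupp.single l g) =
      Finsupp.single (k + l) (modeBracket k l f g) := by
  simp [trigBracket]

theorem trigBracket_eq_sum (F G : Trig U) :
    trigBracket F G = F.sum fun k f => G.sum fun l g =>
      Finsupp.single (k + l) (modeBracket k l f g) := by
  conv_lhs => rw [← Finsupp.sum_single F, ← Finsupp.sum_single G]
  simp only [Finsupp.sum, map_sum, LinearMap.sum_apply, trigBracket_single]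
  exact Finset.sum_comm

theorem trigBracket_self (F : Trig U) : trigBracket F F = 0 := by
  have hsymm : ∀ F G : Trig U, trigBracket F G = -trigBracket G F := by
    intro F G
    induction F using Finsupp.induction_linear with
    | zero => simp
    | add F F' h h' => simp [h, h', add_comm]
    | single k f =>
      induction G using Finsupp.induction_linear with
      | zero => simp
      | add F F' h h' => simp [h, h', add_comm]
      | single l g =>
        rw [trigBracket_single, trigBracket_single, ← Finsupp.single_neg, add_comm]
        congr 1
        refine Hol.ext_on fun z _ => ?_
        simp only [modeBracket_apply, Hol.neg_apply, Hol.sub_apply, Hol.mul_apply]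
        ring
  have h := hsymm F F
  have h2 : (2 : ℂ) • trigBracket F F = 0 := by
    rw [two_smul]
    nth_rewrite 1 [h]
    simp
  exact (smul_eq_zero.1 h2).resolve_left two_ne_zero

theorem trigBracket_neg_swap (F G : Trig U) : trigBracket F G = -trigBracket G F := by
  have h := trigBracket_self (F + G)
  simp only [map_add, LinearMap.add_apply, trigBracket_self, zero_add, add_zero] at h
  rw [add_comm] at h
  exact eq_neg_of_add_eq_zero_left h

theorem trigBracket_jacobi (F G H : Trig U) :
    trigBracket F (trigBracket G H) =
      trigBracket (trigBracket F G) H + trigBracket G (trigBracket F H) := by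
  induction F using Finsupp.induction_linear with
  | zero => simp
  | add F F' h h' => simp only [map_add, LinearMap.add_apply, h, h']; abel
  | single k f =>
    induction G using Finsupp.induction_linear with
    | zero => simp
    | add F F' h h' => simp only [map_add, LinearMap.add_apply, h, h']; abel
    | single l g =>
      induction H using Finsupp.induction_linear with
      | zero => simp
      | add F F' h h' => simp only [map_add, h, h']; abel
      | single m e =>
        simp only [trigBracket_single]
        rw [show l + (k + m) = k + (l + m) by abel, show k + l + m = k + (l + m) by abel,
          ← Finsupp.single_add]
        congr 1
        simp only [modeBracket_apply, modeDir_add, Hol.dir_add, map_sub, LinearMap.sub_apply,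
          Hol.dir_mul]
        rw [Hol.dir_comm (modeDir m) (modeDir l) f, Hol.dir_comm (modeDir m) (modeDir k) g,
          Hol.dir_comm (modeDir k) (modeDir l) e]
        refine Hol.ext_on fun z _ => ?_
        simp only [Hol.add_apply, Hol.sub_apply, Hol.mul_apply]
        ring

/-- The derivative with respect to slow time. -/
noncomputable def timeDeriv : Trig U →ₗ[ℂ] Trig U := Finsupp.mapRange.linearMap (Hol.dir timeDir)

theorem timeDeriv_single (k : Fin n → ℤ) (f : Hol U) :
    timeDeriv (Finsupp.single k f) = Finsupp.single k (Hol.dir timeDir f) := by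
  simp [timeDeriv]

theorem timeDeriv_trigBracket (F G : Trig U) :
    timeDeriv (trigBracket F G) = trigBracket (timeDeriv F) G + trigBracket F (timeDeriv G) := by
  induction F using Finsupp.induction_linear with
  | zero => simp
  | add F F' h h' => simp only [map_add, LinearMap.add_apply, h, h']; abel
  | single k f =>
    induction G using Finsupp.induction_linear with
    | zero => simp
    | add F F' h h' => simp only [map_add, h, h']; abel
    | single l g =>
      simp only [trigBracket_single, timeDeriv_single, ← Finsupp.single_add]
      congr 1
      simp only [modeBracket_apply, map_sub, Hol.dir_mul]
      rw [Hol.dir_comm timeDir (modeDir l) f, Hol.dir_comm timeDir (modeDir k) g]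
      refine Hol.ext_on fun z _ => ?_
      simp only [Hol.add_apply, Hol.sub_apply, Hol.mul_apply]
      ring

/-- The extended algebra: pairs `(F, c)` stand for `F(I, φ, ξ) + c η`, where `η` is `-i` times the
variable conjugate to slow time, so that the bracket with `η` is the derivative with respect to
`ξ`. -/
@[ext] structure Obs (U : Opens (ActTime n)) where
  /-- the trigonometric polynomial -/
  fn : Trig U
  /-- the coefficient of `η` -/
  eta : ℂ

namespace Obs

/-- An extended observable as a pair. -/
def equivProd : Obs U ≃ Trig U × ℂ where
  toFun x := (x.fn, x.eta)
  invFun p := ⟨p.1, p.2⟩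
  left_inv _ := rfl
  right_inv _ := rfl

noncomputable instance : AddCommGroup (Obs U) := equivProd.addCommGroup

noncomputable instance : Module ℂ (Obs U) := equivProd.module ℂ

@[simp] theorem add_fn (x y : Obs U) : (x + y).fn = x.fn + y.fn := rfl
@[simp] theorem add_eta (x y : Obs U) : (x + y).eta = x.eta + y.eta := rfl
@[simp] theorem sub_fn (x y : Obs U) : (x - y).fn = x.fn - y.fn := rfl
@[simp] theorem sub_eta (x y : Obs U) : (x - y).eta = x.eta - y.eta := rfl
@[simp] theorem zero_fn : (0 : Obs U).fn = 0 := rfl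
@[simp] theorem zero_eta : (0 : Obs U).eta = 0 := rfl
@[simp] theorem smul_fn (c : ℂ) (x : Obs U) : (c • x).fn = c • x.fn := rfl
@[simp] theorem smul_eta (c : ℂ) (x : Obs U) : (c • x).eta = c * x.eta := rfl

@[simp] theorem sum_fn {ι : Type*} (s : Finset ι) (x : ι → Obs U) :
    (∑ i ∈ s, x i).fn = ∑ i ∈ s, (x i).fn := by
  classical
  induction s using Finset.induction_on with
  | empty => simp
  | insert i s hi ih => rw [Finset.sum_insert hi, Finset.sum_insert hi, add_fn, ih]

@[simp] theorem sum_eta {ι : Type*} (s : Finset ι) (x : ι → Obs U) :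
    (∑ i ∈ s, x i).eta = ∑ i ∈ s, (x i).eta := by
  classical
  induction s using Finset.induction_on with
  | empty => simp
  | insert i s hi ih => rw [Finset.sum_insert hi, Finset.sum_insert hi, add_eta, ih]

noncomputable instance : Bracket (Obs U) (Obs U) where
  bracket x y :=
    ⟨trigBracket x.fn y.fn + y.eta • timeDeriv x.fn - x.eta • timeDeriv y.fn, 0⟩

theorem lie_fn (x y : Obs U) :
    ⁅x, y⁆.fn = trigBracket x.fn y.fn + y.eta • timeDeriv x.fn - x.eta • timeDeriv y.fn := rfl

@[simp] theorem lie_eta (x y : Obs U) : ⁅x, y⁆.eta = 0 := rfl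

noncomputable instance : LieRing (Obs U) where
  add_lie x y z := by
    ext1
    · simp only [lie_fn, add_fn, add_eta, map_add, LinearMap.add_apply, smul_add, add_smul]; abel
    · simp
  lie_add x y z := by
    ext1
    · simp only [lie_fn, add_fn, add_eta, map_add, smul_add, add_smul]; abel
    · simp
  lie_self x := by
    ext1
    · simp [lie_fn, trigBracket_self]
    · simp
  leibniz_lie x y z := by
    ext1
    · simp only [lie_fn, add_fn, lie_eta, zero_smul, sub_zero, add_zero, map_add, map_sub,
        map_smul, LinearMap.add_apply, LinearMap.sub_apply, LinearMap.smul_apply, smul_add,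
        smul_sub, timeDeriv_trigBracket]
      rw [trigBracket_jacobi x.fn y.fn z.fn]
      rw [trigBracket_neg_swap y.fn (timeDeriv x.fn)]
      module
    · simp

noncomputable instance : LieAlgebra ℂ (Obs U) where
  lie_smul c x y := by
    ext1
    · simp only [lie_fn, smul_fn, smul_eta, map_smul]
      module
    · simp

end Obs

end Algebra

end SlowNekhoroshev

namespace SlowNekhoroshev

/-! ### Weighted norms and the estimate of the bracket -/

section Norms

open TopologicalSpace (Opens)
open scoped ENNReal

variable {n : ℕ}

/-- The complex neighbourhood of `V × ℝ` of widths `δ` and `σ`, shrunk by the factor `1 - u`. -/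
def dom (V : Set (EuclideanSpace ℝ (Fin n))) (δ σ u : ℝ) : Opens (ActTime n) where
  carrier := actionNhd V ((1 - u) * δ) ×ˢ timeStrip ((1 - u) * σ)
  is_open' := by
    refine IsOpen.prod (isOpen_biUnion fun _ _ => Metric.isOpen_ball) ?_
    exact isOpen_lt (continuous_abs.comp Complex.continuous_im) continuous_const

variable {V : Set (EuclideanSpace ℝ (Fin n))} {δ σ : ℝ}

theorem mem_dom {u : ℝ} {z : ActTime n} :
    z ∈ dom V δ σ u ↔ z.1 ∈ actionNhd V ((1 - u) * δ) ∧ |z.2.im| < (1 - u) * σ := Iff.rfl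

theorem dom_add_mem {u u' : ℝ} {z w : ActTime n} (hz : z ∈ dom V δ σ u)
    (h1 : ‖w.1‖ ≤ (u - u') * δ) (h2 : ‖w.2‖ ≤ (u - u') * σ) : z + w ∈ dom V δ σ u' := by
  rw [mem_dom] at hz ⊢
  obtain ⟨hz1, hz2⟩ := hz
  simp only [actionNhd, Set.mem_iUnion] at hz1 ⊢
  obtain ⟨J, hJ, hzJ⟩ := hz1
  refine ⟨⟨J, hJ, ?_⟩, ?_⟩
  · rw [Metric.mem_ball, dist_eq_norm] at hzJ ⊢
    calc ‖(z + w).1 - toComplex J‖ = ‖(z.1 - toComplex J) + w.1‖ := by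
          congr 1; rw [Prod.fst_add]; abel
      _ ≤ ‖z.1 - toComplex J‖ + ‖w.1‖ := norm_add_le _ _
      _ < (1 - u') * δ := by linarith
  · have h3 := Complex.abs_im_le_norm w.2
    calc |(z + w).2.im| = |z.2.im + w.2.im| := by simp
      _ ≤ |z.2.im| + |w.2.im| := abs_add_le _ _
      _ < (1 - u') * σ := by linarith

theorem dom_anti {u u' : ℝ} (hu : u' ≤ u) (hδ : 0 ≤ δ) (hσ : 0 ≤ σ) :
    dom V δ σ u ≤ dom V δ σ u' := fun z hz => by
  have h1 : 0 ≤ (u - u') * δ := mul_nonneg (by linarith) hδ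
  have h2 : 0 ≤ (u - u') * σ := mul_nonneg (by linarith) hσ
  simpa using dom_add_mem (w := 0) (z := z) hz (by simpa using h1) (by simpa using h2)

/-- The supremum over the shrunk domain. -/
noncomputable def supOn (V : Set (EuclideanSpace ℝ (Fin n))) (δ σ u : ℝ)
    (f : ActTime n → ℂ) : ℝ≥0∞ := ⨆ z ∈ dom V δ σ u, ‖f z‖ₑ

theorem le_supOn {u : ℝ} {f : ActTime n → ℂ} {z : ActTime n} (hz : z ∈ dom V δ σ u) :
    ‖f z‖ₑ ≤ supOn V δ σ u f := le_iSup₂ (f := fun z _ => ‖f z‖ₑ) z hz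

theorem supOn_le_mul {u : ℝ} {f g : ActTime n → ℂ} {a : ℝ} (ha : 0 ≤ a)
    (h : ∀ z ∈ dom V δ σ u, ‖f z‖ ≤ a * ‖g z‖) :
    supOn V δ σ u f ≤ ENNReal.ofReal a * supOn V δ σ u g := by
  refine iSup₂_le fun z hz => ?_
  calc ‖f z‖ₑ = ENNReal.ofReal ‖f z‖ := (ofReal_norm _).symm
    _ ≤ ENNReal.ofReal (a * ‖g z‖) := ENNReal.ofReal_le_ofReal (h z hz)
    _ = ENNReal.ofReal a * ‖g z‖ₑ := by rw [ENNReal.ofReal_mul ha, ofReal_norm]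
    _ ≤ _ := by gcongr; exact le_supOn hz

theorem supOn_le_ofReal {u : ℝ} {f : ActTime n → ℂ} {a : ℝ}
    (h : ∀ z ∈ dom V δ σ u, ‖f z‖ ≤ a) : supOn V δ σ u f ≤ ENNReal.ofReal a := by
  refine iSup₂_le fun z hz => ?_
  rw [← ofReal_norm]
  exact ENNReal.ofReal_le_ofReal (h z hz)

/-- The length `|k₁| + ⋯ + |kₙ|` of a Fourier mode. -/
def modeLen (k : Fin n → ℤ) : ℕ := ∑ j, (k j).natAbs

theorem modeLen_add_le (k l : Fin n → ℤ) : modeLen (k + l) ≤ modeLen k + modeLen l := by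
  rw [modeLen, modeLen, modeLen, ← Finset.sum_add_distrib]
  exact Finset.sum_le_sum fun j _ => Int.natAbs_add_le _ _

theorem modeLen_eq_zero {k : Fin n → ℤ} : modeLen k = 0 ↔ k = 0 := by
  rw [modeLen, Finset.sum_eq_zero_iff]
  simp [funext_iff]

theorem norm_intCast_le_modeLen (k : Fin n → ℤ) (j : Fin n) : ‖(k j : ℂ)‖ ≤ modeLen k := by
  rw [Complex.norm_intCast, ← Int.cast_abs, Int.abs_eq_natAbs, Int.cast_natCast, Nat.cast_le]
  exact Finset.single_le_sum (f := fun j => (k j).natAbs) (fun _ _ => Nat.zero_le _)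
    (Finset.mem_univ j)

theorem sum_norm_eq_modeLen (k : Fin n → ℤ) : ∑ j, ‖(k j : ℂ)‖ = modeLen k := by
  rw [modeLen, Nat.cast_sum]
  refine Finset.sum_congr rfl fun j _ => ?_
  rw [Complex.norm_intCast, ← Int.cast_abs, Int.abs_eq_natAbs, Int.cast_natCast]

theorem norm_le_sum_norm (x : EuclideanSpace ℂ (Fin n)) : ‖x‖ ≤ ∑ j, ‖x j‖ := by
  rw [EuclideanSpace.norm_eq]
  refine Real.sqrt_le_iff.2 ⟨Finset.sum_nonneg fun _ _ => norm_nonneg _, ?_⟩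
  exact Finset.sum_sq_le_sq_sum_of_nonneg fun _ _ => norm_nonneg _

theorem norm_modeDir_fst_le (k : Fin n → ℤ) : ‖(modeDir k).1‖ ≤ modeLen k :=
  (norm_le_sum_norm _).trans (sum_norm_eq_modeLen k).le

/-- The exponential weight of a Fourier mode in the strip of width `(1 - v) σ`. -/
noncomputable def weight (σ v : ℝ) (k : Fin n → ℤ) : ℝ≥0∞ :=
  ENNReal.ofReal (Real.exp (modeLen k * ((1 - v) * σ)))

theorem weight_add_le {v : ℝ} (hv : v ≤ 1) (hσ : 0 ≤ σ) (k l : Fin n → ℤ) :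
    weight σ v (k + l) ≤ weight σ v k * weight σ v l := by
  rw [weight, weight, weight, ← ENNReal.ofReal_mul (Real.exp_pos _).le, ← Real.exp_add, ← add_mul]
  refine ENNReal.ofReal_le_ofReal (Real.exp_le_exp.2 ?_)
  have h1 : 0 ≤ (1 - v) * σ := mul_nonneg (by linarith) hσ
  have h2 : (modeLen (k + l) : ℝ) ≤ modeLen k + modeLen l := by exact_mod_cast modeLen_add_le k l
  gcongr

theorem modeLen_mul_weight_le {v v' : ℝ} (hv : v' < v) (hσ : 0 < σ) (k : Fin n → ℤ) :
    ENNReal.ofReal (modeLen k) * weight σ v k ≤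
      ENNReal.ofReal (1 / (Real.exp 1 * ((v - v') * σ))) * weight σ v' k := by
  have hd : 0 < (v - v') * σ := mul_pos (by linarith) hσ
  rw [weight, weight, ← ENNReal.ofReal_mul (by positivity), ← ENNReal.ofReal_mul (by positivity)]
  refine ENNReal.ofReal_le_ofReal ?_
  have h1 : (modeLen k : ℝ) * ((v - v') * σ) * Real.exp 1 ≤
      Real.exp (modeLen k * ((v - v') * σ)) := by
    have h := Real.add_one_le_exp ((modeLen k : ℝ) * ((v - v') * σ) - 1)
    rw [sub_add_cancel, Real.exp_sub] at h
    rwa [le_div_iff₀ (Real.exp_pos 1)] at h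
  have h2 : Real.exp (modeLen k * ((1 - v') * σ)) =
      Real.exp (modeLen k * ((v - v') * σ)) * Real.exp (modeLen k * ((1 - v) * σ)) := by
    rw [← Real.exp_add]; congr 1; ring
  rw [h2, ← mul_assoc (1 / _)]
  refine mul_le_mul_of_nonneg_right ?_ (Real.exp_pos _).le
  rw [one_div, inv_mul_eq_div, le_div_iff₀ (by positivity)]
  linarith

/-- The weighted Fourier norm on the domain shrunk by `1 - u` in the actions and in slow time, and
by `1 - v` in the angles. -/
noncomputable def trigNorm (u v : ℝ) (F : Trig (dom V δ σ 0)) : ℝ≥0∞ :=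
  ∑' k, supOn V δ σ u (F k) * weight σ v k

theorem trigNorm_zero (u v : ℝ) : trigNorm u v (0 : Trig (dom V δ σ 0)) = 0 := by
  simp [trigNorm, supOn, Hol.zero_apply]

theorem trigNorm_add_le (u v : ℝ) (F G : Trig (dom V δ σ 0)) :
    trigNorm u v (F + G) ≤ trigNorm u v F + trigNorm u v G := by
  rw [trigNorm, trigNorm, trigNorm, ← ENNReal.tsum_add]
  refine ENNReal.tsum_le_tsum fun k => ?_
  rw [← add_mul]
  refine mul_le_mul_left ?_ _
  refine iSup₂_le fun z hz => ?_
  rw [Finsupp.add_apply, Hol.add_apply]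
  exact (enorm_add_le _ _).trans (add_le_add (le_supOn hz) (le_supOn hz))

theorem trigNorm_sum_le {ι : Type*} (u v : ℝ) (s : Finset ι) (F : ι → Trig (dom V δ σ 0)) :
    trigNorm u v (∑ i ∈ s, F i) ≤ ∑ i ∈ s, trigNorm u v (F i) := by
  classical
  induction s using Finset.induction_on with
  | empty => simp [trigNorm_zero]
  | insert i s hi ih =>
    rw [Finset.sum_insert hi, Finset.sum_insert hi]
    exact (trigNorm_add_le _ _ _ _).trans (by gcongr)

theorem trigNorm_single (u v : ℝ) (k : Fin n → ℤ) (f : Hol (dom V δ σ 0)) :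
    trigNorm u v (Finsupp.single k f) = supOn V δ σ u f * weight σ v k := by
  rw [trigNorm, tsum_eq_single k, Finsupp.single_eq_same]
  intro l hl
  rw [Finsupp.single_eq_of_ne hl]
  simp [supOn, Hol.zero_apply]

/-- Cauchy's estimate in the direction `y` between two shrunk domains. -/
theorem supOn_dir_le {u u' R : ℝ} (hu' : 0 ≤ u') (hδ : 0 ≤ δ) (hσ : 0 ≤ σ)
    (hR : 0 < R) {y : ActTime n}
    (h1 : R * ‖y.1‖ ≤ (u - u') * δ) (h2 : R * ‖y.2‖ ≤ (u - u') * σ) (f : Hol (dom V δ σ 0)) :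
    supOn V δ σ u (Hol.dir y f) ≤ ENNReal.ofReal (1 / R) * supOn V δ σ u' f := by
  by_cases htop : supOn V δ σ u' f = ⊤
  · rw [htop, ENNReal.mul_top]
    · exact le_top
    · simpa using hR
  have hC : ∀ w ∈ dom V δ σ u', ‖f w‖ ≤ (supOn V δ σ u' f).toReal := fun w hw => by
    rw [← ENNReal.ofReal_le_iff_le_toReal htop, ofReal_norm]
    exact le_supOn hw
  have hmem : ∀ z ∈ dom V δ σ u, ∀ t : ℂ, ‖t‖ ≤ R → z + t • y ∈ dom V δ σ u' := by
    intro z hz t ht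
    refine dom_add_mem hz ?_ ?_
    · rw [Prod.smul_fst, norm_smul]
      exact (mul_le_mul_of_nonneg_right ht (norm_nonneg _)).trans h1
    · rw [Prod.smul_snd, norm_smul]
      exact (mul_le_mul_of_nonneg_right ht (norm_nonneg _)).trans h2
  refine iSup₂_le fun z hz => ?_
  have hz0 : z ∈ dom V δ σ 0 := dom_anti hu' hδ hσ (by
    simpa using hmem z hz 0 (by simpa using hR.le))
  rw [Hol.dir_apply y f hz0, ← ofReal_norm]
  conv_rhs => rw [← ENNReal.ofReal_toReal htop, ← ENNReal.ofReal_mul (by positivity)]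
  refine ENNReal.ofReal_le_ofReal ?_
  rw [one_div_mul_eq_div]
  exact norm_fderiv_apply_le (dom V δ σ 0).isOpen f.differentiableOn hR
    (fun t ht => dom_anti hu' hδ hσ (hmem z hz t ht)) fun t ht => hC _ (hmem z hz t ht)

theorem supOn_zero (u : ℝ) : supOn V δ σ u (0 : Hol (dom V δ σ 0)) = 0 := by
  simp [supOn, Hol.zero_apply]

theorem supOn_dir_modeDir_le {u u' : ℝ} (hu' : 0 ≤ u') (hu : u' < u) (hδ : 0 < δ) (hσ : 0 < σ)
    (k : Fin n → ℤ) (f : Hol (dom V δ σ 0)) :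
    supOn V δ σ u (Hol.dir (modeDir k) f) ≤
      ENNReal.ofReal (1 / ((u - u') * δ)) * ENNReal.ofReal (modeLen k) * supOn V δ σ u' f := by
  have hd : 0 < (u - u') * δ := mul_pos (by linarith) hδ
  by_cases hk : modeLen k = 0
  · rw [modeLen_eq_zero.1 hk, modeDir_zero, Hol.dir_zero, supOn_zero]
    exact bot_le
  have hk' : (0 : ℝ) < modeLen k := by exact_mod_cast Nat.pos_of_ne_zero hk
  refine (supOn_dir_le hu' hδ.le hσ.le (R := (u - u') * δ / modeLen k) (by positivity)
    ?_ ?_ f).trans ?_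
  · calc (u - u') * δ / modeLen k * ‖(modeDir k).1‖
        ≤ (u - u') * δ / modeLen k * modeLen k := by gcongr; exact norm_modeDir_fst_le k
      _ = (u - u') * δ := by field_simp
  · have : 0 ≤ (u - u') * σ := mul_nonneg (by linarith) hσ.le
    simpa [modeDir] using this
  · rw [← ENNReal.ofReal_mul (by positivity)]
    gcongr
    apply le_of_eq
    field_simp

theorem supOn_dir_timeDir_le {u u' : ℝ} (hu' : 0 ≤ u') (hu : u' < u) (hδ : 0 < δ) (hσ : 0 < σ)
    (f : Hol (dom V δ σ 0)) :
    supOn V δ σ u (Hol.dir timeDir f) ≤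
      ENNReal.ofReal (1 / ((u - u') * σ)) * supOn V δ σ u' f := by
  have hd : 0 < (u - u') * σ := mul_pos (by linarith) hσ
  refine supOn_dir_le hu' hδ.le hσ.le hd ?_ ?_ f
  · have : 0 ≤ (u - u') * δ := mul_nonneg (by linarith) hδ.le
    simpa [timeDir] using this
  · simp [timeDir]

theorem supOn_modeBracket_le (u : ℝ) (k l : Fin n → ℤ) (f g : Hol (dom V δ σ 0)) :
    supOn V δ σ u (modeBracket k l f g) ≤
      supOn V δ σ u (Hol.dir (modeDir l) f) * supOn V δ σ u g +
        supOn V δ σ u f * supOn V δ σ u (Hol.dir (modeDir k) g) := by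
  refine iSup₂_le fun z hz => ?_
  rw [modeBracket_apply, Hol.sub_apply, Hol.mul_apply, Hol.mul_apply]
  refine enorm_sub_le.trans ?_
  rw [enorm_mul, enorm_mul]
  gcongr <;> exact le_supOn hz

theorem sum_sum_le_trigNorm_mul (u v u₁ v₁ : ℝ) (F G : Trig (dom V δ σ 0)) :
    ∑ k ∈ F.support, ∑ l ∈ G.support, (supOn V δ σ u (F k) * weight σ v k) *
      (supOn V δ σ u₁ (G l) * weight σ v₁ l) ≤ trigNorm u v F * trigNorm u₁ v₁ G := by
  rw [← Finset.sum_mul_sum]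
  gcongr
  · exact ENNReal.sum_le_tsum _
  · exact ENNReal.sum_le_tsum _

/-- The estimate of the bracket: one function loses in the actions, the other in the angles. -/
theorem trigNorm_trigBracket_le {u v u₁ u₂ v₁ v₂ : ℝ} (hu₁ : 0 ≤ u₁) (hu₁u : u₁ < u)
    (hu₂ : 0 ≤ u₂) (hu₂u : u₂ < u) (hv₁ : v₁ < v) (hv₂ : v₂ < v) (hv : v ≤ 1)
    (hδ : 0 < δ) (hσ : 0 < σ) (F G : Trig (dom V δ σ 0)) :
    trigNorm u v (trigBracket F G) ≤
      ENNReal.ofReal (1 / ((u - u₁) * δ) * (1 / (Real.exp 1 * ((v - v₁) * σ)))) *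
          (trigNorm u₁ v F * trigNorm u v₁ G) +
        ENNReal.ofReal (1 / ((u - u₂) * δ) * (1 / (Real.exp 1 * ((v - v₂) * σ)))) *
          (trigNorm u v₂ F * trigNorm u₂ v G) := by
  have hd₁ : 0 < (u - u₁) * δ := mul_pos (by linarith) hδ
  have hd₂ : 0 < (u - u₂) * δ := mul_pos (by linarith) hδ
  rw [ENNReal.ofReal_mul (by positivity), ENNReal.ofReal_mul (by positivity)]
  set A₁ := ENNReal.ofReal (1 / ((u - u₁) * δ))
  set A₂ := ENNReal.ofReal (1 / ((u - u₂) * δ))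
  set B₁ := ENNReal.ofReal (1 / (Real.exp 1 * ((v - v₁) * σ)))
  set B₂ := ENNReal.ofReal (1 / (Real.exp 1 * ((v - v₂) * σ)))
  have hterm : ∀ (k l : Fin n → ℤ) (f g : Hol (dom V δ σ 0)),
      trigNorm u v (Finsupp.single (k + l) (modeBracket k l f g)) ≤
        A₁ * B₁ * ((supOn V δ σ u₁ f * weight σ v k) * (supOn V δ σ u g * weight σ v₁ l)) +
        A₂ * B₂ * ((supOn V δ σ u f * weight σ v₂ k) * (supOn V δ σ u₂ g * weight σ v l)) := by
    intro k l f g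
    rw [trigNorm_single]
    have h1 := supOn_dir_modeDir_le hu₁ hu₁u hδ hσ l f
    have h2 := supOn_dir_modeDir_le hu₂ hu₂u hδ hσ k g
    have h3 := modeLen_mul_weight_le hv₁ hσ l
    have h4 := modeLen_mul_weight_le hv₂ hσ k
    calc supOn V δ σ u (modeBracket k l f g) * weight σ v (k + l)
        ≤ (A₁ * ENNReal.ofReal (modeLen l) * supOn V δ σ u₁ f * supOn V δ σ u g +
            supOn V δ σ u f * (A₂ * ENNReal.ofReal (modeLen k) * supOn V δ σ u₂ g)) *
            (weight σ v k * weight σ v l) := by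
          gcongr
          · refine (supOn_modeBracket_le u k l f g).trans ?_
            gcongr
          · exact weight_add_le hv hσ.le k l
      _ = A₁ * ((supOn V δ σ u₁ f * weight σ v k) *
            (supOn V δ σ u g * (ENNReal.ofReal (modeLen l) * weight σ v l))) +
          A₂ * ((supOn V δ σ u f * (ENNReal.ofReal (modeLen k) * weight σ v k)) *
            (supOn V δ σ u₂ g * weight σ v l)) := by ring
      _ ≤ A₁ * ((supOn V δ σ u₁ f * weight σ v k) *
            (supOn V δ σ u g * (B₁ * weight σ v₁ l))) +
          A₂ * ((supOn V δ σ u f * (B₂ * weight σ v₂ k)) *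
            (supOn V δ σ u₂ g * weight σ v l)) := by gcongr
      _ = _ := by ring
  rw [trigBracket_eq_sum]
  calc trigNorm u v (F.sum fun k f => G.sum fun l g =>
        Finsupp.single (k + l) (modeBracket k l f g))
      ≤ ∑ k ∈ F.support, ∑ l ∈ G.support,
        trigNorm u v (Finsupp.single (k + l) (modeBracket k l (F k) (G l))) :=
        (trigNorm_sum_le _ _ _ _).trans (Finset.sum_le_sum fun k _ => trigNorm_sum_le _ _ _ _)
    _ ≤ ∑ k ∈ F.support, ∑ l ∈ G.support,
        (A₁ * B₁ * ((supOn V δ σ u₁ (F k) * weight σ v k) *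
            (supOn V δ σ u (G l) * weight σ v₁ l)) +
          A₂ * B₂ * ((supOn V δ σ u (F k) * weight σ v₂ k) *
            (supOn V δ σ u₂ (G l) * weight σ v l))) :=
        Finset.sum_le_sum fun k _ => Finset.sum_le_sum fun l _ => hterm k l _ _
    _ = A₁ * B₁ * (∑ k ∈ F.support, ∑ l ∈ G.support,
          (supOn V δ σ u₁ (F k) * weight σ v k) * (supOn V δ σ u (G l) * weight σ v₁ l)) +
        A₂ * B₂ * (∑ k ∈ F.support, ∑ l ∈ G.support,
          (supOn V δ σ u (F k) * weight σ v₂ k) * (supOn V δ σ u₂ (G l) * weight σ v l)) := by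
        simp only [Finset.sum_add_distrib, Finset.mul_sum]
    _ ≤ _ := by
        gcongr <;> exact sum_sum_le_trigNorm_mul _ _ _ _ _ _

/-- The Nagumo-type bound: the weighted Fourier norms grow at most like `c u^{-p} v^{-p}` as the
shrinking parameters `u` and `v` tend to `0`. For `p = 0` the endpoints `u = v = 0` give a bound on
the whole domain; for `p > 0` they are void. -/
def NagumoBound (F : Trig (dom V δ σ 0)) (p : ℕ) (c : ℝ) : Prop :=
  ∀ u v : ℝ, 0 ≤ u → u ≤ 1 → 0 ≤ v → v ≤ 1 →
    trigNorm u v F * ENNReal.ofReal (u ^ p * v ^ p) ≤ ENNReal.ofReal c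

namespace NagumoBound

variable {F G : Trig (dom V δ σ 0)} {p q : ℕ} {c d : ℝ}

theorem mono (h : NagumoBound F p c) (hcd : c ≤ d) : NagumoBound F p d :=
  fun u v hu hu1 hv hv1 => (h u v hu hu1 hv hv1).trans (ENNReal.ofReal_le_ofReal hcd)

theorem mono_exponent (h : NagumoBound F p c) (hpq : p ≤ q) : NagumoBound F q c := by
  intro u v hu hu1 hv hv1
  refine le_trans ?_ (h u v hu hu1 hv hv1)
  exact mul_le_mul_right (ENNReal.ofReal_le_ofReal (mul_le_mul
    (pow_le_pow_of_le_one hu hu1 hpq) (pow_le_pow_of_le_one hv hv1 hpq) (by positivity)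
    (by positivity))) _

theorem zero : NagumoBound (0 : Trig (dom V δ σ 0)) p c := by
  intro u v _ _ _ _
  simp [trigNorm_zero]

theorem add (hF : NagumoBound F p c) (hG : NagumoBound G p d) (hc : 0 ≤ c) (hd : 0 ≤ d) :
    NagumoBound (F + G) p (c + d) := by
  intro u v hu hu1 hv hv1
  rw [ENNReal.ofReal_add hc hd]
  refine le_trans ?_ (add_le_add (hF u v hu hu1 hv hv1) (hG u v hu hu1 hv hv1))
  rw [← add_mul]
  gcongr
  exact trigNorm_add_le _ _ _ _

theorem sum {ι : Type*} {s : Finset ι} {F : ι → Trig (dom V δ σ 0)} {c : ι → ℝ}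
    (h : ∀ i ∈ s, NagumoBound (F i) p (c i)) (hc : ∀ i ∈ s, 0 ≤ c i) :
    NagumoBound (∑ i ∈ s, F i) p (∑ i ∈ s, c i) := by
  classical
  induction s using Finset.induction_on with
  | empty => simpa using zero
  | insert i s hi ih =>
    rw [Finset.sum_insert hi, Finset.sum_insert hi]
    refine (h i (Finset.mem_insert_self _ _)).add
      (ih (fun j hj => h j (Finset.mem_insert_of_mem hj))
        fun j hj => hc j (Finset.mem_insert_of_mem hj)) (hc i (Finset.mem_insert_self _ _)) ?_
    exact Finset.sum_nonneg fun j hj => hc j (Finset.mem_insert_of_mem hj)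

theorem of_trigNorm_le (hG : NagumoBound G p c) {a : ℝ} (ha : 0 ≤ a)
    (h : ∀ u v : ℝ, trigNorm u v F ≤ ENNReal.ofReal a * trigNorm u v G) :
    NagumoBound F p (a * c) := by
  intro u v hu hu1 hv hv1
  rw [ENNReal.ofReal_mul ha]
  calc trigNorm u v F * ENNReal.ofReal (u ^ p * v ^ p)
      ≤ (ENNReal.ofReal a * trigNorm u v G) * ENNReal.ofReal (u ^ p * v ^ p) := by
        gcongr; exact h u v
    _ = ENNReal.ofReal a * (trigNorm u v G * ENNReal.ofReal (u ^ p * v ^ p)) := by ring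
    _ ≤ _ := by gcongr; exact hG u v hu hu1 hv hv1

theorem of_norm_le (hG : NagumoBound G p c) {a : ℝ} (ha : 0 ≤ a)
    (h : ∀ k z, ‖F k z‖ ≤ a * ‖G k z‖) : NagumoBound F p (a * c) := by
  refine hG.of_trigNorm_le ha fun u v => ?_
  rw [trigNorm, trigNorm, ← ENNReal.tsum_mul_left]
  refine ENNReal.tsum_le_tsum fun k => ?_
  rw [← mul_assoc]
  gcongr
  exact supOn_le_mul ha fun z _ => h k z

theorem smul (hF : NagumoBound F p c) (a : ℂ) : NagumoBound (a • F) p (‖a‖ * c) := by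
  refine hF.of_norm_le (norm_nonneg a) fun k z => ?_
  rw [Finsupp.smul_apply, Hol.smul_apply, norm_mul]

theorem neg (hF : NagumoBound F p c) : NagumoBound (-F) p c := by
  have := hF.of_norm_le (F := -F) zero_le_one fun k z => by
    rw [Finsupp.neg_apply, Hol.neg_apply, norm_neg, one_mul]
  rwa [one_mul] at this

theorem sub (hF : NagumoBound F p c) (hG : NagumoBound G p d) (hc : 0 ≤ c) (hd : 0 ≤ d) :
    NagumoBound (F - G) p (c + d) := by
  rw [sub_eq_add_neg]
  exact hF.add hG.neg hc hd

/-- Shrinking `u` to `u p / (p + 1)` costs at most a factor `e` in its `p`-th power. -/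
theorem pow_le_exp_mul_pow {u : ℝ} (hu : 0 ≤ u) (p : ℕ) :
    u ^ p ≤ Real.exp 1 * (u * p / (p + 1)) ^ p := by
  rcases Nat.eq_zero_or_pos p with rfl | hp
  · simp
  have hp' : (0 : ℝ) < p := by exact_mod_cast hp
  have h := Real.one_add_inv_pow_le_exp (n := p)
  calc u ^ p = (1 + (p : ℝ)⁻¹) ^ p * (u * p / (p + 1)) ^ p := by
        rw [← mul_pow]; congr 1; field_simp
    _ ≤ _ := by gcongr

/-- The bracket of functions with exponents `p` and `q` has exponent `p + q + 1`, with a constant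
which is only bilinear in `p + 1` and `q + 1`: each factor is estimated on a domain which is larger
by the proportion `1 / (p + 1)`, respectively `1 / (q + 1)`, and only in the variables in which that
factor is differentiated. -/
theorem trigBracket (hF : NagumoBound F p c) (hG : NagumoBound G q d) (hc : 0 ≤ c)
    (hδ : 0 < δ) (hσ : 0 < σ) :
    NagumoBound (trigBracket F G) (p + q + 1)
      (2 * Real.exp 1 / (δ * σ) * (p + 1) * (q + 1) * (c * d)) := by
  intro u v hu hu1 hv hv1
  rcases hu.eq_or_lt with rfl | hu0
  · simp
  rcases hv.eq_or_lt with rfl | hv0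
  · simp
  have hlt : ∀ (x : ℝ) (m : ℕ), 0 < x → x * m / (m + 1) < x := fun x m hx => by
    rw [div_lt_iff₀ (by positivity)]; nlinarith
  have hnn : ∀ (x : ℝ) (m : ℕ), 0 < x → 0 ≤ x * m / (m + 1) := fun x m hx => by positivity
  have hle : ∀ (x : ℝ) (m : ℕ), 0 < x → x ≤ 1 → x * m / (m + 1) ≤ 1 := fun x m hx hx1 =>
    (hlt x m hx).le.trans hx1
  have hsub : ∀ (x : ℝ) (m : ℕ), x - x * m / (m + 1) = x / (m + 1) := fun x m => by
    field_simp; ring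
  have key : ∀ (a b : ℕ) (u v : ℝ), 0 < u → 0 < v →
      1 / ((u - u * a / (a + 1)) * δ) * (1 / (Real.exp 1 * ((v - v * b / (b + 1)) * σ))) *
        (u ^ (p + q + 1) * v ^ (p + q + 1)) =
      (a + 1) * (b + 1) / (Real.exp 1 * δ * σ) * (u ^ (p + q) * v ^ (p + q)) := by
    intro a b u v hu hv
    rw [hsub, hsub]
    field_simp
    ring
  have hcd : 2 * Real.exp 1 / (δ * σ) * (p + 1) * (q + 1) * (c * d) =
      (Real.exp 1 * (p + 1) * (q + 1) / (δ * σ)) * (c * d) +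
      (Real.exp 1 * (p + 1) * (q + 1) / (δ * σ)) * (c * d) := by ring
  have hκ : (0 : ℝ) ≤ Real.exp 1 * (p + 1) * (q + 1) / (δ * σ) := by positivity
  have hsum := trigNorm_trigBracket_le (V := V) (hnn u p hu0) (hlt u p hu0) (hnn u q hu0)
    (hlt u q hu0) (hlt v q hv0) (hlt v p hv0) hv1 hδ hσ F G
  -- both halves of the bracket obey the same bound
  have half : ∀ (x y : ℝ≥0∞) (a b : ℕ) (X Y : ℝ), 0 ≤ X → 0 ≤ Y →
      (a + 1 : ℝ) * (b + 1) = (p + 1) * (q + 1) →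
      u ^ (p + q) * v ^ (p + q) ≤ Real.exp 1 ^ 2 * (X * Y) →
      x * ENNReal.ofReal X ≤ ENNReal.ofReal c → y * ENNReal.ofReal Y ≤ ENNReal.ofReal d →
      ENNReal.ofReal (1 / ((u - u * a / (a + 1)) * δ) *
        (1 / (Real.exp 1 * ((v - v * b / (b + 1)) * σ)))) * (x * y) *
        ENNReal.ofReal (u ^ (p + q + 1) * v ^ (p + q + 1)) ≤
      ENNReal.ofReal (Real.exp 1 * (p + 1) * (q + 1) / (δ * σ)) *
        (ENNReal.ofReal c * ENNReal.ofReal d) := by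
    intro x y a b X Y hX hY hab2 hXY hx hy
    calc _ = (x * y) * ENNReal.ofReal ((a + 1) * (b + 1) / (Real.exp 1 * δ * σ) *
          (u ^ (p + q) * v ^ (p + q))) := by
          have hk := key a b u v hu0 hv0
          generalize 1 / ((u - u * a / (a + 1)) * δ) *
            (1 / (Real.exp 1 * ((v - v * b / (b + 1)) * σ))) = w at hk ⊢
          rw [← hk, ENNReal.ofReal_mul' (p := w) (by positivity)]
          ring
      _ ≤ (x * y) * ENNReal.ofReal ((Real.exp 1 * (p + 1) * (q + 1) / (δ * σ)) * (X * Y)) := by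
          refine mul_le_mul_right (ENNReal.ofReal_le_ofReal ?_) _
          calc (a + 1) * (b + 1) / (Real.exp 1 * δ * σ) * (u ^ (p + q) * v ^ (p + q))
              ≤ (a + 1) * (b + 1) / (Real.exp 1 * δ * σ) * (Real.exp 1 ^ 2 * (X * Y)) := by
                gcongr
            _ = _ := by rw [hab2]; field_simp
      _ = ENNReal.ofReal (Real.exp 1 * (p + 1) * (q + 1) / (δ * σ)) *
          ((x * ENNReal.ofReal X) * (y * ENNReal.ofReal Y)) := by
          rw [ENNReal.ofReal_mul hκ, ENNReal.ofReal_mul hX]; ring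
      _ ≤ _ := by gcongr
  calc _ ≤ _ := mul_le_mul_left hsum _
    _ ≤ ENNReal.ofReal (Real.exp 1 * (p + 1) * (q + 1) / (δ * σ)) *
        (ENNReal.ofReal c * ENNReal.ofReal d) +
        ENNReal.ofReal (Real.exp 1 * (p + 1) * (q + 1) / (δ * σ)) *
        (ENNReal.ofReal c * ENNReal.ofReal d) := by
        rw [add_mul]
        refine add_le_add ?_ ?_
        · refine half _ _ p q ((u * p / (p + 1)) ^ p * v ^ p) (u ^ q * (v * q / (q + 1)) ^ q)
            (by positivity) (by positivity) rfl ?_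
            (hF _ _ (hnn u p hu0) (hle u p hu0 hu1) hv hv1)
            (hG _ _ hu hu1 (hnn v q hv0) (hle v q hv0 hv1))
          calc u ^ (p + q) * v ^ (p + q) = u ^ p * v ^ q * (u ^ q * v ^ p) := by ring
            _ ≤ (Real.exp 1 * (u * p / (p + 1)) ^ p) * (Real.exp 1 * (v * q / (q + 1)) ^ q) *
                (u ^ q * v ^ p) := by
                gcongr
                · exact pow_le_exp_mul_pow hu p
                · exact pow_le_exp_mul_pow hv q
            _ = _ := by ring
        · refine half _ _ q p (u ^ p * (v * p / (p + 1)) ^ p) ((u * q / (q + 1)) ^ q * v ^ q)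
            (by positivity) (by positivity) (by ring) ?_
            (hF _ _ hu hu1 (hnn v p hv0) (hle v p hv0 hv1))
            (hG _ _ (hnn u q hu0) (hle u q hu0 hu1) hv hv1)
          calc u ^ (p + q) * v ^ (p + q) = v ^ p * u ^ q * (u ^ p * v ^ q) := by ring
            _ ≤ (Real.exp 1 * (v * p / (p + 1)) ^ p) * (Real.exp 1 * (u * q / (q + 1)) ^ q) *
                (u ^ p * v ^ q) := by
                gcongr
                · exact pow_le_exp_mul_pow hv p
                · exact pow_le_exp_mul_pow hu q
            _ = _ := by ring
    _ = _ := by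
        rw [← ENNReal.ofReal_mul hc, ← ENNReal.ofReal_mul hκ]
        rcases le_or_gt 0 d with hd | hd
        · rw [← ENNReal.ofReal_add (by positivity) (by positivity), ← hcd]
        · have h0 : (Real.exp 1 * (p + 1) * (q + 1) / (δ * σ)) * (c * d) ≤ 0 :=
            mul_nonpos_of_nonneg_of_nonpos hκ (mul_nonpos_of_nonneg_of_nonpos hc hd.le)
          rw [hcd, ENNReal.ofReal_of_nonpos h0, ENNReal.ofReal_of_nonpos (by linarith), add_zero]

/-- The estimate of the derivative with respect to slow time. -/
theorem timeDeriv (hF : NagumoBound F p c) (hδ : 0 < δ) (hσ : 0 < σ) :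
    NagumoBound (timeDeriv F) (p + 1) (Real.exp 1 / σ * (p + 1) * c) := by
  intro u v hu hu1 hv hv1
  rcases hu.eq_or_lt with rfl | hu0
  · simp
  have hlt : u * p / (p + 1) < u := by rw [div_lt_iff₀ (by positivity)]; nlinarith
  have hnn : 0 ≤ u * p / (p + 1) := by positivity
  have hsub : u - u * p / (p + 1) = u / (p + 1) := by field_simp; ring
  have h1 : trigNorm u v (SlowNekhoroshev.timeDeriv F) ≤
      ENNReal.ofReal (1 / (u / (p + 1) * σ)) * trigNorm (u * p / (p + 1)) v F := by
    rw [trigNorm, trigNorm, ← ENNReal.tsum_mul_left]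
    refine ENNReal.tsum_le_tsum fun k => ?_
    rw [← mul_assoc, ← hsub]
    gcongr
    have : (SlowNekhoroshev.timeDeriv F) k = Hol.dir timeDir (F k) := by
      simp [SlowNekhoroshev.timeDeriv]
    rw [this]
    exact supOn_dir_timeDir_le hnn hlt hδ hσ (F k)
  have hκ : (0 : ℝ) ≤ Real.exp 1 / σ * (p + 1) := by positivity
  rw [ENNReal.ofReal_mul hκ]
  calc _ ≤ ENNReal.ofReal (1 / (u / (p + 1) * σ)) * trigNorm (u * p / (p + 1)) v F *
        ENNReal.ofReal (u ^ (p + 1) * v ^ (p + 1)) := by gcongr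
    _ = trigNorm (u * p / (p + 1)) v F *
        ENNReal.ofReal ((p + 1) / σ * (u ^ p * v ^ (p + 1))) := by
        have hk : (p + 1) / σ * (u ^ p * v ^ (p + 1)) =
          1 / (u / (p + 1) * σ) * (u ^ (p + 1) * v ^ (p + 1)) := by field_simp; ring
        rw [hk, ENNReal.ofReal_mul (q := u ^ (p + 1) * v ^ (p + 1)) (by positivity)]
        generalize u * p / (p + 1) = u'
        generalize ENNReal.ofReal (1 / (u / (p + 1) * σ)) = w
        rw [mul_comm w, mul_assoc]
    _ ≤ trigNorm (u * p / (p + 1)) v F *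
        ENNReal.ofReal (Real.exp 1 / σ * (p + 1) * ((u * p / (p + 1)) ^ p * v ^ p)) := by
        refine mul_le_mul_right (ENNReal.ofReal_le_ofReal ?_) _
        calc (p + 1) / σ * (u ^ p * v ^ (p + 1))
            ≤ (p + 1) / σ * ((Real.exp 1 * (u * p / (p + 1)) ^ p) * v ^ p) := by
              refine mul_le_mul_of_nonneg_left ?_ (by positivity)
              exact mul_le_mul (pow_le_exp_mul_pow hu p)
                (pow_le_pow_of_le_one hv hv1 (Nat.le_succ p)) (by positivity) (by positivity)
          _ = _ := by ring
    _ = ENNReal.ofReal (Real.exp 1 / σ * (p + 1)) * (trigNorm (u * p / (p + 1)) v F *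
        ENNReal.ofReal ((u * p / (p + 1)) ^ p * v ^ p)) := by
        rw [ENNReal.ofReal_mul hκ]; ring
    _ ≤ _ := by gcongr; exact hF _ _ hnn (hlt.le.trans hu1) hv hv1

/-- The estimate of a derivative with respect to the angles. -/
theorem of_norm_le_modeLen_mul (hG : NagumoBound G p c) (hσ : 0 < σ) {a : ℝ} (ha : 0 ≤ a)
    (h : ∀ k z, ‖F k z‖ ≤ (modeLen k : ℝ) * a * ‖G k z‖) :
    NagumoBound F (p + 1) (1 / σ * (p + 1) * (a * c)) := by
  intro u v hu hu1 hv hv1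
  rcases hv.eq_or_lt with rfl | hv0
  · simp
  have hlt : v * p / (p + 1) < v := by rw [div_lt_iff₀ (by positivity)]; nlinarith
  have hnn : 0 ≤ v * p / (p + 1) := by positivity
  have hsub : v - v * p / (p + 1) = v / (p + 1) := by field_simp; ring
  have h1 : trigNorm u v F ≤ ENNReal.ofReal a * (ENNReal.ofReal (1 / (Real.exp 1 *
      (v / (p + 1) * σ))) * trigNorm u (v * p / (p + 1)) G) := by
    rw [trigNorm, trigNorm, ← ENNReal.tsum_mul_left, ← ENNReal.tsum_mul_left]
    refine ENNReal.tsum_le_tsum fun k => ?_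
    calc supOn V δ σ u (F k) * weight σ v k
        ≤ ENNReal.ofReal ((modeLen k : ℝ) * a) * supOn V δ σ u (G k) * weight σ v k := by
          gcongr
          exact supOn_le_mul (by positivity) fun z _ => h k z
      _ = ENNReal.ofReal a * (supOn V δ σ u (G k) *
          (ENNReal.ofReal (modeLen k) * weight σ v k)) := by
          rw [ENNReal.ofReal_mul (by positivity)]; ring
      _ ≤ ENNReal.ofReal a * (supOn V δ σ u (G k) * (ENNReal.ofReal (1 / (Real.exp 1 *
          (v / (p + 1) * σ))) * weight σ (v * p / (p + 1)) k)) := by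
          rw [← hsub]
          exact mul_le_mul_right (mul_le_mul_right (modeLen_mul_weight_le hlt hσ k) _) _
      _ = _ := by ring
  have hκ : (0 : ℝ) ≤ 1 / σ * (p + 1) * a := by positivity
  rw [← mul_assoc, ENNReal.ofReal_mul hκ]
  calc _ ≤ ENNReal.ofReal a * (ENNReal.ofReal (1 / (Real.exp 1 *
        (v / (p + 1) * σ))) * trigNorm u (v * p / (p + 1)) G) *
        ENNReal.ofReal (u ^ (p + 1) * v ^ (p + 1)) := by gcongr
    _ = ENNReal.ofReal a * (trigNorm u (v * p / (p + 1)) G *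
        ENNReal.ofReal ((p + 1) / (Real.exp 1 * σ) * (u ^ (p + 1) * v ^ p))) := by
        have hk : (p + 1) / (Real.exp 1 * σ) * (u ^ (p + 1) * v ^ p) =
          1 / (Real.exp 1 * (v / (p + 1) * σ)) * (u ^ (p + 1) * v ^ (p + 1)) := by
          field_simp; ring
        rw [hk, ENNReal.ofReal_mul (q := u ^ (p + 1) * v ^ (p + 1)) (by positivity)]
        generalize v * p / (p + 1) = v'
        generalize ENNReal.ofReal (1 / (Real.exp 1 * (v / (p + 1) * σ))) = w
        rw [mul_comm w, mul_assoc, mul_assoc]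
    _ ≤ ENNReal.ofReal a * (trigNorm u (v * p / (p + 1)) G *
        ENNReal.ofReal (1 / σ * (p + 1) * (u ^ p * (v * p / (p + 1)) ^ p))) := by
        refine mul_le_mul_right (mul_le_mul_right (ENNReal.ofReal_le_ofReal ?_) _) _
        calc (p + 1) / (Real.exp 1 * σ) * (u ^ (p + 1) * v ^ p)
            ≤ (p + 1) / (Real.exp 1 * σ) * (u ^ p * (Real.exp 1 * (v * p / (p + 1)) ^ p)) := by
              refine mul_le_mul_of_nonneg_left ?_ (by positivity)
              exact mul_le_mul (pow_le_pow_of_le_one hu hu1 (Nat.le_succ p))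
                (pow_le_exp_mul_pow hv p) (by positivity) (by positivity)
          _ = 1 / σ * (p + 1) * (u ^ p * (v * p / (p + 1)) ^ p) := by
              generalize (v * p / (p + 1)) ^ p = w
              field_simp
    _ = ENNReal.ofReal (1 / σ * (p + 1) * a) * (trigNorm u (v * p / (p + 1)) G *
        ENNReal.ofReal (u ^ p * (v * p / (p + 1)) ^ p)) := by
        rw [ENNReal.ofReal_mul (by positivity : (0 : ℝ) ≤ 1 / σ * (p + 1)),
          ENNReal.ofReal_mul (by positivity : (0 : ℝ) ≤ 1 / σ * (p + 1))]; ring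
    _ ≤ _ := by gcongr; exact hG _ _ hu hu1 hnn (hlt.le.trans hv1)

/-- A function bounded mode by mode on the whole domain satisfies the bound without loss. -/
theorem of_sum_le (hδ : 0 ≤ δ) (hσ : 0 ≤ σ) {m : (Fin n → ℤ) → ℝ} (hm : ∀ k, 0 ≤ m k)
    (h : ∀ k, ∀ z ∈ dom V δ σ 0, ‖F k z‖ ≤ m k) {s : Finset (Fin n → ℤ)}
    (hs : ∀ k ∉ s, F k = 0)
    (hsum : ∑ k ∈ s, m k * Real.exp (modeLen k * σ) ≤ c) : NagumoBound F 0 c := by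
  intro u v hu hu1 hv hv1
  rw [pow_zero, pow_zero, mul_one, ENNReal.ofReal_one, mul_one, trigNorm,
    tsum_eq_sum (s := s) fun k hk => by rw [hs k hk, supOn_zero, zero_mul]]
  refine le_trans ?_ (ENNReal.ofReal_le_ofReal hsum)
  rw [ENNReal.ofReal_sum_of_nonneg fun k _ => mul_nonneg (hm k) (Real.exp_pos _).le]
  refine Finset.sum_le_sum fun k _ => ?_
  rw [ENNReal.ofReal_mul (hm k), weight]
  gcongr
  · exact supOn_le_ofReal fun z hz => h k z (dom_anti hu hδ hσ hz)
  · nlinarith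

/-- At the real points of the domain, which stay in all the shrunk domains, there is no loss. -/
theorem sum_norm_le (hF : NagumoBound F p c) (hc : 0 ≤ c) {z : ActTime n}
    (hz : ∀ u < 1, z ∈ dom V δ σ u) (s : Finset (Fin n → ℤ)) : ∑ k ∈ s, ‖F k z‖ ≤ c := by
  have h1 : ∀ u : ℝ, 0 ≤ u → u < 1 → (∑ k ∈ s, ‖F k z‖) * u ^ p ≤ c := by
    intro u hu hu1
    have h := hF u 1 hu hu1.le zero_le_one le_rfl
    rw [one_pow, mul_one] at h
    rw [← ENNReal.ofReal_le_ofReal_iff hc, ENNReal.ofReal_mul' (by positivity)]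
    refine le_trans ?_ h
    gcongr
    rw [ENNReal.ofReal_sum_of_nonneg fun _ _ => norm_nonneg _]
    refine le_trans (Finset.sum_le_sum fun k _ => ?_) (ENNReal.sum_le_tsum s)
    rw [ofReal_norm, weight]
    simpa using le_supOn (f := F k) (hz u hu1)
  have hlim : Filter.Tendsto (fun u : ℝ => (∑ k ∈ s, ‖F k z‖) * u ^ p) (nhdsWithin 1 (Set.Iio 1))
      (nhds ((∑ k ∈ s, ‖F k z‖) * 1 ^ p)) :=
    ((continuous_const.mul (continuous_pow p)).tendsto 1).mono_left nhdsWithin_le_nhds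
  rw [one_pow, mul_one] at hlim
  refine le_of_tendsto hlim ?_
  filter_upwards [Ioo_mem_nhdsLT (zero_lt_one' ℝ)] with u hu using h1 u hu.1.le hu.2

end NagumoBound

end Norms

end SlowNekhoroshev

namespace SlowNekhoroshev

/-! ### The majorant sequences -/

section Majorants

open Finset hiding mem_antidiagonal
open Finset.HasAntidiagonal (mem_antidiagonal)

/-- The sequence determined by a recursion in which the value at `s` depends on the values at
`j < s` only. -/
noncomputable def causalSeq {β : Type*} [Inhabited β] (Φ : (ℕ → β) → ℕ → β) (s : ℕ) : β :=
  Φ (fun j => if _ : j < s then causalSeq Φ j else default) s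
  termination_by s

theorem exists_seq_of_causal {β : Type*} [Inhabited β] (Φ : (ℕ → β) → ℕ → β)
    (h : ∀ x y s, (∀ j < s, x j = y j) → Φ x s = Φ y s) : ∃ x : ℕ → β, ∀ s, x s = Φ x s := by
  refine ⟨causalSeq Φ, fun s => ?_⟩
  rw [causalSeq]
  exact h _ _ s fun j hj => dif_pos hj

/-- The coefficients of `1 / (1 - ∑ y_j τ^(j+1))`. They majorize the homogeneous parts of a Lie
transform whose generators have the majorants `y_j`. -/
noncomputable def renewal (y : ℕ → ℝ) : ℕ → ℝ
  | 0 => 1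
  | s + 1 => ∑ j : Fin (s + 1), y j * renewal y (s - j)
  termination_by s => s
  decreasing_by omega

@[simp] theorem renewal_zero (y : ℕ → ℝ) : renewal y 0 = 1 := by rw [renewal]

theorem renewal_succ (y : ℕ → ℝ) (s : ℕ) :
    renewal y (s + 1) = ∑ p ∈ antidiagonal s, y p.1 * renewal y p.2 := by
  rw [renewal, Nat.sum_antidiagonal_eq_sum_range_succ_mk]
  exact Fin.sum_univ_eq_sum_range (fun j => y j * renewal y (s - j)) (s + 1)

theorem renewal_congr {y z : ℕ → ℝ} {s : ℕ} (h : ∀ j < s, y j = z j) :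
    renewal y s = renewal z s := by
  induction s using Nat.strong_induction_on with
  | _ s ih =>
    cases s with
    | zero => simp
    | succ s =>
      simp only [renewal_succ]
      refine sum_congr rfl fun p hp => ?_
      have := mem_antidiagonal.1 hp
      rw [ih p.2 (by omega) fun j hj => h j (by omega), h p.1 (by omega)]

theorem renewal_nonneg {y : ℕ → ℝ} (hy : ∀ j, 0 ≤ y j) (s : ℕ) : 0 ≤ renewal y s := by
  induction s using Nat.strong_induction_on with
  | _ s ih =>
    cases s with
    | zero => simp
    | succ s =>
      rw [renewal_succ]
      refine sum_nonneg fun p hp => mul_nonneg (hy _) (ih _ ?_)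
      have := mem_antidiagonal.1 hp
      omega

theorem sum_range_antidiagonal_le {a b : ℕ → ℝ} (ha : ∀ j, 0 ≤ a j) (hb : ∀ j, 0 ≤ b j) (m : ℕ) :
    ∑ s ∈ range m, ∑ p ∈ antidiagonal s, a p.1 * b p.2 ≤
      (∑ j ∈ range m, a j) * ∑ i ∈ range m, b i := by
  rw [sum_mul_sum, ← sum_product']
  set T := range m ×ˢ range m
  calc ∑ s ∈ range m, ∑ p ∈ antidiagonal s, a p.1 * b p.2
      = ∑ s ∈ range m, ∑ p ∈ (T.filter fun p => p.1 + p.2 < m).filter (fun p => p.1 + p.2 = s),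
          a p.1 * b p.2 := by
        refine sum_congr rfl fun s hs => sum_congr ?_ fun _ _ => rfl
        ext p
        have := mem_range.1 hs
        simp only [mem_antidiagonal, mem_filter, T, mem_product, mem_range]
        omega
    _ = ∑ p ∈ T.filter fun p => p.1 + p.2 < m, a p.1 * b p.2 :=
        sum_fiberwise_of_maps_to (fun p hp => mem_range.2 (mem_filter.1 hp).2) _
    _ ≤ _ := sum_le_sum_of_subset_of_nonneg (filter_subset _ _)
        fun p _ _ => mul_nonneg (ha _) (hb _)

theorem sum_renewal_le {y : ℕ → ℝ} (hy : ∀ j, 0 ≤ y j) {τ Y : ℝ} (hτ : 0 ≤ τ) (hY1 : Y < 1)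
    {m : ℕ} (hY : ∑ j ∈ range m, y j * τ ^ (j + 1) ≤ Y) :
    ∑ s ∈ range m, renewal y (s + 1) * τ ^ (s + 1) ≤ Y / (1 - Y) := by
  have hY0 : 0 ≤ Y := (sum_nonneg fun j _ => mul_nonneg (hy j) (pow_nonneg hτ _)).trans hY
  have hnn : ∀ s, 0 ≤ renewal y s * τ ^ s := fun s =>
    mul_nonneg (renewal_nonneg hy s) (pow_nonneg hτ _)
  set S := ∑ s ∈ range m, renewal y (s + 1) * τ ^ (s + 1) with hS
  have h1 : S ≤ Y * ∑ i ∈ range m, renewal y i * τ ^ i := by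
    calc S = ∑ s ∈ range m, ∑ p ∈ antidiagonal s,
          (y p.1 * τ ^ (p.1 + 1)) * (renewal y p.2 * τ ^ p.2) := by
          refine sum_congr rfl fun s _ => ?_
          rw [renewal_succ, sum_mul]
          refine sum_congr rfl fun p hp => ?_
          rw [← mem_antidiagonal.1 hp]
          ring
      _ ≤ _ := sum_range_antidiagonal_le (a := fun j => y j * τ ^ (j + 1))
          (fun j => mul_nonneg (hy j) (pow_nonneg hτ _)) hnn m
      _ ≤ _ := mul_le_mul_of_nonneg_right hY (sum_nonneg fun i _ => hnn i)
  have h2 : ∑ i ∈ range m, renewal y i * τ ^ i ≤ 1 + S := by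
    calc ∑ i ∈ range m, renewal y i * τ ^ i ≤ ∑ i ∈ range (m + 1), renewal y i * τ ^ i :=
          sum_le_sum_of_subset_of_nonneg (range_mono (Nat.le_succ m)) fun i _ _ => hnn i
      _ = 1 + S := by rw [sum_range_succ', add_comm]; simp [hS]
  have h3 : S ≤ Y * (1 + S) := h1.trans (mul_le_mul_of_nonneg_left h2 hY0)
  rw [le_div_iff₀ (by linarith)]
  linarith

/-- The majorants of the coefficients of the perturbation: `F b^i`, plus the contribution `m` of
the variable conjugate to time at the first order. -/
noncomputable def pertMajorant (F m b : ℝ) (i : ℕ) : ℝ := F * b ^ i + if i = 0 then m else 0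

theorem pertMajorant_nonneg {F m b : ℝ} (hF : 0 ≤ F) (hm : 0 ≤ m) (hb : 0 ≤ b) (i : ℕ) :
    0 ≤ pertMajorant F m b i := by
  unfold pertMajorant
  split_ifs <;> positivity

theorem sum_pertMajorant_le {F m b τ : ℝ} (hF : 0 ≤ F) (hm : 0 ≤ m) (hb : 0 ≤ b) (hτ : 0 ≤ τ)
    (hbτ : b * τ ≤ 1 / 2) (N : ℕ) :
    ∑ i ∈ range N, pertMajorant F m b i * τ ^ i ≤ 2 * F + m := by
  have h1 : ∀ i, pertMajorant F m b i * τ ^ i ≤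
      F * (1 / 2) ^ i + if i = 0 then m else 0 := by
    intro i
    rw [pertMajorant, add_mul]
    refine add_le_add ?_ ?_
    · rw [mul_assoc, ← mul_pow]
      gcongr
    · split_ifs with h
      · simp [h]
      · simp
  refine (sum_le_sum fun i _ => h1 i).trans ?_
  rw [sum_add_distrib, ← mul_sum]
  have h2 : ∑ i ∈ range N, ((1 : ℝ) / 2) ^ i ≤ 2 := sum_geometric_two_le N
  have h3 : ∑ i ∈ range N, (if i = 0 then m else 0) ≤ m := by
    rw [sum_ite_eq' (range N) 0 fun _ => m]
    split_ifs <;> simp [hm]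
  nlinarith

/-- The recursion satisfied by the majorants `ψ_s` of the right-hand sides of the homological
equations; `c ψ_j` majorizes the effect of the `j`-th generator. -/
def IsMajorant (F m b c : ℝ) (ψ : ℕ → ℝ) : Prop :=
  ψ 0 = F ∧ ∀ s, ψ (s + 1) = (s + 2) * (F * b ^ (s + 1)) +
    ∑ p ∈ antidiagonal s, c * ψ p.1 * pertMajorant F m b p.2 +
    ∑ p ∈ antidiagonal s, renewal (fun j => c * ψ j) (p.1 + 1) *
      (ψ p.2 + if p.2 = 0 then m else 0)

theorem exists_isMajorant (F m b c : ℝ) : ∃ ψ, IsMajorant F m b c ψ := by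
  let step : (ℕ → ℝ) → ℕ → ℝ := fun ψ s => (s + 2) * (F * b ^ (s + 1)) +
    ∑ p ∈ antidiagonal s, c * ψ p.1 * pertMajorant F m b p.2 +
    ∑ p ∈ antidiagonal s, renewal (fun j => c * ψ j) (p.1 + 1) *
      (ψ p.2 + if p.2 = 0 then m else 0)
  have hstep : ∀ x y s, (∀ j < s + 1, x j = y j) → step x s = step y s := by
    intro x y s hxy
    have h1 : ∑ p ∈ antidiagonal s, c * x p.1 * pertMajorant F m b p.2 =
        ∑ p ∈ antidiagonal s, c * y p.1 * pertMajorant F m b p.2 := by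
      refine sum_congr rfl fun p hp => ?_
      have := mem_antidiagonal.1 hp
      rw [hxy p.1 (by omega)]
    have h2 : ∑ p ∈ antidiagonal s, renewal (fun j => c * x j) (p.1 + 1) *
          (x p.2 + if p.2 = 0 then m else 0) =
        ∑ p ∈ antidiagonal s, renewal (fun j => c * y j) (p.1 + 1) *
          (y p.2 + if p.2 = 0 then m else 0) := by
      refine sum_congr rfl fun p hp => ?_
      have := mem_antidiagonal.1 hp
      have h3 : renewal (fun j => c * x j) (p.1 + 1) = renewal (fun j => c * y j) (p.1 + 1) :=
        renewal_congr fun j hj => by rw [hxy j (by omega)]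
      rw [hxy p.2 (by omega), h3]
    change _ + _ + _ = _ + _ + _
    rw [h1, h2]
  obtain ⟨ψ, hψ⟩ := exists_seq_of_causal (β := ℝ)
    (fun ψ s => Nat.casesOn s F fun s => step ψ s) (by
      rintro x y (_ | s) hxy
      · rfl
      · exact hstep x y s hxy)
  exact ⟨ψ, hψ 0, fun s => hψ (s + 1)⟩

namespace IsMajorant

variable {F m b c : ℝ} {ψ : ℕ → ℝ}

theorem nonneg (h : IsMajorant F m b c ψ) (hF : 0 ≤ F) (hm : 0 ≤ m) (hb : 0 ≤ b) (hc : 0 ≤ c)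
    (s : ℕ) : 0 ≤ ψ s := by
  induction s using Nat.strong_induction_on with
  | _ s ih =>
    cases s with
    | zero => rwa [h.1]
    | succ s =>
      rw [h.2]
      have h1 : ∀ p ∈ antidiagonal s, 0 ≤ c * ψ p.1 * pertMajorant F m b p.2 := fun p hp => by
        have := mem_antidiagonal.1 hp
        exact mul_nonneg (mul_nonneg hc (ih _ (by omega))) (pertMajorant_nonneg hF hm hb _)
      have h2 : ∀ p ∈ antidiagonal s, 0 ≤ renewal (fun j => c * ψ j) (p.1 + 1) *
          (ψ p.2 + if p.2 = 0 then m else 0) := fun p hp => by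
        have hp' := mem_antidiagonal.1 hp
        refine mul_nonneg ?_ (add_nonneg (ih _ (by omega)) (by split_ifs <;> simp [hm]))
        have hcg : renewal (fun j => c * ψ j) (p.1 + 1) =
            renewal (fun j => c * if j < s + 1 then ψ j else 0) (p.1 + 1) :=
          renewal_congr fun j hj => by rw [if_pos (by omega)]
        rw [hcg]
        refine renewal_nonneg (fun j => mul_nonneg hc ?_) _
        split_ifs with hj
        · exact ih j hj
        · exact le_rfl
      have := sum_nonneg h1
      have := sum_nonneg h2
      positivity

/-- The generating function of the majorants stays bounded at `τ`, by a bootstrap over the partial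
sums: with `g = c τ`, a partial sum `P ≤ 8 F` forces the next one below
`4 F + g P (2 F + m) + (5 / 4) g P (P + m) ≤ 8 F`, since `g (F + m)` is small. -/
theorem sum_le (h : IsMajorant F m b c ψ) (hF : 0 ≤ F) (hm : 0 ≤ m) (hb : 0 ≤ b) (hc : 0 ≤ c)
    {τ : ℝ} (hτ : 0 ≤ τ) (hbτ : b * τ ≤ 1 / 2) (hg : c * τ * (F + m) ≤ 1 / 40) (N : ℕ) :
    ∑ s ∈ range N, ψ s * τ ^ s ≤ 8 * F := by
  have hψ := h.nonneg hF hm hb hc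
  have hcτ : 0 ≤ c * τ := mul_nonneg hc hτ
  induction N with
  | zero => simpa using hF
  | succ N ih =>
    set P := ∑ s ∈ range N, ψ s * τ ^ s with hP
    have hP0 : 0 ≤ P := sum_nonneg fun s _ => mul_nonneg (hψ s) (pow_nonneg hτ _)
    have hy : ∀ j, 0 ≤ c * ψ j := fun j => mul_nonneg hc (hψ j)
    have hY : ∑ j ∈ range N, c * ψ j * τ ^ (j + 1) = c * τ * P := by
      rw [hP, mul_sum]
      exact sum_congr rfl fun j _ => by ring
    have hgP : c * τ * P ≤ 1 / 5 := by nlinarith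
    have hE := sum_renewal_le hy hτ (Y := c * τ * P) (by linarith) hY.le
    have hE' : ∑ s ∈ range N, renewal (fun j => c * ψ j) (s + 1) * τ ^ (s + 1) ≤
        c * τ * P * (5 / 4) := by
      refine hE.trans ?_
      rw [div_le_iff₀ (by linarith)]
      nlinarith [mul_nonneg hcτ hP0]
    have hexp : ∑ s ∈ range (N + 1), ψ s * τ ^ s = F + ∑ s ∈ range N, ψ (s + 1) * τ ^ (s + 1) := by
      rw [sum_range_succ', h.1]; ring
    have hz : ∑ i ∈ range N, (ψ i + if i = 0 then m else 0) * τ ^ i ≤ P + m := by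
      have : ∀ i ∈ range N, (ψ i + if i = 0 then m else 0) * τ ^ i =
          ψ i * τ ^ i + if i = 0 then m else 0 := fun i _ => by
        split_ifs with hi
        · simp [hi]
        · ring
      rw [sum_congr rfl this, sum_add_distrib, sum_ite_eq' (range N) 0 fun _ => m]
      split_ifs <;> simp [hP, hm]
    have hz0 : ∀ i, 0 ≤ (ψ i + if i = 0 then m else 0) * τ ^ i := fun i =>
      mul_nonneg (add_nonneg (hψ i) (by split_ifs <;> simp [hm])) (pow_nonneg hτ _)
    have h1 : F + ∑ s ∈ range N, ((s : ℝ) + 2) * (F * b ^ (s + 1)) * τ ^ (s + 1) ≤ 4 * F := by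
      have hterm : ∀ N : ℕ, F + ∑ s ∈ range N, ((s : ℝ) + 2) * (F * b ^ (s + 1)) * τ ^ (s + 1) ≤
          F * (4 - ((N : ℝ) + 3) * (1 / 2) ^ N) := by
        intro N
        induction N with
        | zero => simp; linarith
        | succ N ih =>
          rw [sum_range_succ, ← add_assoc]
          have hp : (b * τ) ^ (N + 1) ≤ (1 / 2) ^ (N + 1) := by gcongr
          have h5 : ((N : ℝ) + 2) * (F * b ^ (N + 1)) * τ ^ (N + 1) ≤
              F * (((N : ℝ) + 2) * (1 / 2) ^ (N + 1)) := by
            calc ((N : ℝ) + 2) * (F * b ^ (N + 1)) * τ ^ (N + 1) =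
                F * (((N : ℝ) + 2) * (b * τ) ^ (N + 1)) := by rw [mul_pow]; ring
              _ ≤ _ := by gcongr
          refine (add_le_add ih h5).trans (le_of_eq ?_)
          push_cast
          ring
      refine (hterm N).trans ?_
      have : 0 ≤ ((N : ℝ) + 3) * (1 / 2) ^ N := by positivity
      nlinarith
    have h2 : ∑ s ∈ range N, (∑ p ∈ antidiagonal s, c * ψ p.1 * pertMajorant F m b p.2) *
        τ ^ (s + 1) ≤ c * τ * P * (2 * F + m) := by
      calc _ = ∑ s ∈ range N, ∑ p ∈ antidiagonal s,
            (c * ψ p.1 * τ ^ (p.1 + 1)) * (pertMajorant F m b p.2 * τ ^ p.2) := by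
            refine sum_congr rfl fun s _ => ?_
            rw [sum_mul]
            refine sum_congr rfl fun p hp => ?_
            rw [← mem_antidiagonal.1 hp]
            ring
        _ ≤ _ := sum_range_antidiagonal_le (a := fun j => c * ψ j * τ ^ (j + 1))
            (b := fun i => pertMajorant F m b i * τ ^ i)
            (fun j => mul_nonneg (hy j) (pow_nonneg hτ _))
            (fun i => mul_nonneg (pertMajorant_nonneg hF hm hb i) (pow_nonneg hτ _)) N
        _ ≤ _ := by
            rw [hY]
            exact mul_le_mul_of_nonneg_left (sum_pertMajorant_le hF hm hb hτ hbτ N)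
              (mul_nonneg hcτ hP0)
    have h3 : ∑ s ∈ range N, (∑ p ∈ antidiagonal s, renewal (fun j => c * ψ j) (p.1 + 1) *
        (ψ p.2 + if p.2 = 0 then m else 0)) * τ ^ (s + 1) ≤
        c * τ * P * (5 / 4) * (P + m) := by
      calc _ = ∑ s ∈ range N, ∑ p ∈ antidiagonal s,
            (renewal (fun j => c * ψ j) (p.1 + 1) * τ ^ (p.1 + 1)) *
              ((ψ p.2 + if p.2 = 0 then m else 0) * τ ^ p.2) := by
            refine sum_congr rfl fun s _ => ?_
            rw [sum_mul]
            refine sum_congr rfl fun p hp => ?_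
            rw [← mem_antidiagonal.1 hp]
            ring
        _ ≤ _ := sum_range_antidiagonal_le
            (a := fun j => renewal (fun j => c * ψ j) (j + 1) * τ ^ (j + 1))
            (b := fun i => (ψ i + if i = 0 then m else 0) * τ ^ i)
            (fun j => mul_nonneg (renewal_nonneg hy _) (pow_nonneg hτ _)) hz0 N
        _ ≤ _ := mul_le_mul hE' hz (sum_nonneg fun i _ => hz0 i)
            (by have := mul_nonneg hcτ hP0; positivity)
    rw [hexp]
    have hsplit : ∑ s ∈ range N, ψ (s + 1) * τ ^ (s + 1) =
        ∑ s ∈ range N, ((s : ℝ) + 2) * (F * b ^ (s + 1)) * τ ^ (s + 1) +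
        ∑ s ∈ range N, (∑ p ∈ antidiagonal s, c * ψ p.1 * pertMajorant F m b p.2) * τ ^ (s + 1) +
        ∑ s ∈ range N, (∑ p ∈ antidiagonal s, renewal (fun j => c * ψ j) (p.1 + 1) *
          (ψ p.2 + if p.2 = 0 then m else 0)) * τ ^ (s + 1) := by
      rw [← sum_add_distrib, ← sum_add_distrib]
      exact sum_congr rfl fun s _ => by rw [h.2]; ring
    rw [hsplit]
    have hcF : c * τ * F ≤ 1 / 40 := by nlinarith
    have hcm : 0 ≤ c * τ * m := mul_nonneg hcτ hm
    have hcF0 : 0 ≤ c * τ * F := mul_nonneg hcτ hF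
    have h4 : c * τ * P * (2 * F + m) ≤ 8 * F * (1 / 20) := by
      calc c * τ * P * (2 * F + m) = P * (c * τ * (2 * F + m)) := by ring
        _ ≤ (8 * F) * (1 / 20) := by
          refine mul_le_mul ih ?_ (by positivity) (by positivity)
          nlinarith
    have h5 : c * τ * P * (5 / 4) * (P + m) ≤ 8 * F * (1 / 4) := by
      calc c * τ * P * (5 / 4) * (P + m) = P * (5 / 4 * (c * τ * (P + m))) := by ring
        _ ≤ (8 * F) * (1 / 4) := by
          refine mul_le_mul ih ?_ (by positivity) (by positivity)
          have : c * τ * P ≤ c * τ * (8 * F) := mul_le_mul_of_nonneg_left ih hcτ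
          nlinarith
    linarith

theorem sum_renewal_le (h : IsMajorant F m b c ψ) (hF : 0 ≤ F) (hm : 0 ≤ m) (hb : 0 ≤ b)
    (hc : 0 ≤ c) {τ : ℝ} (hτ : 0 ≤ τ) (hbτ : b * τ ≤ 1 / 2) (hg : c * τ * (F + m) ≤ 1 / 40)
    (N : ℕ) :
    ∑ s ∈ range N, renewal (fun j => c * ψ j) (s + 1) * τ ^ (s + 1) ≤ 10 * (c * τ * F) := by
  have hψ := h.nonneg hF hm hb hc
  have hcτ : 0 ≤ c * τ := mul_nonneg hc hτ
  have hY : ∑ j ∈ range N, c * ψ j * τ ^ (j + 1) ≤ 8 * (c * τ * F) := by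
    calc ∑ j ∈ range N, c * ψ j * τ ^ (j + 1) = c * τ * ∑ j ∈ range N, ψ j * τ ^ j := by
          rw [mul_sum]; exact sum_congr rfl fun j _ => by ring
      _ ≤ c * τ * (8 * F) :=
          mul_le_mul_of_nonneg_left (h.sum_le hF hm hb hc hτ hbτ hg N) hcτ
      _ = _ := by ring
  have hcm : 0 ≤ c * τ * m := mul_nonneg hcτ hm
  have hcF : c * τ * F ≤ 1 / 40 := by nlinarith
  have hcF0 : 0 ≤ c * τ * F := mul_nonneg hcτ hF
  refine (SlowNekhoroshev.sum_renewal_le (fun j => mul_nonneg hc (hψ j)) hτ (by linarith)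
    hY).trans ?_
  rw [div_le_iff₀ (by linarith)]
  nlinarith

variable {Δ : ℝ}

/-- The factors `s + 2` produced by differentiation are absorbed by passing from `1 / Δ` to the
point `2 / Δ` of the generating function. -/
theorem renewal_weight_sum_le (h : IsMajorant F m b c ψ) (hF : 0 ≤ F) (hm : 0 ≤ m) (hb : 0 ≤ b)
    (hc : 0 ≤ c) (hΔ : 0 < Δ) (hbΔ : 4 * b ≤ Δ) (hg : c * (2 / Δ) * (F + m) ≤ 1 / 40)
    (N : ℕ) :
    ∑ s ∈ range N, ((s : ℝ) + 2) * renewal (fun j => c * ψ j) (s + 1) * (1 / Δ) ^ (s + 1) ≤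
      10 * (c * (2 / Δ) * F) := by
  have hbτ : b * (2 / Δ) ≤ 1 / 2 := by rw [mul_div_assoc', div_le_iff₀ hΔ]; linarith
  refine le_trans (sum_le_sum fun s _ => ?_)
    (h.sum_renewal_le hF hm hb hc (by positivity) hbτ hg N)
  have hr := renewal_nonneg (y := fun j => c * ψ j)
    (fun j => mul_nonneg hc (h.nonneg hF hm hb hc j)) (s + 1)
  have h2 : ((s : ℝ) + 2) ≤ 2 ^ (s + 1) := by
    have : s + 1 + 1 ≤ 2 ^ (s + 1) := Nat.lt_two_pow_self
    exact_mod_cast this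
  calc ((s : ℝ) + 2) * renewal (fun j => c * ψ j) (s + 1) * (1 / Δ) ^ (s + 1)
      ≤ 2 ^ (s + 1) * renewal (fun j => c * ψ j) (s + 1) * (1 / Δ) ^ (s + 1) := by gcongr
    _ = _ := by rw [div_pow, div_pow]; ring

theorem renewal_sum_le (h : IsMajorant F m b c ψ) (hF : 0 ≤ F) (hm : 0 ≤ m) (hb : 0 ≤ b)
    (hc : 0 ≤ c) (hΔ : 0 < Δ) (hΔ1 : Δ ≤ 1) (hbΔ : 4 * b ≤ Δ)
    (hg : c * (2 / Δ) * (F + m) ≤ 1 / 40) (N : ℕ) :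
    ∑ s ∈ range N, ((s : ℝ) + 2) * renewal (fun j => c * ψ j) (s + 1) ≤ 1 / 4 := by
  have hcF : c * (2 / Δ) * F ≤ 1 / 40 := by
    have : 0 ≤ c * (2 / Δ) * m := by positivity
    nlinarith
  refine le_trans (le_trans (sum_le_sum fun s _ => ?_)
    (h.renewal_weight_sum_le hF hm hb hc hΔ hbΔ hg N)) (by linarith)
  have hr := renewal_nonneg (y := fun j => c * ψ j)
    (fun j => mul_nonneg hc (h.nonneg hF hm hb hc j)) (s + 1)
  refine le_mul_of_one_le_right (by positivity) (one_le_pow₀ ?_)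
  rwa [le_div_iff₀ hΔ, one_mul]

/-- The terms of order larger than `r` in the product of the two series are of size `Δ ^ r`. -/
theorem remainder_sum_le (h : IsMajorant F m b c ψ) (hF : 0 ≤ F) (hm : 0 ≤ m) (hb : 0 ≤ b)
    (hc : 0 ≤ c) (hΔ : 0 < Δ) (hΔ1 : Δ ≤ 1) (hbΔ : 4 * b ≤ Δ)
    (hg : c * (2 / Δ) * (F + m) ≤ 1 / 40) (r : ℕ) :
    ∑ s ∈ range r, ∑ i ∈ range r, (if r ≤ s + 1 + i then
      ((s : ℝ) + 2) * renewal (fun j => c * ψ j) (s + 1) * pertMajorant F m b i else 0) ≤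
      F * Δ ^ r := by
  have hr : ∀ s, 0 ≤ renewal (fun j => c * ψ j) s := renewal_nonneg
    (fun j => mul_nonneg hc (h.nonneg hF hm hb hc j))
  have hbτ : b * (1 / Δ) ≤ 1 / 2 := by
    rw [mul_div_assoc', div_le_iff₀ hΔ]; linarith
  have hΔi : 1 ≤ 1 / Δ := by rwa [le_div_iff₀ hΔ, one_mul]
  have hterm : ∀ s ∈ range r, ∀ i ∈ range r, (if r ≤ s + 1 + i then
      ((s : ℝ) + 2) * renewal (fun j => c * ψ j) (s + 1) * pertMajorant F m b i else 0) ≤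
      Δ ^ r * ((((s : ℝ) + 2) * renewal (fun j => c * ψ j) (s + 1) * (1 / Δ) ^ (s + 1)) *
        (pertMajorant F m b i * (1 / Δ) ^ i)) := by
    intro s _ i _
    have hp := pertMajorant_nonneg hF hm hb i
    have hrs := hr (s + 1)
    split_ifs with hsi
    · have h1 : 1 ≤ Δ ^ r * (1 / Δ) ^ (s + 1 + i) := by
        calc (1 : ℝ) = Δ ^ r * (1 / Δ) ^ r := by
              rw [← mul_pow, mul_one_div_cancel hΔ.ne', one_pow]
          _ ≤ _ := by gcongr
      calc ((s : ℝ) + 2) * renewal (fun j => c * ψ j) (s + 1) * pertMajorant F m b i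
          ≤ ((s : ℝ) + 2) * renewal (fun j => c * ψ j) (s + 1) * pertMajorant F m b i *
            (Δ ^ r * (1 / Δ) ^ (s + 1 + i)) := le_mul_of_one_le_right (by positivity) h1
        _ = _ := by rw [pow_add]; ring
    · positivity
  calc _ ≤ ∑ s ∈ range r, ∑ i ∈ range r,
        Δ ^ r * ((((s : ℝ) + 2) * renewal (fun j => c * ψ j) (s + 1) * (1 / Δ) ^ (s + 1)) *
        (pertMajorant F m b i * (1 / Δ) ^ i)) :=
        sum_le_sum fun s hs => sum_le_sum fun i hi => hterm s hs i hi
    _ = Δ ^ r * ((∑ s ∈ range r, ((s : ℝ) + 2) * renewal (fun j => c * ψ j) (s + 1) *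
        (1 / Δ) ^ (s + 1)) * ∑ i ∈ range r, pertMajorant F m b i * (1 / Δ) ^ i) := by
        rw [sum_mul_sum, mul_sum]
        exact sum_congr rfl fun s _ => (mul_sum _ _ _).symm
    _ ≤ Δ ^ r * (10 * (c * (2 / Δ) * F) * (2 * F + m)) := by
        refine mul_le_mul_of_nonneg_left (mul_le_mul
          (h.renewal_weight_sum_le hF hm hb hc hΔ hbΔ hg r)
          (sum_pertMajorant_le hF hm hb (by positivity) hbτ r)
          (sum_nonneg fun i _ => mul_nonneg (pertMajorant_nonneg hF hm hb i) (by positivity))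
          (by positivity)) (by positivity)
    _ = 10 * F * (c * (2 / Δ) * (2 * F + m)) * Δ ^ r := by ring
    _ ≤ 10 * F * (1 / 20) * Δ ^ r := by
        gcongr
        have : 0 ≤ c * (2 / Δ) * m := by positivity
        nlinarith
    _ ≤ F * Δ ^ r := by
        have : 0 ≤ F * Δ ^ r := by positivity
        linarith

end IsMajorant

end Majorants

end SlowNekhoroshev

namespace SlowNekhoroshev

/-! ### The normal form and the almost invariant observable -/

section NormalForm

open Finset hiding mem_antidiagonal
open Finset.HasAntidiagonal (mem_antidiagonal)

section Recursion

variable {L : Type*} [LieRing L] [LieAlgebra ℂ L]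

/-- The recursion for the right-hand sides `Ψ_s` of the homological equations, given operators
which solve these equations. -/
theorem exists_homological_seq (sol res : L → L) (H : ℕ → L) :
    ∃ Ψ : ℕ → L, Ψ 0 = H 1 ∧ ∀ s, Ψ (s + 1) = ((s : ℂ) + 2) • H (s + 2) -
      ∑ p ∈ antidiagonal s, ⁅sol (Ψ p.1), H (p.2 + 1)⁆ -
      ∑ p ∈ antidiagonal s, lieTransform (fun j => sol (Ψ j)) (p.1 + 1) (res (Ψ p.2)) := by
  have : Inhabited L := ⟨0⟩
  let step : (ℕ → L) → ℕ → L := fun Ψ s => ((s : ℂ) + 2) • H (s + 2) -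
      ∑ p ∈ antidiagonal s, ⁅sol (Ψ p.1), H (p.2 + 1)⁆ -
      ∑ p ∈ antidiagonal s, lieTransform (fun j => sol (Ψ j)) (p.1 + 1) (res (Ψ p.2))
  have hstep : ∀ x y s, (∀ j < s + 1, x j = y j) → step x s = step y s := by
    intro x y s hxy
    have h1 : ∑ p ∈ antidiagonal s, ⁅sol (x p.1), H (p.2 + 1)⁆ =
        ∑ p ∈ antidiagonal s, ⁅sol (y p.1), H (p.2 + 1)⁆ := by
      refine sum_congr rfl fun p hp => ?_
      have := mem_antidiagonal.1 hp
      rw [hxy p.1 (by omega)]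
    have h2 : ∑ p ∈ antidiagonal s, lieTransform (fun j => sol (x j)) (p.1 + 1) (res (x p.2)) =
        ∑ p ∈ antidiagonal s, lieTransform (fun j => sol (y j)) (p.1 + 1) (res (y p.2)) := by
      refine sum_congr rfl fun p hp => ?_
      have := mem_antidiagonal.1 hp
      have h3 : lieTransform (fun j => sol (x j)) (p.1 + 1) (res (y p.2)) =
          lieTransform (fun j => sol (y j)) (p.1 + 1) (res (y p.2)) :=
        lieTransform_congr (fun j hj => by rw [hxy j (by omega)]) _
      rw [hxy p.2 (by omega), h3]
    change _ - _ - _ = _ - _ - _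
    rw [h1, h2]
  obtain ⟨Ψ, hΨ⟩ := exists_seq_of_causal (β := L)
    (fun Ψ s => Nat.casesOn s (H 1) fun s => step Ψ s) (by
      rintro x y (_ | s) hxy
      · rfl
      · exact hstep x y s hxy)
  exact ⟨Ψ, hΨ 0, fun s => hΨ (s + 1)⟩

/-- The homological equations, solved order by order, say that the expansion satisfies
`∂_τ H = ⁅X, H⁆ + E Z` with `X` the generators and `Z` the resonant parts. -/
theorem homological_identity {sol res : L → L} {H Ψ : ℕ → L} (h0 : Ψ 0 = H 1)
    (hs : ∀ s, Ψ (s + 1) = ((s : ℂ) + 2) • H (s + 2) -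
      ∑ p ∈ antidiagonal s, ⁅sol (Ψ p.1), H (p.2 + 1)⁆ -
      ∑ p ∈ antidiagonal s, lieTransform (fun j => sol (Ψ j)) (p.1 + 1) (res (Ψ p.2)))
    {m : ℕ} (hsol : ⁅sol (Ψ m), H 0⁆ + res (Ψ m) = Ψ m) :
    ((m : ℂ) + 1) • H (m + 1) = ∑ p ∈ antidiagonal m, ⁅sol (Ψ p.1), H p.2⁆ +
      ∑ p ∈ antidiagonal m, lieTransform (fun j => sol (Ψ j)) p.1 (res (Ψ p.2)) := by
  cases m with
  | zero => rw [h0] at hsol; simp [h0, hsol]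
  | succ m =>
    rw [Nat.sum_antidiagonal_succ', Nat.sum_antidiagonal_succ]
    have h2 : (((m + 1 : ℕ) : ℂ) + 1) = (m : ℂ) + 2 := by push_cast; ring
    have h3 := hs m
    rw [lieTransform_zero, h2]
    have h4 : ((m : ℂ) + 2) • H (m + 2) = Ψ (m + 1) +
        ∑ p ∈ antidiagonal m, ⁅sol (Ψ p.1), H (p.2 + 1)⁆ +
        ∑ p ∈ antidiagonal m, lieTransform (fun j => sol (Ψ j)) (p.1 + 1) (res (Ψ p.2)) := by
      rw [h3]; abel
    rw [h4]
    nth_rewrite 1 [← hsol]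
    abel

/-- In the bracket of the truncated series, only the terms of total order larger than `r`
survive. -/
theorem lie_sum_eq_remainder {L : Type*} [LieRing L] {Q H : ℕ → L} {r : ℕ}
    (h : ∀ m ≤ r, ∑ p ∈ antidiagonal m, ⁅Q p.1, H p.2⁆ = 0) :
    ⁅∑ s ∈ range (r + 1), Q s, ∑ i ∈ range (r + 1), H i⁆ =
      ∑ s ∈ range r, ∑ i ∈ range r, if r ≤ s + 1 + i then ⁅Q (s + 1), H (i + 1)⁆ else 0 := by
  have h1 : ⁅∑ s ∈ range (r + 1), Q s, ∑ i ∈ range (r + 1), H i⁆ =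
      ∑ s ∈ range (r + 1), ∑ i ∈ range (r + 1), if s + i ≤ r then 0 else ⁅Q s, H i⁆ := by
    have h2 : ⁅∑ s ∈ range (r + 1), Q s, ∑ i ∈ range (r + 1), H i⁆ =
        ∑ s ∈ range (r + 1), ∑ i ∈ range (r + 1), (if s + i ≤ r then ⁅Q s, H i⁆ else 0) +
        ∑ s ∈ range (r + 1), ∑ i ∈ range (r + 1), if s + i ≤ r then 0 else ⁅Q s, H i⁆ := by
      rw [← sum_add_distrib, sum_lie]
      refine sum_congr rfl fun s _ => ?_
      rw [← sum_add_distrib, lie_sum]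
      refine sum_congr rfl fun i _ => ?_
      split_ifs <;> simp
    rw [h2]
    have h3 : ∑ s ∈ range (r + 1), ∑ i ∈ range (r + 1), (if s + i ≤ r then ⁅Q s, H i⁆ else 0) =
        ∑ m ∈ range (r + 1), ∑ p ∈ antidiagonal m, ⁅Q p.1, H p.2⁆ := by
      rw [← sum_product', ← sum_filter]
      rw [← sum_fiberwise_of_maps_to (s := (range (r + 1) ×ˢ range (r + 1)).filter
        fun p => p.1 + p.2 ≤ r) (t := range (r + 1)) (g := fun p => p.1 + p.2) fun p hp =>
          mem_range.2 (Nat.lt_succ_of_le (mem_filter.1 hp).2)]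
      refine sum_congr rfl fun m hm => sum_congr ?_ fun _ _ => rfl
      ext p
      have := mem_range.1 hm
      simp only [mem_antidiagonal, mem_filter, mem_product, mem_range]
      omega
    rw [h3, sum_eq_zero fun m hm => h m (Nat.lt_succ_iff.1 (mem_range.1 hm)), zero_add]
  rw [h1, sum_range_succ', sum_eq_zero (s := range (r + 1))
    (f := fun i => if 0 + i ≤ r then _ else _)
    fun i hi => if_pos (by have := mem_range.1 hi; omega), add_zero]
  refine sum_congr rfl fun s hs => ?_
  rw [sum_range_succ', if_pos (by have := mem_range.1 hs; omega), add_zero]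
  refine sum_congr rfl fun i _ => ?_
  by_cases hsi : r ≤ s + 1 + i
  · rw [if_pos hsi, if_neg (by omega)]
  · rw [if_neg hsi, if_pos (by omega)]

end Recursion

open TopologicalSpace (Opens)

variable {n : ℕ} {U : Opens (ActTime n)}

theorem trigBracket_single_zero_apply (F : Trig U) (h : Hol U) (k : Fin n → ℤ) (z : ActTime n) :
    trigBracket F (Finsupp.single 0 h) k z = -(F k z * Hol.dir (modeDir k) h z) := by
  induction F using Finsupp.induction_linear with
  | zero => simp [Hol.zero_apply]
  | add F G hF hG =>
    rw [map_add, LinearMap.add_apply, Finsupp.add_apply, Hol.add_apply, hF, hG,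
      Finsupp.add_apply, Hol.add_apply]
    ring
  | single l f =>
    rw [trigBracket_single, add_zero]
    by_cases hkl : k = l
    · subst hkl
      rw [Finsupp.single_eq_same, Finsupp.single_eq_same, modeBracket_apply, modeDir_zero,
        Hol.dir_zero, Hol.sub_apply, Hol.mul_apply, Hol.mul_apply, Hol.zero_apply]
      ring
    · rw [Finsupp.single_eq_of_ne hkl, Finsupp.single_eq_of_ne hkl, Hol.zero_apply]
      simp

/-- The Fourier modes of length at least `N` vanish. -/
def SuppLt (F : Trig U) (N : ℕ) : Prop := ∀ k, N ≤ modeLen k → F k = 0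

namespace SuppLt

variable {F G : Trig U} {N N' : ℕ}

theorem mono (h : SuppLt F N) (hN : N ≤ N') : SuppLt F N' := fun k hk => h k (hN.trans hk)

theorem add (hF : SuppLt F N) (hG : SuppLt G N) : SuppLt (F + G) N := fun k hk => by
  rw [Finsupp.add_apply, hF k hk, hG k hk, add_zero]

theorem smul (hF : SuppLt F N) (a : ℂ) : SuppLt (a • F) N := fun k hk => by
  rw [Finsupp.smul_apply, hF k hk, smul_zero]

theorem sub (hF : SuppLt F N) (hG : SuppLt G N) : SuppLt (F - G) N := fun k hk => by
  rw [Finsupp.sub_apply, hF k hk, hG k hk, sub_zero]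

theorem sum {ι : Type*} {s : Finset ι} {F : ι → Trig U} (h : ∀ i ∈ s, SuppLt (F i) N) :
    SuppLt (∑ i ∈ s, F i) N := fun k hk => by
  rw [Finsupp.finsetSum_apply]
  exact sum_eq_zero fun i hi => h i hi k hk

theorem timeDeriv (hF : SuppLt F N) : SuppLt (timeDeriv F) N := fun k hk => by
  simp [SlowNekhoroshev.timeDeriv, hF k hk]

theorem trigBracket (hF : SuppLt F N) (hG : SuppLt G N') : SuppLt (trigBracket F G) (N + N') := by
  rw [trigBracket_eq_sum]
  refine SuppLt.sum fun k hk => SuppLt.sum fun l hl m hm => ?_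
  have hk' : modeLen k < N := by
    by_contra h
    exact Finsupp.mem_support_iff.1 hk (hF k (not_lt.1 h))
  have hl' : modeLen l < N' := by
    by_contra h
    exact Finsupp.mem_support_iff.1 hl (hG l (not_lt.1 h))
  have := modeLen_add_le k l
  refine Finsupp.single_eq_of_ne fun h => ?_
  subst h
  omega

theorem lie {x y : Obs U} (hx : SuppLt x.fn N) (hy : SuppLt y.fn N') :
    SuppLt ⁅x, y⁆.fn (N + N') := by
  rw [Obs.lie_fn]
  exact ((hx.trigBracket hy).add ((hx.timeDeriv.smul _).mono (Nat.le_add_right _ _))).sub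
    ((hy.timeDeriv.smul _).mono (Nat.le_add_left _ _))

theorem lieTransform {X : ℕ → Obs U} {K : ℕ} {G : Obs U} (hG : SuppLt G.fn N) (s : ℕ)
    (hX : ∀ j < s, SuppLt (X j).fn ((j + 1) * K)) :
    SuppLt (lieTransform X s G).fn (s * K + N) := by
  induction s using Nat.strong_induction_on with
  | _ s ih =>
    cases s with
    | zero => simpa using hG
    | succ s =>
      rw [lieTransform_succ, Obs.smul_fn, Obs.sum_fn]
      refine SuppLt.smul (SuppLt.sum fun p hp => ?_) _
      have := mem_antidiagonal.1 hp
      refine ((hX p.1 (by omega)).lie (ih p.2 (by omega) fun j hj => hX j (by omega))).mono ?_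
      rw [← this]
      exact le_of_eq (by ring)

end SuppLt

theorem lieTransform_succ_eta (X : ℕ → Obs U) (s : ℕ) (G : Obs U) :
    (lieTransform X (s + 1) G).eta = 0 := by
  simp [lieTransform_succ]

open scoped Classical in
/-- The solution of the homological equation for a single mode: division by the small divisor
`k·∂h`, off the resonant modes. -/
noncomputable def solveMode (h : Hol U) (M : Set (Fin n → ℤ)) (k : Fin n → ℤ) (f : Hol U) : Hol U :=
  if hk : k ∉ M ∧ ∀ z ∈ U, Hol.dir (modeDir k) h z ≠ 0 then
    Hol.ofFun (fun z => -f z * (Hol.dir (modeDir k) h z)⁻¹)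
      (f.differentiableOn.neg.mul ((Hol.dir (modeDir k) h).differentiableOn.inv hk.2))
  else 0

theorem solveMode_zero (h : Hol U) (M : Set (Fin n → ℤ)) (k : Fin n → ℤ) :
    solveMode h M k 0 = 0 := by
  unfold solveMode
  split_ifs
  · refine Hol.ext_on fun z hz => ?_
    rw [Hol.ofFun_apply hz, Hol.zero_apply, neg_zero, zero_mul]
  · rfl

/-- The generator solving the homological equation with right-hand side `Ψ`. -/
noncomputable def solveHom (h : Hol U) (M : Set (Fin n → ℤ)) (Ψ : Obs U) : Obs U :=
  ⟨Finsupp.onFinset Ψ.fn.support (fun k => solveMode h M k (Ψ.fn k)) fun k hk => by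
    rw [Finsupp.mem_support_iff]
    rintro h0
    exact hk (by rw [h0, solveMode_zero]), 0⟩

open scoped Classical in
/-- The resonant part, which enters the normal form. -/
noncomputable def resonantPart (M : Set (Fin n → ℤ)) (Ψ : Obs U) : Obs U :=
  ⟨Ψ.fn.filter (· ∈ M), Ψ.eta⟩

theorem solveHom_fn_apply (h : Hol U) (M : Set (Fin n → ℤ)) (Ψ : Obs U) (k : Fin n → ℤ) :
    (solveHom h M Ψ).fn k = solveMode h M k (Ψ.fn k) := rfl

theorem SuppLt.solveHom {h : Hol U} {M : Set (Fin n → ℤ)} {Ψ : Obs U} {N : ℕ}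
    (hΨ : SuppLt Ψ.fn N) : SuppLt (solveHom h M Ψ).fn N := fun k hk => by
  rw [solveHom_fn_apply, hΨ k hk, solveMode_zero]

theorem SuppLt.resonantPart {M : Set (Fin n → ℤ)} {Ψ : Obs U} {N : ℕ}
    (hΨ : SuppLt Ψ.fn N) : SuppLt (resonantPart M Ψ).fn N := fun k hk => by
  classical
  simp [SlowNekhoroshev.resonantPart, Finsupp.filter_apply, hΨ k hk]

variable {h : Hol U} {M : Set (Fin n → ℤ)} {α : ℝ} {N : ℕ}

/-- The homological equation, for a right-hand side whose modes are all controlled by the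
non-resonance condition. -/
theorem lie_solveHom (hα : 0 ≤ α)
    (hnr : ∀ k ∉ M, modeLen k < N → ∀ z ∈ U, α < ‖Hol.dir (modeDir k) h z‖) {Ψ : Obs U}
    (hΨ : SuppLt Ψ.fn N) :
    ⁅solveHom h M Ψ, (⟨Finsupp.single 0 h, 0⟩ : Obs U)⁆ + resonantPart M Ψ = Ψ := by
  classical
  have hfn : ⁅solveHom h M Ψ, (⟨Finsupp.single 0 h, 0⟩ : Obs U)⁆.fn =
      trigBracket (solveHom h M Ψ).fn (Finsupp.single 0 h) := by
    simp [Obs.lie_fn, solveHom]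
  ext1
  · rw [Obs.add_fn, hfn]
    refine Finsupp.ext fun k => Hol.ext_on fun z hz => ?_
    rw [Finsupp.add_apply, Hol.add_apply, trigBracket_single_zero_apply, solveHom_fn_apply]
    simp only [resonantPart, Finsupp.filter_apply]
    by_cases hk : k ∈ M
    · rw [if_pos hk, solveMode, dif_neg (fun hh => hh.1 hk), Hol.zero_apply]
      ring
    · rw [if_neg hk, Hol.zero_apply, add_zero]
      by_cases hN : N ≤ modeLen k
      · rw [hΨ k hN, solveMode_zero, Hol.zero_apply]; ring
      · have hne : ∀ z ∈ U, Hol.dir (modeDir k) h z ≠ 0 := fun z hz =>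
          norm_pos_iff.1 (hα.trans_lt (hnr k hk (not_le.1 hN) z hz))
        rw [solveMode, dif_pos ⟨hk, hne⟩, Hol.ofFun_apply hz, inv_mul_cancel_right₀ (hne z hz),
          neg_neg]
  · simp [resonantPart]

theorem norm_solveHom_le (hα : 0 < α)
    (hnr : ∀ k ∉ M, modeLen k < N → ∀ z ∈ U, α < ‖Hol.dir (modeDir k) h z‖) {Ψ : Obs U}
    (hΨ : SuppLt Ψ.fn N) (k : Fin n → ℤ) (z : ActTime n) :
    ‖(solveHom h M Ψ).fn k z‖ ≤ 1 / α * ‖Ψ.fn k z‖ := by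
  rw [solveHom_fn_apply, solveMode]
  split_ifs with hk
  · by_cases hz : z ∈ U
    · by_cases hN : N ≤ modeLen k
      · rw [hΨ k hN, Hol.ofFun_apply hz, Hol.zero_apply]; simp
      · rw [Hol.ofFun_apply hz, norm_mul, norm_inv, norm_neg, mul_comm, one_div]
        gcongr
        exact (hnr k hk.1 (not_le.1 hN) z hz).le
    · rw [Hol.apply_of_notMem _ hz, norm_zero]; positivity
  · rw [Hol.zero_apply, norm_zero]; positivity

theorem norm_resonantPart_le (Ψ : Obs U) (k : Fin n → ℤ) (z : ActTime n) :
    ‖(resonantPart M Ψ).fn k z‖ ≤ 1 * ‖Ψ.fn k z‖ := by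
  classical
  simp only [resonantPart, Finsupp.filter_apply, one_mul]
  split_ifs
  · rfl
  · rw [Hol.zero_apply, norm_zero]; positivity

end NormalForm

end SlowNekhoroshev

namespace SlowNekhoroshev

/-! ### Estimates of the normal form -/

section Estimates

open Finset hiding mem_antidiagonal
open Finset.HasAntidiagonal (mem_antidiagonal)

variable {n : ℕ} {V : Set (EuclideanSpace ℝ (Fin n))} {δ σ : ℝ}

/-- The constant of the bracket estimate. -/
noncomputable def bracketConst (δ σ : ℝ) : ℝ := 2 * Real.exp 1 / (δ * σ)

theorem bracketConst_pos (hδ : 0 < δ) (hσ : 0 < σ) : 0 < bracketConst δ σ := by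
  unfold bracketConst; positivity

/-- The bracket with `G` obeys the same estimate as the bracket with a function of bound `d` and
exponent `q`. This also covers observables which are not small themselves, but whose derivatives
are. -/
def AdBound (G : Obs (dom V δ σ 0)) (q : ℕ) (d : ℝ) : Prop :=
  ∀ (p : ℕ) (c : ℝ) (X : Obs (dom V δ σ 0)), X.eta = 0 → 0 ≤ c → NagumoBound X.fn p c →
    NagumoBound ⁅X, G⁆.fn (p + q + 1) (bracketConst δ σ * (p + 1) * (q + 1) * (c * d))

theorem AdBound.of_nagumoBound {G : Obs (dom V δ σ 0)} {q : ℕ} {d : ℝ} (hδ : 0 < δ) (hσ : 0 < σ)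
    (hη : G.eta = 0) (hG : NagumoBound G.fn q d) : AdBound G q d := by
  intro p c X hX hc hXb
  have : ⁅X, G⁆.fn = trigBracket X.fn G.fn := by simp [Obs.lie_fn, hη, hX]
  rw [this]
  exact hXb.trigBracket hG hc hδ hσ

theorem AdBound.of_nagumoBound_zero {G : Obs (dom V δ σ 0)} {d m : ℝ} (hδ : 0 < δ) (hσ : 0 < σ)
    (hd : 0 ≤ d) (hη : ‖G.eta‖ * δ / 2 ≤ m) (hG : NagumoBound G.fn 0 d) :
    AdBound G 0 (d + m) := by
  intro p c X hX hc hXb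
  have : ⁅X, G⁆.fn = trigBracket X.fn G.fn + G.eta • timeDeriv X.fn := by simp [Obs.lie_fn, hX]
  rw [this]
  have h1 := hXb.trigBracket hG hc hδ hσ
  have h2 := (hXb.timeDeriv hδ hσ).smul G.eta
  refine (h1.add h2 (by positivity) (by positivity)).mono ?_
  have h3 : ‖G.eta‖ * (Real.exp 1 / σ * (p + 1) * c) =
      bracketConst δ σ * (p + 1) * c * (‖G.eta‖ * δ / 2) := by
    unfold bracketConst; field_simp
  have h4 : 0 ≤ bracketConst δ σ * (p + 1) * c := by
    have := bracketConst_pos hδ hσ; positivity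
  rw [h3]
  calc _ ≤ 2 * Real.exp 1 / (δ * σ) * (p + 1) * ((0 : ℕ) + 1) * (c * d) +
        bracketConst δ σ * (p + 1) * c * m := by gcongr
    _ = _ := by unfold bracketConst; push_cast; ring

/-- The bracket with a function of the actions whose derivatives along the modes are at most the
length of the modes, for instance a linear function. -/
theorem AdBound.of_dir_le {ℓ : Hol (dom V δ σ 0)} (hδ : 0 < δ) (hσ : 0 < σ)
    (hℓ : ∀ k z, ‖Hol.dir (modeDir k) ℓ z‖ ≤ modeLen k) :
    AdBound (⟨Finsupp.single 0 ℓ, 0⟩ : Obs (dom V δ σ 0)) 0 δ := by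
  intro p c X hX hc hXb
  have : ⁅X, (⟨Finsupp.single 0 ℓ, 0⟩ : Obs (dom V δ σ 0))⁆.fn =
      trigBracket X.fn (Finsupp.single 0 ℓ) := by simp [Obs.lie_fn, hX]
  rw [this]
  refine (hXb.of_norm_le_modeLen_mul (F := trigBracket X.fn (Finsupp.single 0 ℓ)) hσ zero_le_one
    fun k z => ?_).mono ?_
  · rw [trigBracket_single_zero_apply, norm_neg, norm_mul, mul_one, mul_comm]
    exact mul_le_mul_of_nonneg_right (hℓ k z) (norm_nonneg _)
  · have he : (1 : ℝ) ≤ 2 * Real.exp 1 := by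
      have := Real.add_one_le_exp (1 : ℝ); linarith
    calc 1 / σ * (p + 1) * (1 * c) ≤ 2 * Real.exp 1 / σ * (p + 1) * (1 * c) := by gcongr
      _ = _ := by unfold bracketConst; push_cast; field_simp; ring

/-- The estimate of the Lie transform: the factor `1 / s` compensates the loss `j + 1` due to the
`j`-th generator, and the exponent of the other factor is at most `r`. -/
theorem nagumoBound_lieTransform {X : ℕ → Obs (dom V δ σ 0)} {x : ℕ → ℝ} {N r q : ℕ}
    {G : Obs (dom V δ σ 0)} {d : ℝ} (hδ : 0 < δ) (hσ : 0 < σ) (hXe : ∀ j, (X j).eta = 0)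
    (hX : ∀ j < N, NagumoBound (X j).fn j (x j)) (hx : ∀ j, 0 ≤ x j) (hd : 0 ≤ d)
    (hG : AdBound G q d) {s : ℕ} (hs : s < N) (hsr : s + 1 + q ≤ r) :
    NagumoBound (lieTransform X (s + 1) G).fn (q + (s + 1))
      (renewal (fun j => bracketConst δ σ * r * x j) (s + 1) * d) := by
  have hκ := bracketConst_pos hδ hσ
  have hy : ∀ j, 0 ≤ bracketConst δ σ * r * x j := fun j => by have := hx j; positivity
  induction s using Nat.strong_induction_on with
  | _ s ih =>
    have hE : ∀ i ≤ s, AdBound (lieTransform X i G) (q + i)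
        (renewal (fun j => bracketConst δ σ * r * x j) i * d) := by
      rintro (_ | i) hi
      · simpa using hG
      · exact AdBound.of_nagumoBound hδ hσ (lieTransform_succ_eta X i G)
          (ih i (by omega) (by omega) (by omega))
    rw [lieTransform_succ, Obs.smul_fn, Obs.sum_fn]
    have hsum : NagumoBound (∑ p ∈ antidiagonal s, ⁅X p.1, lieTransform X p.2 G⁆.fn)
        (q + (s + 1)) (∑ p ∈ antidiagonal s, ((s : ℝ) + 1) *
          ((bracketConst δ σ * r * x p.1) *
            (renewal (fun j => bracketConst δ σ * r * x j) p.2 * d))) := by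
      refine NagumoBound.sum (fun p hp => ?_) (fun p hp => ?_)
      all_goals
        have hp' := mem_antidiagonal.1 hp
        have hr := renewal_nonneg hy p.2
        have hx1 := hx p.1
      · have h1 := hE p.2 (by omega) p.1 (x p.1) (X p.1) (hXe _) hx1 (hX _ (by omega))
        rw [show p.1 + (q + p.2) + 1 = q + (s + 1) by omega] at h1
        refine h1.mono ?_
        have h2 : ((p.1 : ℝ) + 1) ≤ s + 1 := by
          have : p.1 ≤ s := by omega
          exact_mod_cast Nat.succ_le_succ this
        have h3 : (((q + p.2 : ℕ) : ℝ) + 1) ≤ r := by exact_mod_cast (by omega : q + p.2 + 1 ≤ r)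
        calc bracketConst δ σ * (p.1 + 1) * (((q + p.2 : ℕ) : ℝ) + 1) * (x p.1 *
              (renewal (fun j => bracketConst δ σ * r * x j) p.2 * d))
            ≤ bracketConst δ σ * (s + 1) * r * (x p.1 *
              (renewal (fun j => bracketConst δ σ * r * x j) p.2 * d)) := by gcongr
          _ = _ := by ring
      · positivity
    refine (hsum.smul _).mono (le_of_eq ?_)
    have hs1 : ‖((s : ℂ) + 1)⁻¹‖ = ((s : ℝ) + 1)⁻¹ := by
      rw [norm_inv]
      congr 1
      exact_mod_cast Complex.norm_natCast (s + 1)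
    rw [hs1, ← mul_sum, inv_mul_cancel_left₀ (by positivity), renewal_succ, sum_mul]
    exact sum_congr rfl fun p _ => by ring

/-- The data of the perturbation problem: the Hamiltonian `∑ H_i`, expanded according to the
length of the Fourier modes, with an integrable part `H_0 = h` which is non-resonant off `M`. The
order in the formal parameter is the index `i`: the modes of `H_i` have length less than `i K` and
its size is `F b ^ (i - 1)`. The number `m` accounts for the variable conjugate to slow time, which
belongs to `H_1`. -/
structure IsPerturbation (H : ℕ → Obs (dom V δ σ 0)) (h : Hol (dom V δ σ 0))
    (M : Set (Fin n → ℤ)) (α : ℝ) (r K : ℕ) (F m b : ℝ) : Prop where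
  zero : H 0 = ⟨Finsupp.single 0 h, 0⟩
  eta_one : ‖(H 1).eta‖ * δ / 2 ≤ m
  eta : ∀ i, (H (i + 2)).eta = 0
  supp : ∀ i, SuppLt (H (i + 1)).fn ((i + 1) * K)
  bound : ∀ i, NagumoBound (H (i + 1)).fn 0 (F * b ^ i)
  nonres : ∀ k ∉ M, modeLen k < r * K → ∀ z ∈ dom V δ σ 0, α < ‖Hol.dir (modeDir k) h z‖

namespace IsPerturbation

variable {H : ℕ → Obs (dom V δ σ 0)} {h : Hol (dom V δ σ 0)} {M : Set (Fin n → ℤ)} {α : ℝ}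
  {r K : ℕ} {F m b : ℝ}

theorem adBound (hH : IsPerturbation H h M α r K F m b) (hδ : 0 < δ) (hσ : 0 < σ) (hF : 0 ≤ F)
    (i : ℕ) : AdBound (H (i + 1)) 0 (pertMajorant F m b i) := by
  cases i with
  | zero =>
    have := AdBound.of_nagumoBound_zero hδ hσ (by positivity) hH.eta_one (hH.bound 0)
    simpa [pertMajorant] using this
  | succ i =>
    have := AdBound.of_nagumoBound hδ hσ (hH.eta i) (hH.bound (i + 1))
    simpa [pertMajorant] using this

/-- The right-hand sides of the homological equations obey the majorant recursion. -/
theorem bounds (hH : IsPerturbation H h M α r K F m b) (hδ : 0 < δ) (hσ : 0 < σ) (hα : 0 < α)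
    (hF : 0 ≤ F) (hm : 0 ≤ m) (hb : 0 ≤ b) {Ψ : ℕ → Obs (dom V δ σ 0)} {ψ : ℕ → ℝ}
    (hψ : IsMajorant F m b (bracketConst δ σ * r / α) ψ) (h0 : Ψ 0 = H 1)
    (hs : ∀ s, Ψ (s + 1) = ((s : ℂ) + 2) • H (s + 2) -
      ∑ p ∈ antidiagonal s, ⁅solveHom h M (Ψ p.1), H (p.2 + 1)⁆ -
      ∑ p ∈ antidiagonal s, lieTransform (fun j => solveHom h M (Ψ j)) (p.1 + 1)
        (resonantPart M (Ψ p.2))) (s : ℕ) (hsr : s < r) :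
    SuppLt (Ψ s).fn ((s + 1) * K) ∧ NagumoBound (Ψ s).fn s (ψ s) ∧
      NagumoBound (solveHom h M (Ψ s)).fn s (ψ s / α) := by
  have hκ := bracketConst_pos hδ hσ
  have hψ0 := hψ.nonneg hF hm hb (by positivity)
  have hsolve : ∀ s < r, SuppLt (Ψ s).fn ((s + 1) * K) → NagumoBound (Ψ s).fn s (ψ s) →
      NagumoBound (solveHom h M (Ψ s)).fn s (ψ s / α) := by
    intro s hs h1 h2
    have h3 := h2.of_norm_le (F := (solveHom h M (Ψ s)).fn) (a := 1 / α) (by positivity)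
      (norm_solveHom_le hα hH.nonres (h1.mono (Nat.mul_le_mul_right K hs)))
    rwa [one_div_mul_eq_div] at h3
  induction s using Nat.strong_induction_on with
  | _ s ih =>
    suffices hmain : SuppLt (Ψ s).fn ((s + 1) * K) ∧ NagumoBound (Ψ s).fn s (ψ s) from
      ⟨hmain.1, hmain.2, hsolve s hsr hmain.1 hmain.2⟩
    cases s with
    | zero =>
      rw [h0, hψ.1]
      exact ⟨hH.supp 0, by simpa using hH.bound 0⟩
    | succ s =>
      have hren : ∀ j, 0 ≤ renewal (fun j => bracketConst δ σ * r / α * ψ j) j :=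
        renewal_nonneg fun j => by have := hψ0 j; positivity
      have hpm := pertMajorant_nonneg hF hm hb
      have heq : (fun j => bracketConst δ σ * r / α * ψ j) =
          fun j => bracketConst δ σ * r * (ψ j / α) := by
        funext j; ring
      have hη : ∀ j, (Ψ (j + 1)).eta = 0 := fun j => by
        rw [hs]
        simp [hH.eta j, lieTransform_succ_eta]
      have hZ : ∀ j ≤ s, AdBound (resonantPart M (Ψ j)) j (ψ j + if j = 0 then m else 0) := by
        intro j hj
        have h1 := ((ih j (by omega) (by omega)).2.1).of_norm_le
          (F := (resonantPart M (Ψ j)).fn) zero_le_one (norm_resonantPart_le (Ψ j))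
        rw [one_mul] at h1
        cases j with
        | zero =>
          rw [if_pos rfl]
          refine AdBound.of_nagumoBound_zero hδ hσ (hψ0 0) ?_ h1
          rw [resonantPart, h0]
          exact hH.eta_one
        | succ j =>
          rw [if_neg (Nat.succ_ne_zero j), add_zero]
          exact AdBound.of_nagumoBound hδ hσ (hη j) h1
      rw [hs, hψ.2, Obs.sub_fn, Obs.sub_fn, Obs.smul_fn, Obs.sum_fn, Obs.sum_fn]
      constructor
      · refine (((hH.supp (s + 1)).smul _).sub (SuppLt.sum fun p hp => ?_)).sub
          (SuppLt.sum fun p hp => ?_)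
        all_goals have hp' := mem_antidiagonal.1 hp
        · refine ((ih p.1 (by omega) (by omega)).1.solveHom.lie (hH.supp p.2)).mono (le_of_eq ?_)
          rw [← hp']; ring
        · refine (SuppLt.lieTransform (ih p.2 (by omega) (by omega)).1.resonantPart (p.1 + 1)
            fun j hj => (ih j (by omega) (by omega)).1.solveHom).mono (le_of_eq ?_)
          rw [← hp']; ring
      · have hpos1 : 0 ≤ ∑ p ∈ antidiagonal s,
            bracketConst δ σ * r / α * ψ p.1 * pertMajorant F m b p.2 :=
          sum_nonneg fun p _ => by
            have := hψ0 p.1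
            have := hpm p.2
            positivity
        have hpos2 : ∀ p : ℕ × ℕ, 0 ≤ renewal (fun j => bracketConst δ σ * r / α * ψ j)
            (p.1 + 1) * (ψ p.2 + if p.2 = 0 then m else 0) := fun p =>
          mul_nonneg (hren _) (add_nonneg (hψ0 _) (by split_ifs <;> simp [hm]))
        refine ((NagumoBound.sub ?_ (NagumoBound.sum (fun p hp => ?_) fun p hp => ?_)
          (by positivity) hpos1)).sub (NagumoBound.sum (fun p hp => ?_) fun p _ => hpos2 p)
          (by positivity) (sum_nonneg fun p _ => hpos2 p)
        · refine (((hH.bound (s + 1)).smul ((s : ℂ) + 2)).mono_exponent (Nat.zero_le _)).mono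
            (le_of_eq ?_)
          congr 1
          exact_mod_cast Complex.norm_natCast (s + 2)
        all_goals have hp' := mem_antidiagonal.1 hp
        · have h1 := hH.adBound hδ hσ hF p.2 p.1 (ψ p.1 / α) (solveHom h M (Ψ p.1)) rfl
            (div_nonneg (hψ0 _) hα.le) (ih p.1 (by omega) (by omega)).2.2
          refine (h1.mono_exponent (by omega)).mono ?_
          have h2 : ((p.1 : ℝ) + 1) ≤ r := by exact_mod_cast (by omega : p.1 + 1 ≤ r)
          have h3 := hψ0 p.1
          have h4 := hpm p.2
          calc bracketConst δ σ * (p.1 + 1) * ((0 : ℕ) + 1) *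
                (ψ p.1 / α * pertMajorant F m b p.2)
              ≤ bracketConst δ σ * r * ((0 : ℕ) + 1) *
                (ψ p.1 / α * pertMajorant F m b p.2) := by gcongr
            _ = _ := by push_cast; ring
        · have := hψ0 p.1
          have := hpm p.2
          positivity
        · have h1 := nagumoBound_lieTransform (X := fun j => solveHom h M (Ψ j))
            (x := fun j => ψ j / α) (N := s + 1) (r := r) hδ hσ (fun _ => rfl)
            (fun j hj => (ih j hj (by omega)).2.2) (fun j => div_nonneg (hψ0 j) hα.le)
            (add_nonneg (hψ0 _) (by split_ifs <;> simp [hm])) (hZ p.2 (by omega))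
            (s := p.1) (by omega) (by omega)
          rw [heq]
          rwa [show p.2 + (p.1 + 1) = s + 1 by omega] at h1

/-- Existence of an observable close to the function `ℓ` of the actions whose Poisson bracket with
the truncated Hamiltonian consists of the terms of order larger than `r` only. -/
theorem exists_almost_invariant (hH : IsPerturbation H h M α r K F m b) (hδ : 0 < δ) (hσ : 0 < σ)
    (hα : 0 < α) (hF : 0 ≤ F) (hm : 0 ≤ m) (hb : 0 ≤ b) {Δ : ℝ} (hΔ : 0 < Δ) (hΔ1 : Δ ≤ 1)
    (hbΔ : 4 * b ≤ Δ) (hg : bracketConst δ σ * r / α * (2 / Δ) * (F + m) ≤ 1 / 40)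
    {ℓ : Hol (dom V δ σ 0)} (hℓ : ∀ k z, ‖Hol.dir (modeDir k) ℓ z‖ ≤ modeLen k)
    (hℓM : ∀ k ∈ M, Hol.dir (modeDir k) ℓ = 0) (hℓt : Hol.dir timeDir ℓ = 0) :
    ∃ (Q : ℕ → Obs (dom V δ σ 0)) (e : ℕ → ℝ), (∀ s, 0 ≤ e s) ∧
      (∀ s < r, (Q s).eta = 0 ∧ NagumoBound (Q s).fn (s + 1) (e s * δ)) ∧
      ∑ s ∈ range r, ((s : ℝ) + 2) * e s ≤ 1 / 4 ∧
      ⁅(⟨Finsupp.single 0 ℓ, 0⟩ : Obs (dom V δ σ 0)) + ∑ s ∈ range r, Q s,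
        ∑ i ∈ range (r + 1), H i⁆ =
        ∑ s ∈ range r, ∑ i ∈ range r, (if r ≤ s + 1 + i then ⁅Q s, H (i + 1)⁆ else 0) ∧
      ∑ s ∈ range r, ∑ i ∈ range r, (if r ≤ s + 1 + i then
        ((s : ℝ) + 2) * e s * pertMajorant F m b i else 0) ≤ F * Δ ^ r := by
  have hκ := bracketConst_pos hδ hσ
  have hc : 0 ≤ bracketConst δ σ * r / α := by positivity
  obtain ⟨ψ, hψ⟩ := exists_isMajorant F m b (bracketConst δ σ * r / α)
  have hψ0 := hψ.nonneg hF hm hb hc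
  obtain ⟨Ψ, h0, hs⟩ := exists_homological_seq (solveHom h M) (resonantPart M) H
  have hbd := hH.bounds hδ hσ hα hF hm hb hψ h0 hs
  set Φ₀ : Obs (dom V δ σ 0) := ⟨Finsupp.single 0 ℓ, 0⟩ with hΦ₀
  have heq : (fun j => bracketConst δ σ * r / α * ψ j) =
      fun j => bracketConst δ σ * r * (ψ j / α) := by
    funext j; ring
  refine ⟨fun s => lieTransform (fun j => solveHom h M (Ψ j)) (s + 1) Φ₀,
    fun s => renewal (fun j => bracketConst δ σ * r / α * ψ j) (s + 1),
    fun s => renewal_nonneg (fun j => mul_nonneg hc (hψ0 j)) _, fun s hsr => ⟨?_, ?_⟩,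
    hψ.renewal_sum_le hF hm hb hc hΔ hΔ1 hbΔ hg r, ?_,
    hψ.remainder_sum_le hF hm hb hc hΔ hΔ1 hbΔ hg r⟩
  · exact lieTransform_succ_eta _ _ _
  · have h1 := nagumoBound_lieTransform (X := fun j => solveHom h M (Ψ j))
      (x := fun j => ψ j / α) (N := r) (r := r) (q := 0) hδ hσ (fun _ => rfl)
      (fun j hj => (hbd j hj).2.2) (fun j => div_nonneg (hψ0 j) hα.le) hδ.le
      (AdBound.of_dir_le hδ hσ hℓ) hsr (by omega)
    rw [heq]
    rwa [zero_add] at h1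
  · have h1 : Φ₀ + ∑ s ∈ range r, lieTransform (fun j => solveHom h M (Ψ j)) (s + 1) Φ₀ =
        ∑ s ∈ range (r + 1), lieTransform (fun j => solveHom h M (Ψ j)) s Φ₀ := by
      rw [sum_range_succ', lieTransform_zero, add_comm]
    rw [h1]
    have hhom : ∀ m < r, ((m : ℂ) + 1) • H (m + 1) =
        ∑ p ∈ antidiagonal m, ⁅solveHom h M (Ψ p.1), H p.2⁆ +
        ∑ p ∈ antidiagonal m, lieTransform (fun j => solveHom h M (Ψ j)) p.1
          (resonantPart M (Ψ p.2)) := by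
      intro m hm
      refine homological_identity h0 hs ?_
      rw [hH.zero]
      exact lie_solveHom hα.le hH.nonres ((hbd m hm).1.mono (Nat.mul_le_mul_right K hm))
    have hzero : ⁅Φ₀, H 0⁆ = 0 ∧ ∀ i < r, ⁅Φ₀, resonantPart M (Ψ i)⁆ = 0 := by
      refine ⟨?_, fun i _ => ?_⟩
      · rw [hH.zero, hΦ₀]
        ext1
        · rw [Obs.lie_fn, zero_smul, zero_smul, add_zero, sub_zero]
          refine Finsupp.ext fun k => Hol.ext_on fun z _ => ?_
          rw [trigBracket_single_zero_apply]
          by_cases hk : k = 0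
          · rw [hk, modeDir_zero, Hol.dir_zero, Hol.zero_apply, mul_zero, neg_zero]
            rfl
          · rw [Finsupp.single_eq_of_ne hk, Hol.zero_apply, zero_mul, neg_zero]
            rfl
        · simp
      · ext1
        · have h2 : timeDeriv Φ₀.fn = 0 := by rw [hΦ₀, timeDeriv_single, hℓt]; simp
          rw [Obs.lie_fn, h2, smul_zero, add_zero, hΦ₀, zero_smul, sub_zero, trigBracket_neg_swap]
          refine Finsupp.ext fun k => Hol.ext_on fun z _ => ?_
          rw [Finsupp.neg_apply, Hol.neg_apply, trigBracket_single_zero_apply, neg_neg]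
          by_cases hk : k ∈ M
          · rw [hℓM k hk]
            simp [Hol.zero_apply]
          · classical
            simp [resonantPart, hk, Hol.zero_apply]
        · simp
    exact lie_sum_eq_remainder (Q := fun s => lieTransform (fun j => solveHom h M (Ψ j)) s Φ₀)
      fun m hm => sum_lie_lieTransform_eq_zero (X := fun j => solveHom h M (Ψ j))
      (Z := fun j => resonantPart M (Ψ j)) hhom hzero.1 hzero.2 hm

end IsPerturbation

end Estimates

end SlowNekhoroshev

namespace SlowNekhoroshev

/-! ### Fourier series of holomorphic functions on a strip -/

section Fourier

open MeasureTheory UnitAddTorus Filter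
open scoped Topology

variable {n : ℕ}

/-- The point of the torus with given angles. -/
noncomputable def toTorus (φ : Fin n → ℝ) : UnitAddTorus (Fin n) :=
  fun j => ((φ j / (2 * Real.pi) : ℝ) : UnitAddCircle)

/-- The normalized Haar measure of the torus. -/
noncomputable def torusMeasure (n : ℕ) : Measure (UnitAddTorus (Fin n)) :=
  Measure.pi fun _ => AddCircle.haarAddCircle

instance : IsProbabilityMeasure (torusMeasure n) := by
  unfold torusMeasure; infer_instance

instance : Measure.IsAddHaarMeasure (torusMeasure n) := by
  unfold torusMeasure; infer_instance

/-- The angles in `(0, 2π]` of a point of the torus. -/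
noncomputable def torusAngle (θ : UnitAddTorus (Fin n)) : Fin n → ℝ :=
  fun j => 2 * Real.pi * (AddCircle.equivIoc (1 : ℝ) 0 (θ j)).1

theorem toTorus_torusAngle (θ : UnitAddTorus (Fin n)) : toTorus (torusAngle θ) = θ := by
  funext j
  have h : (2 * Real.pi * (AddCircle.equivIoc (1 : ℝ) 0 (θ j)).1) / (2 * Real.pi) =
      (AddCircle.equivIoc (1 : ℝ) 0 (θ j)).1 := mul_div_cancel_left₀ _ (by positivity)
  rw [toTorus, torusAngle, h]
  exact (AddCircle.equivIoc (1 : ℝ) 0).symm_apply_apply (θ j)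

theorem measurable_torusAngle : Measurable (torusAngle (n := n)) := by
  refine measurable_pi_lambda _ fun j => Measurable.const_mul ?_ _
  exact measurable_subtype_coe.comp
    ((AddCircle.measurableEquivIoc (1 : ℝ) 0).measurable.comp (measurable_pi_apply j))

theorem toTorus_add (φ ψ : Fin n → ℝ) : toTorus (φ + ψ) = toTorus φ + toTorus ψ := by
  funext j
  simp [toTorus, add_div]

theorem exists_of_toTorus_eq {φ ψ : Fin n → ℝ} (h : toTorus φ = toTorus ψ) :
    ∃ m : Fin n → ℤ, φ = fun j => ψ j + 2 * Real.pi * m j := by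
  have h1 : ∀ j, ∃ m : ℤ, φ j = ψ j + 2 * Real.pi * m := by
    intro j
    have h2 := congrFun h j
    simp only [toTorus] at h2
    rw [QuotientAddGroup.eq, AddSubgroup.mem_zmultiples_iff] at h2
    obtain ⟨m, hm⟩ := h2
    refine ⟨-m, ?_⟩
    have : (2 * Real.pi) ≠ 0 := by positivity
    simp only [zsmul_eq_mul, mul_one] at hm
    push_cast
    rw [hm]
    field_simp
    ring
  choose m hm using h1
  exact ⟨m, funext hm⟩

theorem isQuotientMap_toTorus : Topology.IsQuotientMap (toTorus (n := n)) := by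
  refine IsOpenMap.isQuotientMap ?_ ?_ fun θ => ⟨_, toTorus_torusAngle θ⟩
  · have h1 : IsOpenMap fun x : Fin n → ℝ => fun j => (x j : UnitAddCircle) :=
      IsOpenMap.piMap (fun _ => QuotientAddGroup.isOpenMap_coe)
        (Filter.Eventually.of_forall fun _ => QuotientAddGroup.mk_surjective)
    have h2 : IsOpenMap fun x : Fin n → ℝ => fun j => x j / (2 * Real.pi) :=
      IsOpenMap.piMap (f := fun _ : Fin n => fun x : ℝ => x / (2 * Real.pi)) (fun _ =>
        (Homeomorph.mulRight₀ (2 * Real.pi)⁻¹ (by positivity)).isOpenMap)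
        (Filter.Eventually.of_forall fun _ =>
        (Homeomorph.mulRight₀ (2 * Real.pi)⁻¹ (by positivity)).surjective)
    exact h1.comp h2
  · refine continuous_pi fun j => ?_
    exact (AddCircle.continuous_mk' 1).comp ((continuous_apply j).div_const _)

/-- The exponential `exp(i k·φ)`. -/
noncomputable def modeExp (k : Fin n → ℤ) (φ : Fin n → ℝ) : ℂ :=
  Complex.exp (Complex.I * ∑ j, (k j : ℂ) * (φ j : ℂ))

theorem norm_modeExp (k : Fin n → ℤ) (φ : Fin n → ℝ) : ‖modeExp k φ‖ = 1 := by
  rw [modeExp, Complex.norm_exp]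
  have : (∑ j, (k j : ℂ) * (φ j : ℂ)) = ((∑ j, (k j : ℝ) * φ j : ℝ) : ℂ) := by push_cast; rfl
  rw [this, Complex.I_mul_re, Complex.ofReal_im, neg_zero, Real.exp_zero]

theorem mFourier_toTorus (k : Fin n → ℤ) (φ : Fin n → ℝ) :
    mFourier k (toTorus φ) = modeExp k φ := by
  simp only [mFourier, ContinuousMap.coe_mk, toTorus, fourier_coe_apply, modeExp]
  rw [← Complex.exp_sum, Finset.mul_sum]
  congr 1
  refine Finset.sum_congr rfl fun j _ => ?_
  have : (Real.pi : ℂ) ≠ 0 := Complex.ofReal_ne_zero.2 Real.pi_ne_zero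
  push_cast
  field_simp

theorem mFourier_add_apply (k : Fin n → ℤ) (x y : UnitAddTorus (Fin n)) :
    mFourier k (x + y) = mFourier k x * mFourier k y := by
  simp only [mFourier, ContinuousMap.coe_mk, ← Finset.prod_mul_distrib]
  refine Finset.prod_congr rfl fun j _ => ?_
  simp [fourier_apply, AddCircle.toCircle_add, smul_add]

theorem norm_mFourier_apply (k : Fin n → ℤ) (x : UnitAddTorus (Fin n)) :
    ‖mFourier k x‖ = 1 := by
  rw [← toTorus_torusAngle x, mFourier_toTorus, norm_modeExp]

/-- The Fourier coefficients of a function which is `2π`-periodic on the real angles. -/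
noncomputable def fourierCoef (g : (Fin n → ℂ) → ℂ) (k : Fin n → ℤ) : ℂ :=
  ∫ θ, mFourier (-k) θ * g (fun j => (torusAngle θ j : ℂ)) ∂torusMeasure n

variable {g : (Fin n → ℂ) → ℂ} {S C : ℝ}

theorem periodic_int (hper : ∀ φ ∈ angleStrip n S, ∀ j,
      g (φ + Pi.single j (2 * Real.pi : ℂ)) = g φ) (m : Fin n → ℤ) :
    ∀ φ ∈ angleStrip n S, g (φ + fun j => 2 * Real.pi * (m j : ℂ)) = g φ := by
  have hmem : ∀ m : Fin n → ℤ, ∀ φ ∈ angleStrip n S,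
      (φ + fun j => 2 * Real.pi * (m j : ℂ)) ∈ angleStrip n S := by
    intro m φ hφ j
    have h2 : (φ j + 2 * (Real.pi : ℂ) * (m j : ℂ)).im = (φ j).im := by
      rw [show (2 * (Real.pi : ℂ) * (m j : ℂ)) = ((2 * Real.pi * m j : ℝ) : ℂ) by push_cast; rfl]
      simp
    change |(φ j + 2 * (Real.pi : ℂ) * (m j : ℂ)).im| < S
    rw [h2]
    exact hφ j
  let P : AddSubgroup (Fin n → ℤ) :=
    { carrier := {m | ∀ φ ∈ angleStrip n S, g (φ + fun j => 2 * Real.pi * (m j : ℂ)) = g φ}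
      zero_mem' := fun φ _ => by congr 1; funext j; simp
      add_mem' := fun {a b} ha hb φ hφ => by
        rw [← ha φ hφ, ← hb _ (hmem a φ hφ)]
        congr 1
        funext j
        simp only [Pi.add_apply]
        push_cast
        ring
      neg_mem' := fun {a} ha φ hφ => by
        rw [← ha _ (hmem (-a) φ hφ)]
        congr 1
        funext j
        simp }
  have hsingle : ∀ j, (Pi.single j 1 : Fin n → ℤ) ∈ P := by
    intro j φ hφ
    rw [← hper φ hφ j]
    congr 1
    funext i
    by_cases hij : i = j
    · subst hij; simp
    · simp [hij]
  have hm : m = ∑ j, m j • (Pi.single j 1 : Fin n → ℤ) := by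
    funext i
    simp [Finset.sum_apply, Pi.single_apply]
  have : m ∈ P := by
    rw [hm]
    exact sum_mem fun j _ => P.zsmul_mem (hsingle j) _
  exact this

theorem real_add_mem_angleStrip {w : Fin n → ℂ} (hw : w ∈ angleStrip n S) (x : Fin n → ℝ) :
    ((fun j => (x j : ℂ)) + w) ∈ angleStrip n S := fun j => by
  have := hw j
  simpa using this

theorem zero_mem_angleStrip (hS : 0 < S) : (0 : Fin n → ℂ) ∈ angleStrip n S := fun j => by simpa

theorem eq_of_toTorus_eq (hper : ∀ φ ∈ angleStrip n S, ∀ j,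
      g (φ + Pi.single j (2 * Real.pi : ℂ)) = g φ) (hS : 0 < S) {φ ψ : Fin n → ℝ}
    (h : toTorus φ = toTorus ψ) : g (fun j => (φ j : ℂ)) = g (fun j => (ψ j : ℂ)) := by
  obtain ⟨m, rfl⟩ := exists_of_toTorus_eq h
  have hψ := real_add_mem_angleStrip (zero_mem_angleStrip hS) ψ
  rw [add_zero] at hψ
  rw [← periodic_int hper m _ hψ]
  congr 1
  funext j
  simp

/-- Translating the angles multiplies the Fourier coefficients by a phase. -/
theorem fourierCoef_shift (hper : ∀ φ ∈ angleStrip n S, ∀ j,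
      g (φ + Pi.single j (2 * Real.pi : ℂ)) = g φ) (hS : 0 < S) (k : Fin n → ℤ)
    (w : Fin n → ℝ) :
    fourierCoef (fun φ => g (φ + fun j => (w j : ℂ))) k = modeExp k w * fourierCoef g k := by
  have h1 : ∀ θ : UnitAddTorus (Fin n),
      g ((fun j => (torusAngle θ j : ℂ)) + fun j => (w j : ℂ)) =
        g (fun j => (torusAngle (θ + toTorus w) j : ℂ)) := by
    intro θ
    have h2 := eq_of_toTorus_eq hper hS (φ := torusAngle θ + w)
      (ψ := torusAngle (θ + toTorus w)) (by
        rw [toTorus_add, toTorus_torusAngle, toTorus_torusAngle])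
    rw [← h2]
    congr 1
    funext j
    simp
  have h3 : ∀ θ : UnitAddTorus (Fin n), mFourier (-k) θ =
      modeExp k w * mFourier (-k) (θ + toTorus w) := by
    intro θ
    have h4 : modeExp k w * mFourier (-k) (toTorus w) = 1 := by
      rw [← mFourier_toTorus, ← mFourier_add, add_neg_cancel, mFourier_zero]
      rfl
    rw [mFourier_add_apply, mul_left_comm, h4, mul_one]
  unfold fourierCoef
  simp_rw [h1]
  rw [← integral_add_right_eq_self (fun θ => mFourier (-k) θ *
    g (fun j => (torusAngle θ j : ℂ))) (toTorus w), ← integral_const_mul]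
  refine integral_congr_ae (Eventually.of_forall fun θ => ?_)
  simp only
  rw [h3 θ]
  ring

theorem measurable_shift (hg : DifferentiableOn ℂ g (angleStrip n S)) {w : Fin n → ℂ}
    (hw : w ∈ angleStrip n S) :
    Measurable fun θ : UnitAddTorus (Fin n) => g ((fun j => (torusAngle θ j : ℂ)) + w) := by
  have h1 : Continuous fun x : Fin n → ℝ => g ((fun j => (x j : ℂ)) + w) := by
    refine hg.continuousOn.comp_continuous ?_ fun x => real_add_mem_angleStrip hw x
    fun_prop
  exact h1.measurable.comp measurable_torusAngle

theorem norm_fourierCoef_le_of_bound {g : (Fin n → ℂ) → ℂ}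
    (hC : ∀ x : Fin n → ℝ, ‖g fun j => (x j : ℂ)‖ ≤ C) (k : Fin n → ℤ) :
    ‖fourierCoef g k‖ ≤ C := by
  have := norm_integral_le_of_norm_le_const (μ := torusMeasure n)
    (f := fun θ => mFourier (-k) θ * g (fun j => (torusAngle θ j : ℂ))) (C := C)
    (Eventually.of_forall fun θ => by
      rw [norm_mul, norm_mFourier_apply, one_mul]
      exact hC _)
  simpa [fourierCoef] using this

/-- Exponential decay of the Fourier coefficients: the angles are translated by imaginary
amounts, up to the boundary of the strip. -/
theorem norm_fourierCoef_le (hper : ∀ φ ∈ angleStrip n S, ∀ j,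
      g (φ + Pi.single j (2 * Real.pi : ℂ)) = g φ) (hS : 0 < S)
    (hg : DifferentiableOn ℂ g (angleStrip n S)) (hC : ∀ φ ∈ angleStrip n S, ‖g φ‖ ≤ C)
    (k : Fin n → ℤ) : ‖fourierCoef g k‖ ≤ C * Real.exp (-(modeLen k * S)) := by
  let s : Fin n → ℂ := fun j => ((k j).sign : ℂ)
  have hs : ∀ ζ ∈ timeStrip S, ζ • s ∈ angleStrip n S := by
    intro ζ hζ j
    have h1 : (ζ * ((k j).sign : ℂ)).im = ζ.im * (k j).sign := by
      rw [show (((k j).sign : ℤ) : ℂ) = (((k j).sign : ℝ) : ℂ) by push_cast; rfl]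
      simp
    change |(ζ * ((k j).sign : ℂ)).im| < S
    have h2 : |((k j).sign : ℝ)| ≤ 1 := by
      rcases Int.sign_trichotomy (k j) with h | h | h <;> simp [h]
    rw [h1, abs_mul]
    have h3 : |ζ.im| < S := hζ
    nlinarith [abs_nonneg ζ.im]
  have hopen : IsOpen (timeStrip S) :=
    isOpen_lt (continuous_abs.comp Complex.continuous_im) continuous_const
  have hmem : ∀ ζ ∈ timeStrip S, ∀ x : Fin n → ℝ,
      ((fun j => (x j : ℂ)) + ζ • s) ∈ angleStrip n S := fun ζ hζ x =>
    real_add_mem_angleStrip (hs ζ hζ) x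
  have hdiff : DifferentiableOn ℂ (fun ζ : ℂ => fourierCoef (fun φ => g (φ + ζ • s)) k)
      (timeStrip S) := by
    refine differentiableOn_integral_of_bounded hopen (C := C) (fun θ => ?_) (fun ζ hζ => ?_)
      fun ζ hζ θ => ?_
    · refine DifferentiableOn.const_mul ?_ _
      refine hg.comp (t := angleStrip n S) ?_ fun ζ hζ => hmem ζ hζ _
      exact (differentiable_id.smul_const s).const_add _ |>.differentiableOn
    · exact ((mFourier (-k)).continuous.measurable.mul
        (measurable_shift hg (hs ζ hζ))).aestronglyMeasurable
    · rw [norm_mul, norm_mFourier_apply, one_mul]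
      exact hC _ (hmem ζ hζ _)
  have hmodeLen : ∑ j, (k j : ℂ) * s j = modeLen k := by
    rw [modeLen, Nat.cast_sum]
    refine Finset.sum_congr rfl fun j _ => ?_
    have h := Int.mul_sign_self (k j)
    simp only [s]
    rw [← Int.cast_mul, h]
    simp
  have hreal : ∀ x : ℝ, fourierCoef (fun φ => g (φ + (x : ℂ) • s)) k =
      Complex.exp (Complex.I * (modeLen k * x)) * fourierCoef g k := by
    intro x
    have h1 := fourierCoef_shift hper hS k (fun j => x * ((k j).sign : ℝ))
    have h2 : (fun j => ((x * ((k j).sign : ℝ) : ℝ) : ℂ)) = (x : ℂ) • s := by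
      funext j; simp [s]
    rw [h2] at h1
    rw [h1, modeExp]
    congr 3
    rw [← hmodeLen, Finset.sum_mul]
    refine Finset.sum_congr rfl fun j _ => ?_
    simp only [s]
    push_cast
    ring
  have h0 : (0 : ℂ) ∈ timeStrip S := by simpa [timeStrip] using hS
  have hconv : Convex ℝ (timeStrip S) := by
    have : timeStrip S = Complex.imLm ⁻¹' Set.Ioo (-S) S := by
      ext ζ; simp [timeStrip, abs_lt]
    rw [this]
    exact (convex_Ioo _ _).linear_preimage _
  have hexp : Differentiable ℂ fun ζ : ℂ =>
      Complex.exp (Complex.I * (modeLen k * ζ)) * fourierCoef g k := by fun_prop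
  have heq : Set.EqOn (fun ζ : ℂ => fourierCoef (fun φ => g (φ + ζ • s)) k)
      (fun ζ => Complex.exp (Complex.I * (modeLen k * ζ)) * fourierCoef g k) (timeStrip S) := by
    refine (hdiff.analyticOnNhd hopen).eqOn_of_preconnected_of_frequently_eq
      (hexp.differentiableOn.analyticOnNhd hopen) hconv.isPreconnected h0 ?_
    have hlim : Tendsto (fun x : ℝ => (x : ℂ)) (𝓝[≠] 0) (𝓝[≠] 0) := by
      refine tendsto_nhdsWithin_of_tendsto_nhds_of_eventually_within _ ?_ ?_
      · have : Tendsto (fun x : ℝ => (x : ℂ)) (𝓝 0) (𝓝 ((0 : ℝ) : ℂ)) :=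
          Complex.continuous_ofReal.tendsto 0
        rw [Complex.ofReal_zero] at this
        exact this.mono_left nhdsWithin_le_nhds
      · filter_upwards [self_mem_nhdsWithin] with x hx
        exact Complex.ofReal_ne_zero.2 hx
    exact hlim.frequently (Frequently.of_forall fun x => hreal x)
  have hy : ∀ y : ℝ, 0 ≤ y → y < S → ‖fourierCoef g k‖ ≤ C * Real.exp (-(modeLen k * y)) := by
    intro y hy0 hy
    have hmemy : (-(y * Complex.I) : ℂ) ∈ timeStrip S := by
      simpa [timeStrip, abs_of_nonneg hy0] using hy
    have h1 := heq hmemy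
    simp only at h1
    have h2 : ‖fourierCoef (fun φ => g (φ + (-(y * Complex.I) : ℂ) • s)) k‖ ≤ C :=
      norm_fourierCoef_le_of_bound (g := fun φ => g (φ + (-(y * Complex.I) : ℂ) • s))
        (fun x => hC _ (hmem _ hmemy x)) k
    rw [h1, norm_mul] at h2
    have h3 : Complex.I * (modeLen k * -(y * Complex.I)) = ((modeLen k * y : ℝ) : ℂ) := by
      push_cast
      linear_combination (-(modeLen k : ℂ) * y) * Complex.I_mul_I
    rw [h3, Complex.norm_exp_ofReal] at h2
    rw [Real.exp_neg, ← div_eq_mul_inv, le_div_iff₀ (Real.exp_pos _), mul_comm]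
    exact h2
  have hlim : Tendsto (fun y : ℝ => C * Real.exp (-(modeLen k * y))) (𝓝[<] S)
      (𝓝 (C * Real.exp (-(modeLen k * S)))) := by
    have : Continuous fun y : ℝ => C * Real.exp (-(modeLen k * y)) := by fun_prop
    exact (this.tendsto S).mono_left nhdsWithin_le_nhds
  refine ge_of_tendsto hlim ?_
  filter_upwards [Ioo_mem_nhdsLT hS] with y hy' using hy y hy'.1.le hy'.2

/-! ### Sums over the Fourier modes -/

theorem hasSum_pow_natAbs {q : ℝ} (hq : 0 ≤ q) (hq1 : q < 1) :
    HasSum (fun m : ℤ => q ^ m.natAbs) ((1 + q) / (1 - q)) := by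
  have h1 := hasSum_geometric_of_lt_one hq hq1
  have h2 := h1.mul_left q
  have h4 : ∀ m : ℕ, q ^ (-((m : ℤ) + 1)).natAbs = q * q ^ m := fun m => by
    rw [← pow_succ']
    congr 1
  have h3 := HasSum.of_nat_of_neg_add_one (f := fun m : ℤ => q ^ m.natAbs)
    (by simpa using h1) (m' := q * (1 - q)⁻¹) (by simpa only [h4] using h2)
  convert h3 using 1
  rw [div_eq_mul_inv]
  ring

theorem sum_pow_modeLen_le {q : ℝ} (hq : 0 ≤ q) (hq1 : q < 1) (s : Finset (Fin n → ℤ)) :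
    ∑ k ∈ s, q ^ modeLen k ≤ ((1 + q) / (1 - q)) ^ n := by
  classical
  let T : Fin n → Finset ℤ := fun j => s.image fun k => k j
  calc ∑ k ∈ s, q ^ modeLen k ≤ ∑ k ∈ Fintype.piFinset T, q ^ modeLen k := by
        refine Finset.sum_le_sum_of_subset_of_nonneg (fun k hk => ?_) fun _ _ _ => by positivity
        exact Fintype.mem_piFinset.2 fun j => Finset.mem_image_of_mem _ hk
    _ = ∑ k ∈ Fintype.piFinset T, ∏ j, q ^ (k j).natAbs := by
        refine Finset.sum_congr rfl fun k _ => ?_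
        rw [modeLen, Finset.prod_pow_eq_pow_sum]
    _ = ∏ j, ∑ m ∈ T j, q ^ m.natAbs :=
        (Finset.prod_univ_sum T fun _ m => q ^ m.natAbs).symm
    _ ≤ ∏ _j : Fin n, ((1 + q) / (1 - q)) := by
        refine Finset.prod_le_prod (fun j _ => Finset.sum_nonneg fun _ _ => by positivity)
          fun j _ => ?_
        exact sum_le_hasSum _ (fun _ _ => by positivity) (hasSum_pow_natAbs hq hq1)
    _ = _ := by rw [Finset.prod_const, Finset.card_univ, Fintype.card_fin]

/-- The constant `∑ exp(-σ|k|/2)`, summed over all Fourier modes. -/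
noncomputable def modeSum (n : ℕ) (σ : ℝ) : ℝ :=
  ((1 + Real.exp (-(σ / 2))) / (1 - Real.exp (-(σ / 2)))) ^ n

variable {σ : ℝ}

theorem sum_exp_modeLen_le (hσ : 0 < σ) (s : Finset (Fin n → ℤ)) :
    ∑ k ∈ s, Real.exp (-(modeLen k * (σ / 2))) ≤ modeSum n σ := by
  have h := sum_pow_modeLen_le (q := Real.exp (-(σ / 2))) (Real.exp_pos _).le
    (Real.exp_lt_one_iff.2 (by linarith)) s
  refine le_trans (le_of_eq (Finset.sum_congr rfl fun k _ => ?_)) h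
  rw [← Real.exp_nat_mul]
  congr 1
  ring

theorem summable_exp_modeLen (hσ : 0 < σ) :
    Summable fun k : Fin n → ℤ => Real.exp (-(modeLen k * (σ / 2))) :=
  summable_of_sum_le (fun _ => (Real.exp_pos _).le) (sum_exp_modeLen_le hσ)

theorem modeSum_nonneg (hσ : 0 < σ) : 0 ≤ modeSum n σ := by
  simpa using sum_exp_modeLen_le (n := n) hσ ∅

theorem sum_exp_modeLen_tail_le (hσ : 0 < σ) {N : ℕ} {s : Finset (Fin n → ℤ)}
    (hs : ∀ k ∈ s, N ≤ modeLen k) :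
    ∑ k ∈ s, Real.exp (-(modeLen k * σ)) ≤ Real.exp (-(N * (σ / 2))) * modeSum n σ := by
  refine le_trans ?_ (mul_le_mul_of_nonneg_left (sum_exp_modeLen_le hσ s) (Real.exp_pos _).le)
  rw [Finset.mul_sum]
  refine Finset.sum_le_sum fun k hk => ?_
  rw [← Real.exp_add]
  have : (N : ℝ) ≤ modeLen k := by exact_mod_cast hs k hk
  exact Real.exp_le_exp.2 (by nlinarith)

theorem finite_modeLen_lt (N : ℕ) : {k : Fin n → ℤ | modeLen k < N}.Finite := by
  refine (Set.Finite.pi' (t := fun _ : Fin n => Set.Icc (-(N : ℤ)) N)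
    fun _ => Set.finite_Icc _ _).subset fun k hk j => ?_
  have h1 : (k j).natAbs ≤ modeLen k :=
    Finset.single_le_sum (f := fun j => (k j).natAbs) (fun _ _ => Nat.zero_le _)
      (Finset.mem_univ j)
  have h2 : modeLen k < N := hk
  constructor <;> omega

/-- The modes of length smaller than `N`. -/
noncomputable def modesBelow (n N : ℕ) : Finset (Fin n → ℤ) := (finite_modeLen_lt N).toFinset

theorem mem_modesBelow {N : ℕ} {k : Fin n → ℤ} : k ∈ modesBelow n N ↔ modeLen k < N := by
  simp [modesBelow]

theorem norm_sub_sum_modesBelow_le (hσ : 0 < σ) {a : (Fin n → ℤ) → ℂ} {A : ℝ} {s : ℂ}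
    (ha : ∀ k, ‖a k‖ ≤ A * Real.exp (-(modeLen k * σ))) (hA : 0 ≤ A) (hs : HasSum a s) (N : ℕ) :
    ‖s - ∑ k ∈ modesBelow n N, a k‖ ≤ A * (Real.exp (-(N * (σ / 2))) * modeSum n σ) := by
  classical
  refine le_of_tendsto ((hs.sub_const (∑ k ∈ modesBelow n N, a k)).norm) ?_
  filter_upwards [eventually_ge_atTop (modesBelow n N)] with t ht
  rw [← Finset.sum_sdiff ht, add_sub_cancel_right]
  refine (norm_sum_le_of_le _ fun k _ => ha k).trans ?_
  rw [← Finset.mul_sum]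
  refine mul_le_mul_of_nonneg_left (sum_exp_modeLen_tail_le hσ fun k hk => ?_) hA
  have := (Finset.mem_sdiff.1 hk).2
  rw [mem_modesBelow] at this
  omega

theorem hasSum_fourier (hper : ∀ φ ∈ angleStrip n S, ∀ j,
      g (φ + Pi.single j (2 * Real.pi : ℂ)) = g φ) (hS : 0 < S)
    (hg : DifferentiableOn ℂ g (angleStrip n S)) (hC : ∀ φ ∈ angleStrip n S, ‖g φ‖ ≤ C)
    (φ : Fin n → ℝ) :
    HasSum (fun k => fourierCoef g k * modeExp k φ) (g fun j => (φ j : ℂ)) := by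
  have hcont : Continuous fun θ : UnitAddTorus (Fin n) => g fun j => (torusAngle θ j : ℂ) := by
    rw [isQuotientMap_toTorus.continuous_iff]
    have h1 : Continuous fun x : Fin n → ℝ => g (fun j => (x j : ℂ)) := by
      refine hg.continuousOn.comp_continuous (by fun_prop) fun x => ?_
      simpa using real_add_mem_angleStrip (zero_mem_angleStrip hS) x
    refine h1.congr fun x => ?_
    exact (eq_of_toTorus_eq hper hS (toTorus_torusAngle _)).symm
  let F : C(UnitAddTorus (Fin n), ℂ) := ⟨_, hcont⟩
  have hF : ∀ k, mFourierCoeff F k = fourierCoef g k := fun k => rfl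
  have hsum : Summable (mFourierCoeff F) := by
    refine Summable.of_norm_bounded ((summable_exp_modeLen (n := n)
      (by positivity : 0 < 2 * S)).mul_left C) fun k => ?_
    rw [hF]
    have := norm_fourierCoef_le hper hS hg hC k
    simpa using this
  have h := hasSum_mFourier_series_apply_of_summable hsum (toTorus φ)
  have h2 : F (toTorus φ) = g fun j => (φ j : ℂ) :=
    eq_of_toTorus_eq hper hS (toTorus_torusAngle _)
  rw [h2] at h
  simpa only [hF, mFourier_toTorus, smul_eq_mul] using h

end Fourier

end SlowNekhoroshev

namespace SlowNekhoroshev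

/-! ### The expansion of the Hamiltonian into blocks of Fourier modes -/

section Blocks

open Filter
open scoped Topology

variable {n : ℕ} {G V : Set (EuclideanSpace ℝ (Fin n))} {δ σ C : ℝ}
  {h : EuclideanSpace ℂ (Fin n) → ℂ} {f : EuclideanSpace ℂ (Fin n) × (Fin n → ℂ) × ℂ → ℂ}

theorem actionNhd_mono (hVG : V ⊆ G) : actionNhd V δ ⊆ actionNhd G δ :=
  Set.biUnion_subset_biUnion_left hVG

theorem mem_dom_zero {z : ActTime n} :
    z ∈ dom V δ σ 0 ↔ z.1 ∈ actionNhd V δ ∧ |z.2.im| < σ := by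
  rw [mem_dom, sub_zero, one_mul, one_mul]

theorem mem_phaseDomain (hVG : V ⊆ G) (hσ : 0 < σ) {z : ActTime n} (hz : z ∈ dom V δ σ 0)
    {φ : Fin n → ℂ} (hφ : φ ∈ angleStrip n (2 * σ)) :
    (z.1, φ, z.2) ∈ phaseDomain G δ (2 * σ) := by
  rw [mem_dom_zero] at hz
  refine ⟨actionNhd_mono hVG hz.1, hφ, ?_⟩
  change |z.2.im| < 2 * σ
  linarith [hz.2]

theorem isOpen_actionNhd : IsOpen (actionNhd V δ) := isOpen_biUnion fun _ _ => Metric.isOpen_ball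

namespace IsRegular

theorem differentiableOn_angles (hf : IsRegular G δ σ h f) (hVG : V ⊆ G) (hσ : 0 < σ)
    {z : ActTime n} (hz : z ∈ dom V δ σ 0) :
    DifferentiableOn ℂ (fun φ => f (z.1, φ, z.2)) (angleStrip n (2 * σ)) := by
  refine hf.holo_f.comp (t := phaseDomain G δ (2 * σ)) ?_ fun φ hφ => mem_phaseDomain hVG hσ hz hφ
  exact (Differentiable.differentiableOn (by fun_prop))

theorem periodic_angles (hf : IsRegular G δ σ h f) (hVG : V ⊆ G) (hσ : 0 < σ)
    {z : ActTime n} (hz : z ∈ dom V δ σ 0) : ∀ φ ∈ angleStrip n (2 * σ), ∀ j,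
      f (z.1, φ + Pi.single j (2 * Real.pi : ℂ), z.2) = f (z.1, φ, z.2) :=
  fun _ hφ j => hf.periodic_f _ _ _ (mem_phaseDomain hVG hσ hz hφ) j

theorem differentiableOn_actTime (hf : IsRegular G δ σ h f) (hVG : V ⊆ G) (hσ : 0 < σ)
    {φ : Fin n → ℂ} (hφ : φ ∈ angleStrip n (2 * σ)) :
    DifferentiableOn ℂ (fun z : ActTime n => f (z.1, φ, z.2)) (dom V δ σ 0) := by
  refine hf.holo_f.comp (t := phaseDomain G δ (2 * σ)) ?_ fun z hz => mem_phaseDomain hVG hσ hz hφ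
  exact (Differentiable.differentiableOn (by fun_prop))

theorem real_mem_angleStrip (hσ : 0 < σ) (φ : Fin n → ℝ) :
    (fun j => (φ j : ℂ)) ∈ angleStrip n (2 * σ) := by
  simpa using real_add_mem_angleStrip (zero_mem_angleStrip (by positivity : 0 < 2 * σ)) φ

theorem differentiableOn_coef (hf : IsRegular G δ σ h f) (hVG : V ⊆ G) (hσ : 0 < σ)
    (k : Fin n → ℤ) :
    DifferentiableOn ℂ (fun z : ActTime n => fourierCoef (fun φ => f (z.1, φ, z.2)) k)
      (dom V δ σ 0) := by
  obtain ⟨B, hB⟩ := hf.bdd_f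
  refine differentiableOn_integral_of_bounded (dom V δ σ 0).isOpen (C := B) (fun θ => ?_)
    (fun z hz => ?_) fun z hz θ => ?_
  · exact (hf.differentiableOn_actTime hVG hσ (real_mem_angleStrip hσ _)).const_mul _
  · have h1 := measurable_shift (hf.differentiableOn_angles hVG hσ hz)
      (zero_mem_angleStrip (by positivity : 0 < 2 * σ))
    simp only [add_zero] at h1
    exact ((UnitAddTorus.mFourier (-k)).continuous.measurable.mul h1).aestronglyMeasurable
  · rw [norm_mul, norm_mFourier_apply, one_mul]
    exact hB _ (mem_phaseDomain hVG hσ hz (real_mem_angleStrip hσ _))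

/-- The Fourier coefficients of the perturbation, as holomorphic functions. -/
noncomputable def coef (hf : IsRegular G δ σ h f) (hVG : V ⊆ G) (hσ : 0 < σ) (k : Fin n → ℤ) :
    Hol (dom V δ σ 0) :=
  Hol.ofFun _ (hf.differentiableOn_coef hVG hσ k)

theorem coef_apply (hf : IsRegular G δ σ h f) (hVG : V ⊆ G) (hσ : 0 < σ) (k : Fin n → ℤ)
    {z : ActTime n} (hz : z ∈ dom V δ σ 0) :
    hf.coef hVG hσ k z = fourierCoef (fun φ => f (z.1, φ, z.2)) k := Hol.ofFun_apply hz

theorem norm_coef_le (hf : IsRegular G δ σ h f) (hVG : V ⊆ G) (hσ : 0 < σ)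
    (hC : ∀ z ∈ phaseDomain G δ (2 * σ), ‖f z‖ ≤ C) (k : Fin n → ℤ)
    {z : ActTime n} (hz : z ∈ dom V δ σ 0) :
    ‖hf.coef hVG hσ k z‖ ≤ C * Real.exp (-(modeLen k * (2 * σ))) := by
  rw [hf.coef_apply hVG hσ k hz]
  exact norm_fourierCoef_le (hf.periodic_angles hVG hσ hz) (by positivity)
    (hf.differentiableOn_angles hVG hσ hz)
    (fun φ hφ => hC _ (mem_phaseDomain hVG hσ hz hφ)) k

theorem hasSum_coef (hf : IsRegular G δ σ h f) (hVG : V ⊆ G) (hσ : 0 < σ)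
    {z : ActTime n} (hz : z ∈ dom V δ σ 0) (φ : Fin n → ℝ) :
    HasSum (fun k => hf.coef hVG hσ k z * modeExp k φ) (f (z.1, fun j => (φ j : ℂ), z.2)) := by
  obtain ⟨B, hB⟩ := hf.bdd_f
  have h1 := hasSum_fourier (hf.periodic_angles hVG hσ hz) (by positivity)
    (hf.differentiableOn_angles hVG hσ hz)
    (fun φ hφ => hB _ (mem_phaseDomain hVG hσ hz hφ)) φ
  simpa only [hf.coef_apply hVG hσ _ hz] using h1

/-- The part of the perturbation with Fourier modes in a finite set. -/
noncomputable def part (hf : IsRegular G δ σ h f) (hVG : V ⊆ G) (hσ : 0 < σ)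
    (s : Finset (Fin n → ℤ)) : Trig (dom V δ σ 0) :=
  ∑ k ∈ s, Finsupp.single k (hf.coef hVG hσ k)

theorem part_apply [DecidableEq (Fin n → ℤ)] (hf : IsRegular G δ σ h f) (hVG : V ⊆ G) (hσ : 0 < σ)
    (s : Finset (Fin n → ℤ)) (k : Fin n → ℤ) :
    hf.part hVG hσ s k = if k ∈ s then hf.coef hVG hσ k else 0 := by
  rw [part, Finsupp.finsetSum_apply]
  simp only [Finsupp.single_apply]
  exact Finset.sum_ite_eq' s k _

theorem nagumoBound_part (hf : IsRegular G δ σ h f) (hVG : V ⊆ G) (hσ : 0 < σ) (hδ : 0 ≤ δ)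
    (hC : ∀ z ∈ phaseDomain G δ (2 * σ), ‖f z‖ ≤ C) (hC0 : 0 ≤ C) {N : ℕ}
    {s : Finset (Fin n → ℤ)} (hs : ∀ k ∈ s, N ≤ modeLen k) :
    NagumoBound (hf.part hVG hσ s) 0 (C * (Real.exp (-(N * (σ / 2))) * modeSum n σ)) := by
  classical
  refine NagumoBound.of_sum_le hδ hσ.le (m := fun k => C * Real.exp (-(modeLen k * (2 * σ))))
    (fun k => by positivity) (fun k z hz => ?_) (s := s) (fun k hk => ?_) ?_
  · rw [hf.part_apply hVG hσ]
    split_ifs with hk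
    · exact hf.norm_coef_le hVG hσ hC k hz
    · rw [Hol.zero_apply, norm_zero]; positivity
  · rw [hf.part_apply hVG hσ, if_neg hk]
  · refine le_trans (le_of_eq ?_)
      (mul_le_mul_of_nonneg_left (sum_exp_modeLen_tail_le hσ hs) hC0)
    rw [Finset.mul_sum]
    refine Finset.sum_congr rfl fun k _ => ?_
    rw [mul_assoc, ← Real.exp_add]
    congr 2
    ring

open scoped Classical in
/-- The block of the Fourier modes `k` with `i K ≤ |k| < (i + 1) K`. -/
noncomputable def block (hf : IsRegular G δ σ h f) (hVG : V ⊆ G) (hσ : 0 < σ) (K i : ℕ) :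
    Trig (dom V δ σ 0) :=
  hf.part hVG hσ (modesBelow n ((i + 1) * K) \ modesBelow n (i * K))

theorem sum_block (hf : IsRegular G δ σ h f) (hVG : V ⊆ G) (hσ : 0 < σ) (K r : ℕ) :
    ∑ i ∈ Finset.range r, hf.block hVG hσ K i = hf.part hVG hσ (modesBelow n (r * K)) := by
  classical
  induction r with
  | zero =>
    have : modesBelow n (0 * K) = ∅ := by
      ext k; simp [mem_modesBelow]
    rw [this]
    simp [part]
  | succ r ih =>
    rw [Finset.sum_range_succ, ih, block]
    have hsub : modesBelow n (r * K) ⊆ modesBelow n ((r + 1) * K) := fun k hk => by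
      rw [mem_modesBelow] at hk ⊢
      exact hk.trans_le (Nat.mul_le_mul_right K (Nat.le_succ r))
    rw [part, part, part, add_comm, ← Finset.sum_sdiff hsub]

theorem suppLt_block (hf : IsRegular G δ σ h f) (hVG : V ⊆ G) (hσ : 0 < σ) (K i : ℕ) :
    SuppLt (hf.block hVG hσ K i) ((i + 1) * K) := fun k hk => by
  classical
  rw [block, hf.part_apply hVG hσ, if_neg]
  rw [Finset.mem_sdiff, mem_modesBelow]
  omega

theorem nagumoBound_block (hf : IsRegular G δ σ h f) (hVG : V ⊆ G) (hσ : 0 < σ) (hδ : 0 ≤ δ)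
    (hC : ∀ z ∈ phaseDomain G δ (2 * σ), ‖f z‖ ≤ C) (hC0 : 0 ≤ C) (K i : ℕ) :
    NagumoBound (hf.block hVG hσ K i) 0
      (C * modeSum n σ * Real.exp (-((K : ℝ) * (σ / 2))) ^ i) := by
  classical
  refine (hf.nagumoBound_part hVG hσ hδ hC hC0 (N := i * K) fun k hk => ?_).mono (le_of_eq ?_)
  · rw [Finset.mem_sdiff, mem_modesBelow, mem_modesBelow] at hk
    omega
  · rw [← Real.exp_nat_mul]
    push_cast
    rw [show (i : ℝ) * -((K : ℝ) * (σ / 2)) = -((i : ℝ) * K * (σ / 2)) by ring]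
    ring

/-- The integrable part of the Hamiltonian, as a holomorphic function. -/
noncomputable def hHol (hf : IsRegular G δ σ h f) (hVG : V ⊆ G) : Hol (dom V δ σ 0) :=
  Hol.ofFun (fun z => h z.1) <| by
    refine hf.holo_h.comp (t := actionNhd G δ) differentiable_fst.differentiableOn fun z hz => ?_
    exact actionNhd_mono hVG (mem_dom_zero.1 hz).1

theorem dir_hHol_apply (hf : IsRegular G δ σ h f) (hVG : V ⊆ G) {z : ActTime n}
    (hz : z ∈ dom V δ σ 0) (y : ActTime n) :
    Hol.dir y (hf.hHol hVG) z = fderiv ℂ h z.1 y.1 := by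
  rw [Hol.dir_apply _ _ hz, hHol, Hol.fderiv_ofFun hz]
  have h1 : DifferentiableAt ℂ h z.1 :=
    hf.holo_h.differentiableAt (isOpen_actionNhd.mem_nhds
      (actionNhd_mono hVG (mem_dom_zero.1 hz).1))
  have h2 : HasFDerivAt (fun z : ActTime n => h z.1)
      ((fderiv ℂ h z.1).comp (ContinuousLinearMap.fst ℂ _ _)) z :=
    h1.hasFDerivAt.comp z hasFDerivAt_fst
  rw [h2.fderiv]
  rfl

theorem dir_modeDir_hHol (hf : IsRegular G δ σ h f) (hVG : V ⊆ G) {z : ActTime n}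
    (hz : z ∈ dom V δ σ 0) (k : Fin n → ℤ) :
    Hol.dir (modeDir k) (hf.hHol hVG) z = ∑ j, frequency h z.1 j * (k j : ℂ) := by
  rw [hf.dir_hHol_apply hVG hz]
  have h1 : (modeDir k).1 = ∑ j, (k j : ℂ) • EuclideanSpace.single j (1 : ℂ) := by
    ext i
    simp [modeDir, Finset.sum_apply, Pi.single_apply]
  rw [h1, map_sum]
  refine Finset.sum_congr rfl fun j _ => ?_
  rw [map_smul, frequency, smul_eq_mul, mul_comm]

/-- The expansion of the Hamiltonian: the integrable part, then the blocks. The variable conjugate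
to slow time comes with the first block; it has the coefficient `μ` in the autonomous Hamiltonian,
hence `i μ` in the normalization of `Obs`. -/
noncomputable def expansion (hf : IsRegular G δ σ h f) (hVG : V ⊆ G) (hσ : 0 < σ) (K : ℕ)
    (ε μ : ℝ) : ℕ → Obs (dom V δ σ 0)
  | 0 => ⟨Finsupp.single 0 (hf.hHol hVG), 0⟩
  | 1 => ⟨(ε : ℂ) • hf.block hVG hσ K 0, Complex.I * μ⟩
  | i + 2 => ⟨(ε : ℂ) • hf.block hVG hσ K (i + 1), 0⟩

theorem expansion_succ_fn (hf : IsRegular G δ σ h f) (hVG : V ⊆ G) (hσ : 0 < σ) (K : ℕ)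
    (ε μ : ℝ) (i : ℕ) :
    (hf.expansion hVG hσ K ε μ (i + 1)).fn = (ε : ℂ) • hf.block hVG hσ K i := by
  cases i <;> rfl

theorem sum_expansion (hf : IsRegular G δ σ h f) (hVG : V ⊆ G) (hσ : 0 < σ) (K : ℕ)
    (ε μ : ℝ) {r : ℕ} (hr : 1 ≤ r) :
    ∑ i ∈ Finset.range (r + 1), hf.expansion hVG hσ K ε μ i =
      ⟨Finsupp.single 0 (hf.hHol hVG) + (ε : ℂ) • hf.part hVG hσ (modesBelow n (r * K)),
        Complex.I * μ⟩ := by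
  ext1
  · rw [Obs.sum_fn, Finset.sum_range_succ', add_comm, ← sum_block, Finset.smul_sum]
    simp only [expansion_succ_fn]
    rfl
  · obtain ⟨r, rfl⟩ := Nat.exists_eq_add_of_le' hr
    rw [Obs.sum_eta, Finset.sum_range_succ', Finset.sum_range_succ']
    simp [expansion]

theorem isPerturbation (hf : IsRegular G δ σ h f) (hVG : V ⊆ G) (hσ : 0 < σ) (hδ : 0 ≤ δ)
    (hC : ∀ z ∈ phaseDomain G δ (2 * σ), ‖f z‖ ≤ C) (hC0 : 0 ≤ C) {M : Set (Fin n → ℤ)}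
    {α ε μ : ℝ} (hε : 0 ≤ ε) (hμ : 0 ≤ μ) {r K : ℕ}
    (hnr : IsNonResonanceDomain h V M α δ (r * K)) :
    IsPerturbation (hf.expansion hVG hσ K ε μ) (hf.hHol hVG) M α r K (ε * (C * modeSum n σ))
      (μ * δ / 2) (Real.exp (-((K : ℝ) * (σ / 2)))) where
  zero := rfl
  eta_one := by
    change ‖Complex.I * (μ : ℂ)‖ * δ / 2 ≤ _
    rw [norm_mul, Complex.norm_I, one_mul, Complex.norm_real, Real.norm_of_nonneg hμ]
  eta _ := rfl
  supp i := by
    rw [expansion_succ_fn]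
    exact (hf.suppLt_block hVG hσ K i).smul _
  bound i := by
    rw [expansion_succ_fn]
    refine ((hf.nagumoBound_block hVG hσ hδ hC hC0 K i).smul (ε : ℂ)).mono (le_of_eq ?_)
    rw [Complex.norm_real, Real.norm_of_nonneg hε]
    ring
  nonres k hk hkr z hz := by
    rw [hf.dir_modeDir_hHol hVG hz]
    exact hnr k hk hkr _ (mem_dom_zero.1 hz).1

end IsRegular

end Blocks

end SlowNekhoroshev

namespace SlowNekhoroshev

/-! ### Evaluation of observables along trajectories -/

section Evaluation

open TopologicalSpace (Opens)
open Finset hiding mem_antidiagonal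

variable {n : ℕ} {U : Opens (ActTime n)}

/-- The value of the trigonometric polynomial `∑ F_k exp(i k·φ)`. -/
noncomputable def evalTrig (z : ActTime n) (φ : Fin n → ℝ) : Trig U →ₗ[ℂ] ℂ :=
  Finsupp.lsum ℂ fun k =>
    { toFun := fun f : Hol U => f z * modeExp k φ
      map_add' := fun f g => by rw [Hol.add_apply, add_mul]
      map_smul' := fun c f => by rw [Hol.smul_apply, mul_assoc]; rfl }

theorem evalTrig_single (z : ActTime n) (φ : Fin n → ℝ) (k : Fin n → ℤ) (f : Hol U) :
    evalTrig z φ (Finsupp.single k f) = f z * modeExp k φ := by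
  rw [evalTrig, Finsupp.lsum_single]
  rfl

theorem norm_evalTrig_le_sum (z : ActTime n) (φ : Fin n → ℝ) (F : Trig U) :
    ‖evalTrig z φ F‖ ≤ ∑ k ∈ F.support, ‖F k z‖ := by
  conv_lhs => rw [← Finsupp.sum_single F, Finsupp.sum, map_sum]
  refine norm_sum_le_of_le _ fun k _ => ?_
  rw [evalTrig_single, norm_mul, norm_modeExp, mul_one]

theorem NagumoBound.norm_evalTrig_le {V : Set (EuclideanSpace ℝ (Fin n))} {δ σ : ℝ}
    {F : Trig (dom V δ σ 0)} {p : ℕ} {c : ℝ} (hF : NagumoBound F p c) (hc : 0 ≤ c)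
    {z : ActTime n} (hz : ∀ u < 1, z ∈ dom V δ σ u) (φ : Fin n → ℝ) : ‖evalTrig z φ F‖ ≤ c :=
  (norm_evalTrig_le_sum z φ F).trans (hF.sum_norm_le hc hz _)

/-- The direction of the `j`-th action. -/
noncomputable def actDir (j : Fin n) : ActTime n := (EuclideanSpace.single j 1, 0)

/-- The derivative with respect to the `j`-th action. -/
noncomputable def actDeriv (j : Fin n) : Trig U →ₗ[ℂ] Trig U :=
  Finsupp.mapRange.linearMap (Hol.dir (actDir j))

theorem actDeriv_single (j : Fin n) (k : Fin n → ℤ) (f : Hol U) :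
    actDeriv j (Finsupp.single k f) = Finsupp.single k (Hol.dir (actDir j) f) := by
  simp [actDeriv]

/-- `-i` times the derivative with respect to the `j`-th angle. -/
noncomputable def angDeriv (j : Fin n) : Trig U →ₗ[ℂ] Trig U :=
  Finsupp.lsum ℂ fun k => (k j : ℂ) • Finsupp.lsingle k

theorem angDeriv_single (j : Fin n) (k : Fin n → ℤ) (f : Hol U) :
    angDeriv j (Finsupp.single k f) = Finsupp.single k ((k j : ℂ) • f) := by
  simp [angDeriv]

theorem angDeriv_apply (j : Fin n) (F : Trig U) (k : Fin n → ℤ) :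
    angDeriv j F k = (k j : ℂ) • F k := by
  induction F using Finsupp.induction_linear with
  | zero => simp
  | add F G hF hG => rw [map_add, Finsupp.add_apply, hF, hG, Finsupp.add_apply, smul_add]
  | single l f =>
    rw [angDeriv_single]
    by_cases hkl : k = l
    · subst hkl; simp
    · rw [Finsupp.single_eq_of_ne hkl, Finsupp.single_eq_of_ne hkl, smul_zero]

theorem modeExp_add (k l : Fin n → ℤ) (φ : Fin n → ℝ) :
    modeExp (k + l) φ = modeExp k φ * modeExp l φ := by
  rw [modeExp, modeExp, modeExp, ← Complex.exp_add, ← mul_add, ← sum_add_distrib]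
  congr 2
  refine sum_congr rfl fun j _ => ?_
  rw [Pi.add_apply]
  push_cast
  ring

theorem modeDir_eq_sum (k : Fin n → ℤ) : modeDir k = ∑ j, (k j : ℂ) • actDir j := by
  refine Prod.ext ?_ ?_
  · rw [Prod.fst_sum]
    ext i
    simp [modeDir, actDir, Finset.sum_apply, Pi.single_apply]
  · rw [Prod.snd_sum]
    simp [modeDir, actDir]

theorem dir_modeDir_apply (k : Fin n → ℤ) (f : Hol U) {z : ActTime n} (hz : z ∈ U) :
    Hol.dir (modeDir k) f z = ∑ j, (k j : ℂ) * Hol.dir (actDir j) f z := by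
  rw [Hol.dir_apply _ _ hz, modeDir_eq_sum, map_sum]
  refine sum_congr rfl fun j _ => ?_
  rw [map_smul, Hol.dir_apply _ _ hz, smul_eq_mul]

/-- The algebraic bracket is `-i` times the Poisson bracket. -/
theorem evalTrig_trigBracket (F G : Trig U) {z : ActTime n} (hz : z ∈ U) (φ : Fin n → ℝ) :
    evalTrig z φ (trigBracket F G) =
      ∑ j, (evalTrig z φ (actDeriv j F) * evalTrig z φ (angDeriv j G) -
        evalTrig z φ (angDeriv j F) * evalTrig z φ (actDeriv j G)) := by
  induction F using Finsupp.induction_linear with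
  | zero => simp
  | add F F' h h' =>
    simp only [map_add, LinearMap.add_apply, h, h', ← sum_add_distrib]
    exact sum_congr rfl fun j _ => by ring
  | single k f =>
    induction G using Finsupp.induction_linear with
    | zero => simp
    | add G G' h h' =>
      simp only [map_add, h, h', ← sum_add_distrib]
      exact sum_congr rfl fun j _ => by ring
    | single l g =>
      simp only [trigBracket_single, evalTrig_single, actDeriv_single, angDeriv_single,
        modeBracket_apply, Hol.sub_apply, Hol.mul_apply, Hol.smul_apply, modeExp_add,
        dir_modeDir_apply _ _ hz, sum_sub_distrib]
      rw [sub_mul]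
      congr 1
      · rw [sum_mul, sum_mul]
        exact sum_congr rfl fun j _ => by ring
      · rw [mul_sum, sum_mul]
        exact sum_congr rfl fun j _ => by ring

/-- The derivative of an observable along a curve. -/
theorem hasDerivWithinAt_evalTrig (F : Trig U) {J : ℝ → EuclideanSpace ℂ (Fin n)} {ξ : ℝ → ℂ}
    {φ : ℝ → Fin n → ℝ} {s : Set ℝ} {t : ℝ} (hz : (J t, ξ t) ∈ U) {J' : Fin n → ℂ} {ξ' : ℂ}
    {φ' : Fin n → ℝ} (hJ : ∀ j, HasDerivWithinAt (fun t => J t j) (J' j) s t)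
    (hξ : HasDerivWithinAt ξ ξ' s t) (hφ : ∀ j, HasDerivWithinAt (fun t => φ t j) (φ' j) s t) :
    HasDerivWithinAt (fun t => evalTrig (J t, ξ t) (φ t) F)
      (∑ j, J' j * evalTrig (J t, ξ t) (φ t) (actDeriv j F) +
        ξ' * evalTrig (J t, ξ t) (φ t) (timeDeriv F) +
        Complex.I * ∑ j, φ' j * evalTrig (J t, ξ t) (φ t) (angDeriv j F)) s t := by
  induction F using Finsupp.induction_linear with
  | zero => simpa using hasDerivWithinAt_const t s (0 : ℂ)
  | add F G hF hG =>
    simp only [map_add]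
    refine (hF.add hG).congr_deriv ?_
    simp only [mul_add, sum_add_distrib]
    ring
  | single k f =>
    simp only [evalTrig_single, actDeriv_single, angDeriv_single, timeDeriv_single,
      Hol.smul_apply]
    have hJ' : HasDerivWithinAt J (WithLp.toLp 2 J') s t := by
      have h1 := (hasDerivWithinAt_pi.2 hJ)
      exact ((PiLp.continuousLinearEquiv 2 ℝ (fun _ : Fin n => ℂ)).symm :
        (Fin n → ℂ) →L[ℝ] EuclideanSpace ℂ (Fin n)).hasFDerivAt.comp_hasDerivWithinAt t h1
    have hzd : HasDerivWithinAt (fun t => (J t, ξ t)) (WithLp.toLp 2 J', ξ') s t :=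
      hJ'.prodMk hξ
    have hfd := ((f.differentiableAt hz).hasFDerivAt.restrictScalars ℝ).comp_hasDerivWithinAt t hzd
    have hdir : fderiv ℂ f (J t, ξ t) (WithLp.toLp 2 J', ξ') =
        ∑ j, J' j * Hol.dir (actDir j) f (J t, ξ t) + ξ' * Hol.dir timeDir f (J t, ξ t) := by
      have h1 : ((WithLp.toLp 2 J', ξ') : ActTime n) = ∑ j, J' j • actDir j + ξ' • timeDir := by
        refine Prod.ext ?_ ?_
        · rw [Prod.fst_add, Prod.fst_sum]
          ext i
          simp [timeDir, actDir, Finset.sum_apply, Pi.single_apply]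
        · rw [Prod.snd_add, Prod.snd_sum]
          simp [timeDir, actDir]
      rw [h1, map_add, map_sum, map_smul, Hol.dir_apply _ _ hz, smul_eq_mul]
      congr 1
      refine sum_congr rfl fun j _ => ?_
      rw [map_smul, Hol.dir_apply _ _ hz, smul_eq_mul]
    have hexp : HasDerivWithinAt (fun t => modeExp k (φ t))
        (modeExp k (φ t) * (Complex.I * ∑ j, (k j : ℂ) * (φ' j : ℂ))) s t := by
      unfold modeExp
      refine HasDerivWithinAt.cexp (HasDerivWithinAt.const_mul _ ?_)
      refine HasDerivWithinAt.fun_sum fun j _ => HasDerivWithinAt.const_mul _ ?_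
      exact (hφ j).ofReal_comp
    have h := hfd.mul hexp
    refine h.congr_deriv ?_
    change fderiv ℂ f (J t, ξ t) (WithLp.toLp 2 J', ξ') * _ + f (J t, ξ t) * _ = _
    rw [hdir]
    simp only [add_mul, sum_mul, mul_sum]
    rw [add_assoc, add_assoc]
    congr 1
    · exact sum_congr rfl fun j _ => by ring
    · congr 1
      · ring
      · exact sum_congr rfl fun j _ => by ring

end Evaluation

end SlowNekhoroshev

namespace SlowNekhoroshev

/-! ### The derivatives of the Hamiltonian and of the almost invariant observable -/

section Derivatives

open Finset hiding mem_antidiagonal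
open scoped Topology

variable {n : ℕ} {G V : Set (EuclideanSpace ℝ (Fin n))} {δ σ C : ℝ}
  {h : EuclideanSpace ℂ (Fin n) → ℂ} {f : EuclideanSpace ℂ (Fin n) × (Fin n → ℂ) × ℂ → ℂ}

theorem real_mem_dom {I : EuclideanSpace ℝ (Fin n)} (hI : I ∈ V) (hδ : 0 < δ) (hσ : 0 < σ)
    (x : ℝ) (u : ℝ) (hu : u < 1) : ((toComplex I, (x : ℂ)) : ActTime n) ∈ dom V δ σ u := by
  have h1 : 0 < (1 - u) * δ := mul_pos (by linarith) hδ
  have h2 : 0 < (1 - u) * σ := mul_pos (by linarith) hσ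
  exact mem_dom.2 ⟨Set.mem_biUnion hI (Metric.mem_ball_self h1), by simpa using h2⟩

section Bounds

variable {F : Trig (dom V δ σ 0)} {p : ℕ} {c : ℝ} {z : ActTime n}

theorem NagumoBound.norm_evalTrig_angDeriv_le (hF : NagumoBound F p c) (hc : 0 ≤ c) (hσ : 0 < σ)
    (hz : ∀ u < 1, z ∈ dom V δ σ u) (φ : Fin n → ℝ) (j : Fin n) :
    ‖evalTrig z φ (angDeriv j F)‖ ≤ 1 / σ * (p + 1) * c := by
  have h1 := hF.of_norm_le_modeLen_mul (F := angDeriv j F) hσ zero_le_one fun k z => by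
    rw [angDeriv_apply, Hol.smul_apply, norm_mul, mul_one]
    exact mul_le_mul_of_nonneg_right (norm_intCast_le_modeLen k j) (norm_nonneg _)
  rw [one_mul] at h1
  exact h1.norm_evalTrig_le (by positivity) hz φ

/-- The derivative with respect to an action is, up to a phase, the bracket with the exponential of
the conjugate angle. -/
theorem NagumoBound.norm_evalTrig_actDeriv_le (hF : NagumoBound F p c) (hc : 0 ≤ c) (hδ : 0 < δ)
    (hσ : 0 < σ) (hz : ∀ u < 1, z ∈ dom V δ σ u) (φ : Fin n → ℝ) (j : Fin n) :
    ‖evalTrig z φ (actDeriv j F)‖ ≤ bracketConst δ σ * (p + 1) * (c * Real.exp σ) := by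
  classical
  set one : Hol (dom V δ σ 0) := Hol.ofFun (fun _ => 1) (differentiableOn_const 1) with hone
  have hone1 : ∀ w ∈ dom V δ σ 0, one w = 1 := fun w hw => Hol.ofFun_apply hw
  have hz0 : z ∈ dom V δ σ 0 := hz 0 one_pos
  have hdir : ∀ y : ActTime n, Hol.dir y one = 0 := fun y => Hol.ext_on fun w hw => by
    rw [Hol.dir_apply _ _ hw, hone, Hol.fderiv_ofFun hw, Hol.zero_apply]
    simp
  have hlen : modeLen (Pi.single j 1 : Fin n → ℤ) = 1 := by
    rw [modeLen, sum_eq_single j (fun i _ hi => by rw [Pi.single_eq_of_ne hi]; rfl)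
      (fun hj => absurd (mem_univ j) hj), Pi.single_eq_same]
    rfl
  have hE : NagumoBound (Finsupp.single (Pi.single j 1) one : Trig (dom V δ σ 0)) 0
      (Real.exp σ) := by
    refine NagumoBound.of_sum_le hδ.le hσ.le (m := fun _ => 1) (fun _ => zero_le_one)
      (fun k w hw => ?_) (s := {Pi.single j 1}) (fun k hk => ?_) ?_
    · by_cases hk : k = Pi.single j 1
      · rw [hk, Finsupp.single_eq_same, hone1 w hw, norm_one]
      · rw [Finsupp.single_eq_of_ne hk, Hol.zero_apply, norm_zero]; exact zero_le_one
    · exact Finsupp.single_eq_of_ne (by simpa using hk)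
    · rw [sum_singleton, hlen]
      simp
  have hval : evalTrig z φ (SlowNekhoroshev.trigBracket F (Finsupp.single (Pi.single j 1) one)) =
      evalTrig z φ (actDeriv j F) * modeExp (Pi.single j 1) φ := by
    rw [evalTrig_trigBracket _ _ hz0]
    simp only [actDeriv_single, angDeriv_single, hdir, Finsupp.single_zero, map_zero, mul_zero,
      sub_zero, evalTrig_single, Hol.smul_apply, hone1 z hz0]
    rw [sum_eq_single j (fun i _ hi => by rw [Pi.single_eq_of_ne hi]; simp)
      (fun hj => absurd (mem_univ j) hj), Pi.single_eq_same]
    simp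
  -- the exponential has modulus one at real angles
  have hb := (hF.trigBracket hE hc hδ hσ).norm_evalTrig_le (by positivity) hz φ
  rw [hval, norm_mul, norm_modeExp, mul_one] at hb
  refine hb.trans (le_of_eq ?_)
  unfold bracketConst
  push_cast
  ring

end Bounds

theorem toComplex_add_single (I : EuclideanSpace ℝ (Fin n)) (j : Fin n) (x : ℝ) :
    toComplex (I + EuclideanSpace.single j x) =
      toComplex I + (x : ℂ) • EuclideanSpace.single j (1 : ℂ) := by
  ext i
  by_cases hij : i = j
  · subst hij; simp [toComplex]
  · simp [toComplex, hij]

theorem fderiv_evalTrig_actDir {U : TopologicalSpace.Opens (ActTime n)} (F : Trig U)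
    {z : ActTime n} (hz : z ∈ U) (φ : Fin n → ℝ) (j : Fin n) :
    DifferentiableAt ℂ (fun z => evalTrig z φ F) z ∧
      fderiv ℂ (fun z => evalTrig z φ F) z (actDir j) = evalTrig z φ (actDeriv j F) := by
  induction F using Finsupp.induction_linear with
  | zero => simp
  | add F G hF hG =>
    simp only [map_add]
    refine ⟨hF.1.fun_add hG.1, ?_⟩
    rw [fderiv_fun_add hF.1 hG.1, add_apply, hF.2, hG.2]
  | single k f =>
    simp only [evalTrig_single, actDeriv_single]
    have hf := f.differentiableAt hz
    refine ⟨hf.mul_const _, ?_⟩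
    rw [fderiv_mul_const hf, smul_apply, Hol.dir_apply _ _ hz, smul_eq_mul,
      mul_comm]

/-- A complex function of a real variable which is real near `0` has a real derivative there. -/
theorem ofReal_deriv_re {F : ℝ → ℂ} {D : ℂ} (hF : HasDerivAt F D 0)
    (him : ∀ᶠ x in 𝓝 (0 : ℝ), (F x).im = 0) : ((deriv (fun x => (F x).re) 0 : ℝ) : ℂ) = D := by
  have h1 : HasDerivAt (fun x => (F x).re) D.re 0 :=
    Complex.reCLM.hasFDerivAt.comp_hasDerivAt (0 : ℝ) hF
  have h2 : HasDerivAt (fun x => (F x).im) D.im 0 :=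
    Complex.imCLM.hasFDerivAt.comp_hasDerivAt (0 : ℝ) hF
  have h3 : HasDerivAt (fun x => (F x).im) 0 0 :=
    (hasDerivAt_const (0 : ℝ) (0 : ℝ)).congr_of_eventuallyEq him
  rw [h1.deriv]
  apply Complex.ext
  · simp
  · simpa using h3.unique h2

theorem modeExp_add_single (k : Fin n → ℤ) (φ : Fin n → ℝ) (j : Fin n) (x : ℝ) :
    modeExp k (φ + Pi.single j x) = modeExp k φ * Complex.exp (Complex.I * (k j : ℂ) * x) := by
  rw [modeExp, modeExp, ← Complex.exp_add]
  congr 1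
  have h1 : ∑ i, (k i : ℂ) * ((Pi.single j x : Fin n → ℝ) i : ℂ) = (k j : ℂ) * x := by
    rw [sum_eq_single j (fun i _ hi => by rw [Pi.single_eq_of_ne hi]; simp)
      (fun hj => absurd (mem_univ j) hj), Pi.single_eq_same]
  simp only [Pi.add_apply, Complex.ofReal_add, mul_add, sum_add_distrib, h1]
  ring

/-- Termwise differentiation of a Fourier series. -/
theorem hasDerivAt_fourierSeries {c : (Fin n → ℤ) → ℂ} {u : (Fin n → ℤ) → ℝ} (hu : Summable u)
    {j : Fin n} (hc : ∀ k, ‖(k j : ℂ)‖ * ‖c k‖ ≤ u k) {g : (Fin n → ℝ) → ℂ}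
    (hg : ∀ φ, HasSum (fun k => c k * modeExp k φ) (g φ)) (φ : Fin n → ℝ) :
    HasDerivAt (fun x : ℝ => g (φ + Pi.single j x))
      (Complex.I * ∑' k, (k j : ℂ) * (c k * modeExp k φ)) 0 := by
  have hd : ∀ (k : Fin n → ℤ) (x : ℝ), HasDerivAt (fun x : ℝ => c k * modeExp k (φ + Pi.single j x))
      (Complex.I * ((k j : ℂ) * (c k * modeExp k (φ + Pi.single j x)))) x := by
    intro k x
    simp only [modeExp_add_single]
    have h1 : HasDerivAt (fun x : ℝ => Complex.I * (k j : ℂ) * (x : ℂ))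
        (Complex.I * (k j : ℂ)) x := by
      simpa using (Complex.ofRealCLM.hasDerivAt (x := x)).const_mul (Complex.I * (k j : ℂ))
    refine ((h1.cexp.const_mul (modeExp k φ)).const_mul (c k)).congr_deriv ?_
    ring
  have hderiv := hasDerivAt_tsum (y₀ := 0) hu hd (fun k x => by
    rw [norm_mul, Complex.norm_I, one_mul, norm_mul, norm_mul, norm_modeExp, mul_one]
    exact hc k) (hg _).summable 0
  have hfun : (fun x : ℝ => g (φ + Pi.single j x)) =
      fun x => ∑' k, c k * modeExp k (φ + Pi.single j x) := funext fun x => (hg _).tsum_eq.symm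
  rw [hfun, ← tsum_mul_left]
  refine hderiv.congr_deriv (tsum_congr fun k => ?_)
  rw [Pi.single_zero, add_zero]

theorem nonneg_of_norm_le (hC : ∀ z ∈ phaseDomain G δ (2 * σ), ‖f z‖ ≤ C) (hVG : V ⊆ G)
    (hσ : 0 < σ) {z : ActTime n} (hz : z ∈ dom V δ σ 0) : 0 ≤ C :=
  (norm_nonneg _).trans (hC _ (mem_phaseDomain hVG hσ hz
    (zero_mem_angleStrip (by positivity : 0 < 2 * σ))))

namespace IsRegular

variable (hf : IsRegular G δ σ h f) (hVG : V ⊆ G)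

theorem evalTrig_part (hσ : 0 < σ) (s : Finset (Fin n → ℤ)) (z : ActTime n) (φ : Fin n → ℝ) :
    evalTrig z φ (hf.part hVG hσ s) = ∑ k ∈ s, hf.coef hVG hσ k z * modeExp k φ := by
  rw [part, map_sum]
  exact sum_congr rfl fun k _ => evalTrig_single _ _ _ _

theorem evalTrig_angDeriv_part (hσ : 0 < σ) (s : Finset (Fin n → ℤ)) (z : ActTime n)
    (φ : Fin n → ℝ) (j : Fin n) : evalTrig z φ (angDeriv j (hf.part hVG hσ s)) =
      ∑ k ∈ s, (k j : ℂ) * (hf.coef hVG hσ k z * modeExp k φ) := by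
  rw [part, map_sum, map_sum]
  refine sum_congr rfl fun k _ => ?_
  rw [angDeriv_single, evalTrig_single, Hol.smul_apply, mul_assoc]

/-- The width `2 σ` of the domain leaves decay of rate `σ` for the coefficients of an angle
derivative. -/
theorem norm_intCast_mul_coef_le (hσ : 0 < σ) (hC : ∀ z ∈ phaseDomain G δ (2 * σ), ‖f z‖ ≤ C)
    {z : ActTime n} (hz : z ∈ dom V δ σ 0) (j : Fin n) (k : Fin n → ℤ) :
    ‖(k j : ℂ)‖ * ‖hf.coef hVG hσ k z‖ ≤ C / σ * Real.exp (-(modeLen k * σ)) := by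
  have hC0 := nonneg_of_norm_le hC hVG hσ hz
  have h1 : (modeLen k : ℝ) * σ ≤ Real.exp (modeLen k * σ) :=
    (le_add_of_nonneg_right zero_le_one).trans (Real.add_one_le_exp _)
  calc ‖(k j : ℂ)‖ * ‖hf.coef hVG hσ k z‖
      ≤ modeLen k * (C * Real.exp (-(modeLen k * (2 * σ)))) :=
        mul_le_mul (norm_intCast_le_modeLen k j) (hf.norm_coef_le hVG hσ hC k hz)
          (norm_nonneg _) (by positivity)
    _ = C / σ * ((modeLen k * σ) * Real.exp (-(modeLen k * (2 * σ)))) := by field_simp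
    _ ≤ C / σ * (Real.exp (modeLen k * σ) * Real.exp (-(modeLen k * (2 * σ)))) := by gcongr
    _ = _ := by rw [← Real.exp_add]; congr 2; ring

/-- The derivative of the perturbation with respect to an angle, up to the tail of the Fourier
series. -/
theorem exists_hasDerivAt_angle (hσ : 0 < σ) (hC : ∀ z ∈ phaseDomain G δ (2 * σ), ‖f z‖ ≤ C)
    {z : ActTime n} (hz : z ∈ dom V δ σ 0) (φ : Fin n → ℝ) (j : Fin n) (N : ℕ) :
    ∃ τ : ℂ, ‖τ‖ ≤ C / σ * (Real.exp (-(N * (σ / 2))) * modeSum n σ) ∧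
      HasDerivAt (fun x : ℝ => f (z.1, fun i => ((φ + Pi.single j x : Fin n → ℝ) i : ℂ), z.2))
        (Complex.I * evalTrig z φ (angDeriv j (hf.part hVG hσ (modesBelow n N))) + τ) 0 := by
  have hC0 := nonneg_of_norm_le hC hVG hσ hz
  have hbound := hf.norm_intCast_mul_coef_le hVG hσ hC hz j
  have hsummable : Summable fun k : Fin n → ℤ => C / σ * Real.exp (-(modeLen k * σ)) := by
    have := (summable_exp_modeLen (n := n) (by positivity : 0 < 2 * σ)).mul_left (C / σ)
    simpa using this
  have hderiv := hasDerivAt_fourierSeries (c := fun k => hf.coef hVG hσ k z) hsummable hbound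
    (g := fun φ => f (z.1, fun i => (φ i : ℂ), z.2)) (fun φ => hf.hasSum_coef hVG hσ hz φ) φ
  have ha : ∀ k : Fin n → ℤ, ‖(k j : ℂ) * (hf.coef hVG hσ k z * modeExp k φ)‖ ≤
      C / σ * Real.exp (-(modeLen k * σ)) := fun k => by
    rw [norm_mul, norm_mul, norm_modeExp, mul_one]
    exact hbound k
  have hasum := (Summable.of_norm_bounded hsummable ha).hasSum
  have htail := norm_sub_sum_modesBelow_le hσ ha (by positivity) hasum N
  rw [hf.evalTrig_angDeriv_part hVG hσ]
  generalize (∑' k : Fin n → ℤ, (k j : ℂ) * (hf.coef hVG hσ k z * modeExp k φ)) = A at *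
  generalize (∑ k ∈ modesBelow n N, (k j : ℂ) * (hf.coef hVG hσ k z * modeExp k φ)) = B at *
  refine ⟨Complex.I * (A - B), ?_, hderiv.congr_deriv (by ring)⟩
  rwa [norm_mul, Complex.norm_I, one_mul]

/-- The derivative of the perturbation with respect to an action, up to the derivative of the tail
of the Fourier series, which is estimated by Cauchy's inequality. -/
theorem exists_hasDerivAt_action (hσ : 0 < σ)
    (hC : ∀ z ∈ phaseDomain G δ (2 * σ), ‖f z‖ ≤ C) (hδ : 0 < δ)
    {I : EuclideanSpace ℝ (Fin n)} (hI : I ∈ V) (ξ : ℝ) (φ : Fin n → ℝ) (j : Fin n) (N : ℕ) :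
    ∃ ρ : ℂ, ‖ρ‖ ≤ 2 * C / δ * (Real.exp (-(N * (σ / 2))) * modeSum n σ) ∧
      HasDerivAt (fun x : ℝ => f (toComplex (I + EuclideanSpace.single j x),
          fun i => (φ i : ℂ), (ξ : ℂ)))
        (evalTrig (toComplex I, (ξ : ℂ)) φ
          (actDeriv j (hf.part hVG hσ (modesBelow n N))) + ρ) 0 := by
  set z : ActTime n := (toComplex I, (ξ : ℂ)) with hzdef
  have hz : z ∈ dom V δ σ 0 := real_mem_dom hI hδ hσ ξ 0 one_pos
  have hC0 := nonneg_of_norm_le hC hVG hσ hz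
  have hφ := real_mem_angleStrip hσ φ
  let f₁ : ActTime n → ℂ := fun w => f (w.1, fun i => (φ i : ℂ), w.2)
  let P : ActTime n → ℂ := fun w => evalTrig w φ (hf.part hVG hσ (modesBelow n N))
  have hf₁ : DifferentiableOn ℂ f₁ (dom V δ σ 0) := hf.differentiableOn_actTime hVG hσ hφ
  have hP : ∀ w ∈ dom V δ σ 0, DifferentiableAt ℂ P w := fun w hw =>
    (fderiv_evalTrig_actDir _ hw φ j).1
  have htail : ∀ w ∈ dom V δ σ 0, ‖(f₁ - P) w‖ ≤
      C * (Real.exp (-(N * (σ / 2))) * modeSum n σ) := by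
    intro w hw
    simp only [Pi.sub_apply, f₁, P]
    rw [hf.evalTrig_part hVG hσ]
    refine norm_sub_sum_modesBelow_le hσ (fun k => ?_) hC0 (hf.hasSum_coef hVG hσ hw φ) N
    rw [norm_mul, norm_modeExp, mul_one]
    refine (hf.norm_coef_le hVG hσ hC k hw).trans ?_
    gcongr
    linarith
  have hmem : ∀ t : ℂ, ‖t‖ ≤ δ / 2 → z + t • actDir j ∈ dom V δ σ 0 := by
    intro t ht
    have hz2 : z ∈ dom V δ σ (1 / 2) := real_mem_dom hI hδ hσ ξ _ (by norm_num)
    refine dom_add_mem hz2 ?_ ?_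
    · rw [Prod.smul_fst, norm_smul]
      simp only [actDir, PiLp.norm_single, norm_one, mul_one]
      linarith
    · simp only [actDir, Prod.smul_snd, smul_zero, norm_zero]
      positivity
  have hd₁ : DifferentiableAt ℂ f₁ z := hf₁.differentiableAt ((dom V δ σ 0).isOpen.mem_nhds hz)
  refine ⟨fderiv ℂ (f₁ - P) z (actDir j), ?_, ?_⟩
  · refine (norm_fderiv_apply_le (dom V δ σ 0).isOpen
      (hf₁.sub fun w hw => (hP w hw).differentiableWithinAt) (by positivity : 0 < δ / 2)
      (fun t ht => hmem t ht) fun t ht => htail _ (hmem t ht)).trans (le_of_eq ?_)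
    field_simp
  · rw [fderiv_sub hd₁ (hP z hz), sub_apply,
      (fderiv_evalTrig_actDir _ hz φ j).2, add_sub_cancel]
    have hline : HasDerivAt (fun x : ℝ => z + (x : ℂ) • actDir j) (actDir j) 0 := by
      have h1 := (Complex.ofRealCLM.hasDerivAt (x := 0)).smul_const (actDir j) |>.const_add z
      simpa using h1
    have hz0 : z + ((0 : ℝ) : ℂ) • actDir j = z := by simp
    have h2 : HasFDerivAt (𝕜 := ℝ) f₁ ((fderiv ℂ f₁ z).restrictScalars ℝ)
        (z + ((0 : ℝ) : ℂ) • actDir j) := by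
      rw [hz0]; exact hd₁.hasFDerivAt.restrictScalars ℝ
    have h3 := h2.comp_hasDerivAt (0 : ℝ) hline
    refine h3.congr_of_eventuallyEq (Filter.Eventually.of_forall fun x => ?_)
    simp only [Function.comp, f₁, hzdef, toComplex_add_single]
    congr 1
    simp [actDir]

theorem hasDerivAt_h_action (hσ : 0 < σ) (hδ : 0 < δ) {I : EuclideanSpace ℝ (Fin n)}
    (hI : I ∈ V) (ξ : ℝ) (φ : Fin n → ℝ) (j : Fin n) :
    HasDerivAt (fun x : ℝ => h (toComplex (I + EuclideanSpace.single j x)))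
      (evalTrig (toComplex I, (ξ : ℂ)) φ
        (actDeriv j (Finsupp.single 0 (hf.hHol hVG) : Trig (dom V δ σ 0)))) 0 := by
  have hz : ((toComplex I, (ξ : ℂ)) : ActTime n) ∈ dom V δ σ 0 := real_mem_dom hI hδ hσ ξ 0 one_pos
  rw [actDeriv_single, evalTrig_single, hf.dir_hHol_apply hVG hz]
  have hexp : modeExp (0 : Fin n → ℤ) φ = 1 := by simp [modeExp]
  rw [hexp, mul_one]
  have hd : DifferentiableAt ℂ h (toComplex I) :=
    hf.holo_h.differentiableAt (isOpen_actionNhd.mem_nhds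
      (actionNhd_mono hVG (mem_dom_zero.1 hz).1))
  have hline : HasDerivAt (fun x : ℝ => toComplex I + (x : ℂ) • EuclideanSpace.single j (1 : ℂ))
      (EuclideanSpace.single j (1 : ℂ)) 0 := by
    have h1 := (Complex.ofRealCLM.hasDerivAt (x := 0)).smul_const
      (EuclideanSpace.single j (1 : ℂ)) |>.const_add (toComplex I)
    simpa using h1
  have h2 : HasFDerivAt (𝕜 := ℝ) h ((fderiv ℂ h (toComplex I)).restrictScalars ℝ)
      (toComplex I + ((0 : ℝ) : ℂ) • EuclideanSpace.single j (1 : ℂ)) := by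
    simpa using hd.hasFDerivAt.restrictScalars ℝ
  have h3 := h2.comp_hasDerivAt (0 : ℝ) hline
  refine h3.congr_of_eventuallyEq (Filter.Eventually.of_forall fun x => ?_)
  simp only [Function.comp, toComplex_add_single]

end IsRegular

end Derivatives

end SlowNekhoroshev

namespace SlowNekhoroshev

/-! ### The drift of the actions -/

section Drift

open Finset hiding mem_antidiagonal
open scoped Topology RealInnerProductSpace

variable {n : ℕ} {G V : Set (EuclideanSpace ℝ (Fin n))} {δ σ C : ℝ}
  {h : EuclideanSpace ℂ (Fin n) → ℂ} {f : EuclideanSpace ℂ (Fin n) × (Fin n → ℂ) × ℂ → ℂ}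

/-- The linear function `v·I` of the actions. -/
noncomputable def linHol (U : TopologicalSpace.Opens (ActTime n)) (v : EuclideanSpace ℝ (Fin n)) :
    Hol U :=
  Hol.ofFun (fun z => ∑ j, (v j : ℂ) * z.1 j) (Differentiable.differentiableOn (by fun_prop))

theorem linHol_apply {U : TopologicalSpace.Opens (ActTime n)} (v : EuclideanSpace ℝ (Fin n))
    {z : ActTime n} (hz : z ∈ U) : linHol U v z = ∑ j, (v j : ℂ) * z.1 j := Hol.ofFun_apply hz

theorem dir_linHol_apply {U : TopologicalSpace.Opens (ActTime n)} (v : EuclideanSpace ℝ (Fin n))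
    (y : ActTime n) {z : ActTime n} (hz : z ∈ U) :
    Hol.dir y (linHol U v) z = ∑ j, (v j : ℂ) * y.1 j := by
  rw [Hol.dir_apply _ _ hz, linHol, Hol.fderiv_ofFun hz]
  have h1 : HasFDerivAt (fun z : ActTime n => ∑ j, (v j : ℂ) * z.1 j)
      (∑ j, (v j : ℂ) • ((EuclideanSpace.proj j).comp
        (ContinuousLinearMap.fst ℂ (EuclideanSpace ℂ (Fin n)) ℂ))) z := by
    refine HasFDerivAt.fun_sum fun j _ => HasFDerivAt.const_mul ?_ _
    exact ((EuclideanSpace.proj j).comp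
      (ContinuousLinearMap.fst ℂ (EuclideanSpace ℂ (Fin n)) ℂ)).hasFDerivAt
  rw [h1.fderiv, _root_.sum_apply]
  rfl

theorem inner_eq_sum (v w : EuclideanSpace ℝ (Fin n)) : ⟪v, w⟫ = ∑ j, v j * w j := by
  rw [PiLp.inner_apply]
  exact sum_congr rfl fun j _ => by simp [mul_comm]

theorem abs_coord_le_norm (v : EuclideanSpace ℝ (Fin n)) (j : Fin n) : |v j| ≤ ‖v‖ :=
  PiLp.norm_apply_le v j

theorem ofReal_inner_toComplex (v I : EuclideanSpace ℝ (Fin n)) :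
    ∑ j, (v j : ℂ) * toComplex I j = ((⟪v, I⟫ : ℝ) : ℂ) := by
  rw [inner_eq_sum]
  push_cast
  rfl

/-- Along a trajectory, an observable varies according to its bracket with the truncated
Hamiltonian, up to the contribution of the tail of the perturbation. -/
theorem IsRegular.exists_hasDerivWithinAt_evalTrig (hf : IsRegular G δ σ h f) (hVG : V ⊆ G)
    (hσ : 0 < σ) (hδ : 0 < δ) (hG : IsOpen G) (hC : ∀ z ∈ phaseDomain G δ (2 * σ), ‖f z‖ ≤ C)
    {ε μ : ℝ} (hε : 0 < ε) {a b : ℝ} {I : ℝ → EuclideanSpace ℝ (Fin n)} {φ : ℝ → Fin n → ℝ}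
    (htr : IsTrajectoryOn (hamiltonian h f ε μ) I φ a b) {t : ℝ} (ht : t ∈ Set.Icc a b)
    (hI : I t ∈ V) (N : ℕ) {Φ : Obs (dom V δ σ 0)} (hΦ : Φ.eta = 0) {A P : ℝ}
    (hA : ∀ j, ‖evalTrig (toComplex (I t), ((μ * t : ℝ) : ℂ)) (φ t) (actDeriv j Φ.fn)‖ ≤ A)
    (hP : ∀ j, ‖evalTrig (toComplex (I t), ((μ * t : ℝ) : ℂ)) (φ t) (angDeriv j Φ.fn)‖ ≤ P) :
    ∃ D : ℂ, HasDerivWithinAt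
      (fun s => evalTrig (toComplex (I s), ((μ * s : ℝ) : ℂ)) (φ s) Φ.fn) D (Set.Icc a b) t ∧
      ‖D‖ ≤ ‖evalTrig (toComplex (I t), ((μ * t : ℝ) : ℂ)) (φ t)
        ⁅Φ, (⟨Finsupp.single 0 (hf.hHol hVG) + (ε : ℂ) • hf.part hVG hσ (modesBelow n N),
          Complex.I * μ⟩ : Obs (dom V δ σ 0))⁆.fn‖ +
        ε * (n * ((C / σ * A + 2 * C / δ * P) * (Real.exp (-(N * (σ / 2))) * modeSum n σ))) := by
  set z : ActTime n := (toComplex (I t), ((μ * t : ℝ) : ℂ)) with hzdef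
  have hz : z ∈ dom V δ σ 0 := real_mem_dom hI hδ hσ _ 0 one_pos
  have hC0 := nonneg_of_norm_le hC hVG hσ hz
  set T := hf.part hVG hσ (modesBelow n N) with hT
  set h₀ : Trig (dom V δ σ 0) := Finsupp.single 0 (hf.hHol hVG) with hh₀
  set E := Real.exp (-(N * (σ / 2))) * modeSum n σ with hE
  have hE0 : 0 ≤ E := mul_nonneg (Real.exp_pos _).le (modeSum_nonneg hσ)
  choose τ hτ hτd using fun j => hf.exists_hasDerivAt_angle hVG hσ hC hz (φ t) j N
  choose ρ hρ hρd using fun j => hf.exists_hasDerivAt_action hVG hσ hC hδ hI (μ * t) (φ t) j N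
  have hI' : ∀ j, HasDerivWithinAt (fun s => toComplex (I s) j)
      (-(ε * (Complex.I * evalTrig z (φ t) (angDeriv j T) + τ j))) (Set.Icc a b) t := by
    intro j
    have h1 := ((htr t ht j).1).ofReal_comp
    have h2 : HasDerivAt (fun x : ℝ => h (toComplex (I t)) + (ε : ℂ) * f (toComplex (I t),
        fun i => ((φ t + Pi.single j x : Fin n → ℝ) i : ℂ), ((μ * t : ℝ) : ℂ)))
        (ε * (Complex.I * evalTrig z (φ t) (angDeriv j T) + τ j)) 0 :=
      ((hτd j).const_mul (ε : ℂ)).const_add _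
    have h3 := ofReal_deriv_re h2 (Filter.Eventually.of_forall fun x => by
      rw [Complex.add_im, hf.real_h _ (hVG hI), Complex.im_ofReal_mul, hf.real_f _ (hVG hI)]
      simp)
    rw [← h3, ← Complex.ofReal_neg]
    exact h1
  have hφ' : ∀ j, ∃ w : ℝ, (w : ℂ) = evalTrig z (φ t) (actDeriv j h₀) +
      ε * (evalTrig z (φ t) (actDeriv j T) + ρ j) ∧
      HasDerivWithinAt (fun s => φ s j) w (Set.Icc a b) t := by
    intro j
    refine ⟨_, ?_, (htr t ht j).2⟩
    have h2 : HasDerivAt (fun x : ℝ => h (toComplex (I t + EuclideanSpace.single j x)) +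
        (ε : ℂ) * f (toComplex (I t + EuclideanSpace.single j x),
        fun i => (φ t i : ℂ), ((μ * t : ℝ) : ℂ)))
        (evalTrig z (φ t) (actDeriv j h₀) + ε * (evalTrig z (φ t) (actDeriv j T) + ρ j)) 0 :=
      (hf.hasDerivAt_h_action hVG hσ hδ hI _ (φ t) j).add ((hρd j).const_mul (ε : ℂ))
    refine ofReal_deriv_re h2 ?_
    have hcont : Filter.Tendsto (fun x : ℝ => I t + EuclideanSpace.single j x) (𝓝 0)
        (𝓝 (I t)) := by
      have h4 : Continuous fun x : ℝ => I t + x • EuclideanSpace.single j (1 : ℝ) := by fun_prop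
      have h5 := h4.tendsto 0
      rw [zero_smul, add_zero] at h5
      refine h5.congr fun x => ?_
      congr 1
      ext i
      by_cases hij : i = j
      · subst hij; simp
      · simp [hij]
    filter_upwards [hcont.eventually (hG.mem_nhds (hVG hI))] with x hx
    rw [Complex.add_im, hf.real_h _ hx, Complex.im_ofReal_mul, hf.real_f _ hx]
    simp
  choose w hw hwd using hφ'
  have hξ : HasDerivWithinAt (fun s : ℝ => ((μ * s : ℝ) : ℂ)) μ (Set.Icc a b) t := by
    have := ((hasDerivWithinAt_id t (Set.Icc a b)).const_mul μ).ofReal_comp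
    simpa using this
  refine ⟨_, hasDerivWithinAt_evalTrig Φ.fn hz hI' hξ hwd, ?_⟩
  have hbr : evalTrig z (φ t) ⁅Φ, (⟨h₀ + (ε : ℂ) • T, Complex.I * μ⟩ : Obs (dom V δ σ 0))⁆.fn =
      ∑ j, (evalTrig z (φ t) (actDeriv j Φ.fn) * (ε * evalTrig z (φ t) (angDeriv j T)) -
        evalTrig z (φ t) (angDeriv j Φ.fn) * (evalTrig z (φ t) (actDeriv j h₀) +
          ε * evalTrig z (φ t) (actDeriv j T))) +
      Complex.I * μ * evalTrig z (φ t) (timeDeriv Φ.fn) := by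
    have h1 : ∀ j, angDeriv j h₀ = 0 := fun j => by
      rw [hh₀, angDeriv_single]; simp
    rw [Obs.lie_fn, hΦ, zero_smul, sub_zero, map_add, map_smul, evalTrig_trigBracket _ _ hz]
    simp only [map_add, map_smul, h1, zero_add, smul_eq_mul]
  -- the brackets with the truncated Hamiltonian recombine, leaving the tails `τ` and `ρ`
  have hD : ∑ j, -(ε * (Complex.I * evalTrig z (φ t) (angDeriv j T) + τ j)) *
        evalTrig z (φ t) (actDeriv j Φ.fn) + μ * evalTrig z (φ t) (timeDeriv Φ.fn) +
        Complex.I * ∑ j, w j * evalTrig z (φ t) (angDeriv j Φ.fn) =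
      -Complex.I * evalTrig z (φ t)
        ⁅Φ, (⟨h₀ + (ε : ℂ) • T, Complex.I * μ⟩ : Obs (dom V δ σ 0))⁆.fn +
      ε * ∑ j, (-(τ j * evalTrig z (φ t) (actDeriv j Φ.fn)) +
        Complex.I * (ρ j * evalTrig z (φ t) (angDeriv j Φ.fn))) := by
    rw [hbr, mul_add]
    have h1 : -Complex.I * (Complex.I * μ * evalTrig z (φ t) (timeDeriv Φ.fn)) =
        μ * evalTrig z (φ t) (timeDeriv Φ.fn) := by
      linear_combination (-(μ : ℂ) * evalTrig z (φ t) (timeDeriv Φ.fn)) * Complex.I_mul_I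
    rw [h1, mul_sum, mul_sum, mul_sum]
    have h2 : ∀ x y u : ℂ, x + y + u = (x + u) + y := fun x y u => by ring
    refine (h2 _ _ _).trans (Eq.trans ?_ (h2 _ _ _).symm)
    rw [← sum_add_distrib, ← sum_add_distrib]
    congr 1
    refine sum_congr rfl fun j _ => ?_
    rw [hw j]
    ring
  rw [hD]
  refine (norm_add_le _ _).trans (add_le_add ?_ ?_)
  · rw [norm_mul, norm_neg, Complex.norm_I, one_mul]
  · rw [norm_mul, Complex.norm_real, Real.norm_of_nonneg hε.le]
    refine mul_le_mul_of_nonneg_left ?_ hε.le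
    refine (norm_sum_le_of_le _ (fun j _ => ?_)).trans (le_of_eq (b := n * ((C / σ * A +
      2 * C / δ * P) * E)) (by rw [sum_const, card_univ, Fintype.card_fin, nsmul_eq_mul]))
    refine (norm_add_le _ _).trans ?_
    rw [norm_neg, norm_mul, norm_mul, norm_mul, Complex.norm_I, one_mul]
    calc ‖τ j‖ * ‖evalTrig z (φ t) (actDeriv j Φ.fn)‖ +
          ‖ρ j‖ * ‖evalTrig z (φ t) (angDeriv j Φ.fn)‖
        ≤ (C / σ * E) * A + (2 * C / δ * E) * P := by
          refine add_le_add (mul_le_mul (hτ j) (hA j) (norm_nonneg _) (by positivity))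
            (mul_le_mul (hρ j) (hP j) (norm_nonneg _) (by positivity))
      _ = _ := by ring

/-- The smallness assumption makes the majorant series converge: the constant `2 ^ 8` in the
definition of `smallness` leaves the factor `e / 128` here. -/
theorem bracketConst_mul_le {Cf α ε μ : ℝ} {r K : ℕ} (hδ : 0 < δ) (hδ1 : δ ≤ 1) (hσ : 0 < σ)
    (hα : 0 < α) (hε : 0 ≤ ε) (hμ : 0 ≤ μ) (hCf : 0 ≤ Cf)
    (hΔ : 0 < smallness n σ Cf δ α ε μ r K) :
    bracketConst δ σ * r / α * (2 / smallness n σ Cf δ α ε μ r K) *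
      (ε * (Cf * modeSum n σ) + μ * δ / 2) ≤ 1 / 40 := by
  set Δ := smallness n σ Cf δ α ε μ r K with hΔdef
  have hF : 0 ≤ Cf * modeSum n σ := mul_nonneg hCf (modeSum_nonneg hσ)
  have he2 : 2 ≤ Real.exp 1 := by have := Real.add_one_le_exp (1 : ℝ); linarith
  have he3 : Real.exp 1 ≤ 2.72 := by have := Real.exp_one_lt_d9; linarith
  set L := lam n σ Cf ε μ with hL
  have hL' : L = μ + Real.exp 1 * (Cf * modeSum n σ) * ε := rfl
  have h1 : ε * (Cf * modeSum n σ) + μ * δ / 2 ≤ L / 2 := by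
    have h2 : 0 ≤ (Cf * modeSum n σ) * ε := by positivity
    rw [hL']
    nlinarith
  have h3 : 2 ^ 8 * (r : ℝ) / (α * δ * σ) * L ≤ Δ := by
    rw [hΔdef, smallness, ← hL]
    have : 0 < Real.exp (-((K : ℝ) * (σ / 2))) := Real.exp_pos _
    linarith
  have hκ := bracketConst_pos hδ hσ
  calc bracketConst δ σ * r / α * (2 / Δ) * (ε * (Cf * modeSum n σ) + μ * δ / 2)
      ≤ bracketConst δ σ * r / α * (2 / Δ) * (L / 2) := by gcongr
    _ = Real.exp 1 / 128 * (2 ^ 8 * (r : ℝ) / (α * δ * σ) * L / Δ) := by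
        unfold bracketConst; field_simp; ring
    _ ≤ 2.72 / 128 * 1 := by
        refine mul_le_mul (by linarith) ?_ ?_ (by norm_num)
        · rwa [div_le_one hΔ]
        · have : 0 ≤ L := by rw [hL']; positivity
          positivity
    _ ≤ 1 / 40 := by norm_num

end Drift

end SlowNekhoroshev

namespace SlowNekhoroshev

/-! ### The confinement of the actions -/

section Confinement

open Finset hiding mem_antidiagonal
open scoped Topology RealInnerProductSpace

variable {n : ℕ} {G V : Set (EuclideanSpace ℝ (Fin n))} {δ σ C : ℝ}
  {h : EuclideanSpace ℂ (Fin n) → ℂ} {f : EuclideanSpace ℂ (Fin n) × (Fin n → ℂ) × ℂ → ℂ}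

/-- A bound for the speed of the almost invariant observables, in units of `ε Δ ^ r`: the first
term comes from the bracket with the truncated Hamiltonian, the second one from the tail of the
Fourier series. -/
noncomputable def speedConst (n : ℕ) (σ C : ℝ) : ℝ :=
  C * modeSum n σ * (2 * Real.exp 1 / σ +
    n * ((1 + Real.exp 1 * Real.exp σ / (2 * σ)) / σ + 1 / (2 * σ)))

theorem speedConst_nonneg (hσ : 0 < σ) (hC : 0 ≤ C) : 0 ≤ speedConst n σ C := by
  have := modeSum_nonneg (n := n) hσ
  unfold speedConst
  positivity

/-- The drift along a direction `v` orthogonal to the resonant modes: the almost invariant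
observable built from `v·I` differs from it by at most `δ / 8` at each end, and moves at the speed
`speedConst n σ C * ε * Δ ^ r` at most. -/
theorem abs_inner_sub_le (hf : IsRegular G δ σ h f) (hG : IsOpen G) (hVG : V ⊆ G) (hσ : 0 < σ)
    (hδ : 0 < δ) (hδ1 : δ ≤ 1) (hC : ∀ z ∈ phaseDomain G δ (2 * σ), ‖f z‖ ≤ C) (hC0 : 0 ≤ C)
    {M : Set (Fin n → ℤ)} {r K : ℕ} (hr : 1 ≤ r) {α ε μ : ℝ} (hα : 0 < α) (hε : 0 < ε)
    (hμ : 0 ≤ μ) (hnr : IsNonResonanceDomain h V M α δ (r * K))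
    (hΔ1 : smallness n σ C δ α ε μ r K ≤ 1) {a b : ℝ} {I : ℝ → EuclideanSpace ℝ (Fin n)}
    {φ : ℝ → Fin n → ℝ} (htr : IsTrajectoryOn (hamiltonian h f ε μ) I φ a b)
    (hI : ∀ t ∈ Set.Icc a b, I t ∈ V) (h0 : (0 : ℝ) ∈ Set.Icc a b) {t : ℝ}
    (ht : t ∈ Set.Icc a b) {v : EuclideanSpace ℝ (Fin n)} (hv : ‖v‖ ≤ 1)
    (hvM : ∀ k ∈ M, ⟪v, intVec k⟫ = 0) :
    |⟪v, I t - I 0⟫| ≤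
      δ / 4 + speedConst n σ C * ε * smallness n σ C δ α ε μ r K ^ r * |t| := by
  set Δ := smallness n σ C δ α ε μ r K with hΔdef
  set b₀ := Real.exp (-((K : ℝ) * (σ / 2))) with hb₀
  set F₀ := C * modeSum n σ with hF₀
  have hF : 0 ≤ F₀ := mul_nonneg hC0 (modeSum_nonneg hσ)
  have hb0 : 0 < b₀ := Real.exp_pos _
  have hbΔ : 4 * b₀ ≤ Δ := by
    have h1 : 0 ≤ 2 ^ 8 * (r : ℝ) / (α * δ * σ) * lam n σ C ε μ := by
      have : 0 ≤ lam n σ C ε μ := by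
        change 0 ≤ μ + Real.exp 1 * F₀ * ε
        positivity
      positivity
    rw [hΔdef, smallness]
    linarith
  have hΔ0 : 0 < Δ := by linarith
  have hκ := bracketConst_pos hδ hσ
  set U := dom V δ σ 0 with hU
  have hvj : ∀ j, |v j| ≤ 1 := fun j => (abs_coord_le_norm v j).trans hv
  obtain ⟨Q, e, he0, hQ, hesum, hbr, hrem⟩ := (hf.isPerturbation hVG hσ hδ.le hC hC0 hε.le hμ
    hnr).exists_almost_invariant hδ hσ hα (by positivity) (by positivity) hb0.le hΔ0 hΔ1 hbΔ
    (bracketConst_mul_le hδ hδ1 hσ hα hε.le hμ hC0 hΔ0) (ℓ := linHol U v)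
    (fun k z => by
      by_cases hz : z ∈ U
      · rw [dir_linHol_apply v _ hz, ← sum_norm_eq_modeLen]
        refine norm_sum_le_of_le _ fun j _ => ?_
        rw [norm_mul, Complex.norm_real]
        exact mul_le_of_le_one_left (norm_nonneg _) (hvj j)
      · rw [Hol.apply_of_notMem _ hz, norm_zero]; positivity)
    (fun k hk => Hol.ext_on fun z hz => by
      rw [dir_linHol_apply v _ hz, Hol.zero_apply]
      have h1 : ∑ j, (v j : ℂ) * (modeDir k).1 j = ((⟪v, intVec k⟫ : ℝ) : ℂ) := by
        rw [inner_eq_sum]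
        push_cast
        exact sum_congr rfl fun j _ => by simp [modeDir, intVec]
      rw [h1, hvM k hk, Complex.ofReal_zero])
    (Hol.ext_on fun z hz => by
      rw [dir_linHol_apply v _ hz, Hol.zero_apply]
      simp [timeDir])
  rw [hf.sum_expansion hVG hσ K ε μ hr] at hbr
  set R : Obs U := ∑ s ∈ range r, Q s with hR
  set Φ : Obs U := ⟨Finsupp.single 0 (linHol U v), 0⟩ + R with hΦ
  have hRη : R.eta = 0 := by
    rw [hR, Obs.sum_eta]
    exact sum_eq_zero fun s hs => (hQ s (mem_range.1 hs)).1
  have hΦη : Φ.eta = 0 := by rw [hΦ, Obs.add_eta, hRη, add_zero]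
  have hRfn : R.fn = ∑ s ∈ range r, (Q s).fn := by rw [hR, Obs.sum_fn]
  have hΦfn : Φ.fn = Finsupp.single 0 (linHol U v) + R.fn := by rw [hΦ, Obs.add_fn]
  -- the real points of the domain
  let z : ℝ → ActTime n := fun s => (toComplex (I s), ((μ * s : ℝ) : ℂ))
  have hz : ∀ s ∈ Set.Icc a b, ∀ u < 1, z s ∈ dom V δ σ u := fun s hs u hu =>
    real_mem_dom (hI s hs) hδ hσ _ u hu
  have hz0 : ∀ s ∈ Set.Icc a b, z s ∈ U := fun s hs => hz s hs 0 one_pos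
  have hsum_e : ∑ s ∈ range r, e s ≤ 1 / 8 := by
    have h1 : ∑ s ∈ range r, 2 * e s ≤ ∑ s ∈ range r, ((s : ℝ) + 2) * e s :=
      sum_le_sum fun s _ => by nlinarith [he0 s, (Nat.cast_nonneg s : (0 : ℝ) ≤ s)]
    rw [← mul_sum] at h1
    linarith
  -- the observable is close to `v·I`
  have hRval : ∀ s ∈ Set.Icc a b, ‖evalTrig (z s) (φ s) R.fn‖ ≤ δ / 8 := by
    intro s hs
    rw [hRfn, map_sum]
    refine (norm_sum_le_of_le _ fun i hi => (hQ i (mem_range.1 hi)).2.norm_evalTrig_le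
      (mul_nonneg (he0 i) hδ.le) (hz s hs) (φ s)).trans ?_
    rw [← sum_mul]
    nlinarith
  have hcast : ∀ s : ℕ, ((s + 1 : ℕ) : ℝ) + 1 = (s : ℝ) + 2 := fun s => by push_cast; ring
  -- its derivatives are bounded, so that the tail of the perturbation acts on it weakly
  have hA : ∀ s ∈ Set.Icc a b, ∀ j, ‖evalTrig (z s) (φ s) (actDeriv j Φ.fn)‖ ≤
      1 + Real.exp 1 * Real.exp σ / (2 * σ) := by
    intro s hs j
    rw [hΦfn, map_add, map_add]
    refine (norm_add_le _ _).trans (add_le_add ?_ ?_)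
    · rw [actDeriv_single, evalTrig_single, norm_mul, norm_modeExp, mul_one,
        dir_linHol_apply v _ (hz0 s hs)]
      have h1 : ∑ i, (v i : ℂ) * (actDir (n := n) j).1 i = v j := by
        rw [sum_eq_single j (fun i _ hi => by simp [actDir, hi])
          (fun hj => absurd (mem_univ j) hj)]
        simp [actDir]
      rw [h1, Complex.norm_real]
      exact hvj j
    · rw [hRfn, map_sum, map_sum]
      refine (norm_sum_le_of_le _ fun i hi => (hQ i (mem_range.1 hi)).2.norm_evalTrig_actDeriv_le
        (mul_nonneg (he0 i) hδ.le) hδ hσ (hz s hs) (φ s) j).trans ?_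
      calc ∑ i ∈ range r, bracketConst δ σ * (((i + 1 : ℕ) : ℝ) + 1) * (e i * δ * Real.exp σ)
          = bracketConst δ σ * δ * Real.exp σ * ∑ i ∈ range r, ((i : ℝ) + 2) * e i := by
            rw [mul_sum]
            exact sum_congr rfl fun i _ => by rw [hcast]; ring
        _ ≤ bracketConst δ σ * δ * Real.exp σ * (1 / 4) := by gcongr
        _ = _ := by unfold bracketConst; field_simp; ring
  have hP : ∀ s ∈ Set.Icc a b, ∀ j, ‖evalTrig (z s) (φ s) (angDeriv j Φ.fn)‖ ≤ δ / (4 * σ) := by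
    intro s hs j
    have h1 : angDeriv j (Finsupp.single 0 (linHol U v)) = 0 := by
      rw [angDeriv_single]; simp
    rw [hΦfn, map_add, h1, zero_add, hRfn, map_sum, map_sum]
    refine (norm_sum_le_of_le _ fun i hi => (hQ i (mem_range.1 hi)).2.norm_evalTrig_angDeriv_le
        (mul_nonneg (he0 i) hδ.le) hσ (hz s hs) (φ s) j).trans ?_
    calc ∑ i ∈ range r, 1 / σ * (((i + 1 : ℕ) : ℝ) + 1) * (e i * δ)
        = δ / σ * ∑ i ∈ range r, ((i : ℝ) + 2) * e i := by
          rw [mul_sum]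
          exact sum_congr rfl fun i _ => by rw [hcast]; ring
      _ ≤ δ / σ * (1 / 4) := by gcongr
      _ = _ := by field_simp
  -- its bracket with the truncated Hamiltonian is of size `ε Δ ^ r`
  have hB : ∀ s ∈ Set.Icc a b, ‖evalTrig (z s) (φ s) ⁅Φ, (⟨Finsupp.single 0 (hf.hHol hVG) +
      (ε : ℂ) • hf.part hVG hσ (modesBelow n (r * K)), Complex.I * μ⟩ : Obs U)⁆.fn‖ ≤
      2 * Real.exp 1 / σ * (ε * F₀ * Δ ^ r) := by
    intro s hs
    rw [hbr, Obs.sum_fn, map_sum]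
    calc _ ≤ ∑ i ∈ range r, ∑ l ∈ range r, (bracketConst δ σ * δ * if r ≤ i + 1 + l then
          ((i : ℝ) + 2) * e i * pertMajorant (ε * F₀) (μ * δ / 2) b₀ l else 0) := by
          refine norm_sum_le_of_le _ fun i hi => ?_
          rw [Obs.sum_fn, map_sum]
          refine norm_sum_le_of_le _ fun l hl => ?_
          have hpm := pertMajorant_nonneg (F := ε * F₀) (m := μ * δ / 2) (b := b₀)
            (by positivity) (by positivity) hb0.le l
          have hei := he0 i
          split_ifs with hil
          · have h1 := (hf.isPerturbation hVG hσ hδ.le hC hC0 hε.le hμ hnr).adBound hδ hσ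
              (by positivity) l (i + 1) (e i * δ) (Q i) (hQ i (mem_range.1 hi)).1
              (by positivity) (hQ i (mem_range.1 hi)).2
            refine (h1.norm_evalTrig_le (by positivity) (hz s hs) (φ s)).trans (le_of_eq ?_)
            rw [hcast]
            push_cast
            ring
          · simp
      _ = bracketConst δ σ * δ * ∑ i ∈ range r, ∑ l ∈ range r, (if r ≤ i + 1 + l then
          ((i : ℝ) + 2) * e i * pertMajorant (ε * F₀) (μ * δ / 2) b₀ l else 0) := by
          simp only [mul_sum]
      _ ≤ bracketConst δ σ * δ * (ε * F₀ * Δ ^ r) := by gcongr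
      _ = _ := by unfold bracketConst; field_simp
  have hE : Real.exp (-(((r * K : ℕ) : ℝ) * (σ / 2))) ≤ Δ ^ r := by
    have h1 : Real.exp (-(((r * K : ℕ) : ℝ) * (σ / 2))) = b₀ ^ r := by
      rw [hb₀, ← Real.exp_nat_mul]
      push_cast
      ring_nf
    rw [h1]
    exact pow_le_pow_left₀ hb0.le (by linarith) r
  have hderiv : ∀ s ∈ Set.Icc a b, ∃ D : ℂ,
      HasDerivWithinAt (fun s => evalTrig (z s) (φ s) Φ.fn) D (Set.Icc a b) s ∧
      ‖D‖ ≤ speedConst n σ C * ε * Δ ^ r := by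
    intro s hs
    obtain ⟨D, hD, hDb⟩ := hf.exists_hasDerivWithinAt_evalTrig hVG hσ hδ hG hC hε htr hs (hI s hs)
      (r * K) hΦη (hA s hs) (hP s hs)
    have hm := modeSum_nonneg (n := n) hσ
    refine ⟨D, hD, hDb.trans ((add_le_add (hB s hs) (?_ : _ ≤ ε * (n * ((C / σ *
      (1 + Real.exp 1 * Real.exp σ / (2 * σ)) + 2 * C / δ * (δ / (4 * σ))) *
      (Δ ^ r * modeSum n σ))))).trans (le_of_eq ?_))⟩
    · gcongr
    · rw [speedConst, hF₀]
      field_simp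
      ring
  choose! D hD hDb using hderiv
  have hmv := (convex_Icc a b).norm_image_sub_le_of_norm_hasDerivWithin_le hD hDb h0 ht
  have hval : ∀ s ∈ Set.Icc a b, evalTrig (z s) (φ s) Φ.fn =
      ((⟪v, I s⟫ : ℝ) : ℂ) + evalTrig (z s) (φ s) R.fn := by
    intro s hs
    have hexp : modeExp (0 : Fin n → ℤ) (φ s) = 1 := by simp [modeExp]
    rw [hΦfn, map_add, evalTrig_single, hexp, mul_one, linHol_apply v (hz0 s hs),
      ← ofReal_inner_toComplex]
  rw [hval t ht, hval 0 h0] at hmv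
  have h2 : ((⟪v, I t - I 0⟫ : ℝ) : ℂ) =
      ((((⟪v, I t⟫ : ℝ) : ℂ) + evalTrig (z t) (φ t) R.fn) -
      (((⟪v, I 0⟫ : ℝ) : ℂ) + evalTrig (z 0) (φ 0) R.fn)) -
      evalTrig (z t) (φ t) R.fn + evalTrig (z 0) (φ 0) R.fn := by
    rw [inner_sub_right]
    push_cast
    ring
  rw [← Real.norm_eq_abs, ← Complex.norm_real, h2]
  refine (norm_add_le _ _).trans ((add_le_add (norm_sub_le _ _) le_rfl).trans ?_)
  have h3 := hRval t ht
  have h4 := hRval 0 h0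
  rw [sub_zero, Real.norm_eq_abs] at hmv
  linarith

end Confinement

end SlowNekhoroshev


theorem corollary4p1 (n : ℕ) (σ Cf : ℝ) (hσ : 0 < σ) (hσ1 : σ ≤ 1) :
    ∃ C₁ : ℝ, 0 < C₁ ∧
      ∀ (δ : ℝ), 0 < δ → δ ≤ 1 →
      ∀ (G : Set (EuclideanSpace ℝ (Fin n))), IsOpen G →
      ∀ (h : EuclideanSpace ℂ (Fin n) → ℂ)
        (f : EuclideanSpace ℂ (Fin n) × (Fin n → ℂ) × ℂ → ℂ),
        SlowNekhoroshev.IsRegular G δ σ h f →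
        SlowNekhoroshev.supNorm G δ (2 * σ) f = Cf →
      ∀ (M : Set (Fin n → ℤ)), SlowNekhoroshev.IsResonanceModule M →
      ∀ (r K : ℕ), 1 ≤ r → 1 ≤ K →
      ∀ (α ε μ : ℝ), 0 < α → 0 < ε → 0 ≤ μ →
      ∀ (V : Set (EuclideanSpace ℝ (Fin n))), V ⊆ G →
        SlowNekhoroshev.IsNonResonanceDomain h V M α δ (r * K) →
        SlowNekhoroshev.smallness n σ Cf δ α ε μ r K ≤ 1 / 2 →
        (8 + 3 * Real.exp 1 ^ 2)⁻¹ ≤ Real.exp (-((K : ℝ) * (σ / 2))) →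
      ∀ (a b : ℝ), a < 0 → 0 < b →
      ∀ (I : ℝ → EuclideanSpace ℝ (Fin n)) (φ : ℝ → Fin n → ℝ),
        SlowNekhoroshev.IsTrajectoryOn (SlowNekhoroshev.hamiltonian h f ε μ) I φ a b →
        (∀ t ∈ Set.Icc a b, I t ∈ V) →
      ∀ tstar : ℝ,
        tstar = Real.exp 1 ^ 2 * δ /
          (C₁ * ε * SlowNekhoroshev.smallness n σ Cf δ α ε μ r K ^ r) →
      ∀ t ∈ Set.Icc a b ∩ Set.Icc (-tstar) tstar,
        Metric.infDist (I t) (SlowNekhoroshev.fastDriftPlane M (I 0)) ≤ δ / 2 := by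
  have habs : 0 ≤ |Cf| := abs_nonneg Cf
  have hS0 := SlowNekhoroshev.speedConst_nonneg (n := n) hσ habs
  -- `|Cf|` and the summand `1` keep the constant positive for every value of `Cf`
  refine ⟨4 * Real.exp 1 ^ 2 * SlowNekhoroshev.speedConst n σ |Cf| + 1, by positivity, ?_⟩
  intro δ hδ hδ1 G hG h f hf hCf M _ r K hr _ α ε μ hα hε hμ V hVG hnr hΔ _ a b ha hb I φ htr hI
    tstar htstar t ht
  obtain ⟨B, hB⟩ := hf.bdd_f
  have hC0 : 0 ≤ Cf := hCf ▸ Real.iSup_nonneg fun _ => norm_nonneg _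
  rw [abs_of_nonneg hC0] at htstar hS0
  have hC : ∀ z ∈ SlowNekhoroshev.phaseDomain G δ (2 * σ), ‖f z‖ ≤ Cf := fun z hz => by
    rw [← hCf]
    exact le_ciSup (f := fun z : SlowNekhoroshev.phaseDomain G δ (2 * σ) => ‖f z‖)
      ⟨B, by rintro _ ⟨w, rfl⟩; exact hB w w.2⟩ ⟨z, hz⟩
  set S := SlowNekhoroshev.realSpan M with hS
  set w := I t - I 0 with hw
  -- the displacement orthogonal to the plane; its direction is the test vector
  set u := w - S.starProjection w with hu
  have hdist : Metric.infDist (I t) (SlowNekhoroshev.fastDriftPlane M (I 0)) ≤ ‖u‖ := by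
    have hmem : I 0 + S.starProjection w ∈ SlowNekhoroshev.fastDriftPlane M (I 0) := by
      change I 0 + S.starProjection w - I 0 ∈ S
      rw [add_sub_cancel_left]
      exact Submodule.starProjection_apply_mem S w
    refine (Metric.infDist_le_dist_of_mem hmem).trans (le_of_eq ?_)
    rw [dist_eq_norm, hu, hw]
    congr 1
    abel
  refine hdist.trans ?_
  rcases eq_or_ne u 0 with hu0 | hu0
  · rw [hu0, norm_zero]; positivity
  have hupos : 0 < ‖u‖ := norm_pos_iff.2 hu0
  have hperp : ∀ x ∈ S, inner ℝ u x = 0 := fun x hx =>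
    Submodule.inner_left_of_mem_orthogonal hx (Submodule.sub_starProjection_mem_orthogonal w)
  have hinner : inner ℝ (‖u‖⁻¹ • u) w = ‖u‖ := by
    have h1 : inner ℝ u w = ‖u‖ ^ 2 := by
      have h2 : w = u + S.starProjection w := by rw [hu]; abel
      rw [h2, inner_add_right, hperp _ (Submodule.starProjection_apply_mem S w), add_zero,
        real_inner_self_eq_norm_sq]
    rw [real_inner_smul_left, h1]
    field_simp
  have hkey := SlowNekhoroshev.abs_inner_sub_le hf hG hVG hσ hδ hδ1 hC hC0 hr hα hε hμ hnr
    (by linarith) htr hI ⟨ha.le, hb.le⟩ ht.1 (v := ‖u‖⁻¹ • u)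
    (by rw [norm_smul, norm_inv, norm_norm, inv_mul_cancel₀ hupos.ne'])
    (fun k hk => by
      rw [real_inner_smul_left, hperp _ (Submodule.subset_span ⟨k, hk, rfl⟩), mul_zero])
  rw [hinner, abs_of_pos hupos] at hkey
  refine hkey.trans ?_
  have hΔ0 : 0 < SlowNekhoroshev.smallness n σ Cf δ α ε μ r K := by
    have h1 : 0 ≤ SlowNekhoroshev.lam n σ Cf ε μ := by
      have := mul_nonneg hC0 (SlowNekhoroshev.modeSum_nonneg (n := n) hσ)
      change 0 ≤ μ + Real.exp 1 * (Cf * SlowNekhoroshev.modeSum n σ) * ε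
      positivity
    unfold SlowNekhoroshev.smallness
    positivity
  set Δ := SlowNekhoroshev.smallness n σ Cf δ α ε μ r K
  set s := SlowNekhoroshev.speedConst n σ Cf
  have ht' : |t| ≤ tstar := abs_le.2 ht.2
  calc δ / 4 + s * ε * Δ ^ r * |t| ≤ δ / 4 + s * ε * Δ ^ r * tstar := by gcongr
    _ = δ / 4 + δ / 4 * (4 * Real.exp 1 ^ 2 * s / (4 * Real.exp 1 ^ 2 * s + 1)) := by
        rw [htstar]; field_simp
    _ ≤ δ / 4 + δ / 4 * 1 := by
        gcongr
        rw [div_le_one (by positivity)]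
        linarith
    _ = δ / 2 := by ring
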